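/- **Model.** A server moves in one direction with speed $\alpha>0$ on a circle of length $L>0$, identified with $[0,L)$, and stops only to serve users. External users arrive according to a Poisson process of rate $\lambda>0$. A user requests at most $N\ge 1$ services: he requests service $0$, and after service $j-1$ ($1\le j<N$) he is rerouted, with probability $\epsilon_j\in[0,1]$ and independently of everything else, to service $j$; otherwise he leaves. The position $Q_j\in[0,L)$ of service $j$ has law $P_{Q_j}$, which is the sum of finitely many atoms and a part that is absolutely continuous with respect to Lebesgue measure, independently of everything else; given $Q_j=q$ the duration $B_{Q_j}\ge 0$ of the service has a law that depends on $q$ (and $j$) only. Put $\bar b^{(2)}_j=E[B_{Q_j}^2]$. For $\sigma\in\{1,2,\dots\}$ let $\delta^\sigma(q)=\lfloor \sigma q/L\rfloor\,L/\sigma$, and let $\delta^\infty(q)=q$. In the $\sigma$-system the users of position $q$ are served when the server is at $\delta^\sigma(q)$; $\sigma<\infty$ is a discretized system and $\sigma=\infty$ is the mixed system. At each point the server visits successively the queues of the users waiting there for service $N-1,\dots,1,0$, each with gated service (only users who are in the queue when its visit starts are served in that visit). A rerouted user is served the next time the server gets to his queue. Let $\phi^\sigma_n(q)$ be the time at which,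 in cycle $n$, the server starts the queue of external users (those waiting for service $0$) at the point $\delta^\sigma(q)$; cycle $n$ starts at $\phi_n^\sigma(0)$. Let $C^\sigma_n(q)=\phi^\sigma_{n+1}(q)-\phi^\sigma_n(q)$ be the cycle time with respect to $q$, and let $c_*^{(\sigma 2)}(q)=E^0[(C^\sigma_n(q))^2]\in[0,\infty]$ be its second moment in the Palm stationary regime, that is, when the system is observed from a time at which a cycle starts and the sequence, indexed by $n$, of the configurations of waiting users at the times $\phi_n^\sigma(0)$ and of the cycle times $C_n^\sigma(\cdot)$ is stationary. **Theorem.** For all $N,L,\alpha,\lambda,(\epsilon_j),(P_{Q_j})$ there is a threshold $\bar\pi_b^{(2)}>0$ such that the following holds for all laws of the service times with $\bar b_j^{(2)}<\bar\pi_b^{(2)}$ for every $j<N$. Consider the systems $\sigma\in\{1,2,\dots\}\cup\{\infty\}$, each in a Palm stationary regime. There is a subsequence $\sigma_k\to\infty$ of the positive integers with $$P_{Q_0}\Big(c_*^{(\infty 2)}(Q_0)<\infty\ \text{ and }\ \big|c_*^{(\sigma_k 2)}(Q_0)-c_*^{(\infty 2)}(Q_0)\big|\to 0 \text{ as } k\to\infty\Big)=1,$$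 and there are $\bar\sigma<\infty$ and $\bar\omega<\infty$ such that $c_*^{(\sigma_k 2)}(q)\le\bar\omega$ for all $q\in[0,L)$ and all $k$ with $\sigma_k>\bar\sigma$. -/

import Mathlib

open MeasureTheory ProbabilityTheory Filter Topology Set
open scoped ENNReal NNReal

noncomputable section

namespace Polling

/-- The attributes of a user, one entry for each possible service `j < N`: the position at which
the `j`-th service is requested, its duration, and a coin that tells whether the user is rerouted
to service `j` after having completed service `j - 1` (the coin of service `0` is not used, every
user requests that service). -/
abbrev Mark (N : ℕ) : Type := Fin N → (ℝ × ℝ≥0) × Bool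

/-- A user together with his class `j`: he has been rerouted `j` times, and his next service is
number `j`. An external arrival has class `0`. -/
abbrev User (N : ℕ) : Type := Fin N × Mark N

/-- A configuration of users, as a counting measure on `User N`. -/
abbrev Config (N : ℕ) : Type := Measure (User N)

/-- The randomness of the system observed from the time `0` at which a cycle starts: the
configuration of the users that are then waiting, and the inter-arrival times and marks of the
later external arrivals. -/
abbrev Path (N : ℕ) : Type := Config N × (ℕ → ℝ × Mark N)

variable {N : ℕ}

/-- Position of the `j`-th service. -/
def pos (m : Mark N) (j : Fin N) : ℝ := (m j).1.1

/-- Duration of the `j`-th service. -/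
def svc (m : Mark N) (j : Fin N) : ℝ≥0 := (m j).1.2

/-- The index `j - 1` (and `0` for `j = 0`). -/
def prev (j : Fin N) : Fin N := ⟨j.1 - 1, by omega⟩

/-- The user `u` goes through his service number `j`: he is rerouted after each service from his
current one to service `j - 1`. -/
def Attends (u : User N) (j : Fin N) : Prop :=
  u.1 ≤ j ∧ ∀ i, u.1 < i → i ≤ j → (u.2 i).2 = true

/-- Everything that specifies a mixed polling system with rerouting, apart from the service times:
a circle of length `L`, mapped to `[0, L)`, on which the server moves with speed `α`; the rate
`lam` of the Poisson process of external arrivals; the rerouting probabilities `ε j`, `1 ≤ j`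
(`ε 0` plays no role); the distributions `P j` of the positions `Q_j`, each of which is the sum of
finitely many atoms and of an absolutely continuous measure. -/
structure Network (N : ℕ) where
  L : ℝ
  α : ℝ
  lam : ℝ
  ε : Fin N → ℝ
  P : Fin N → Measure ℝ
  L_pos : 0 < L
  α_pos : 0 < α
  lam_pos : 0 < lam
  ε_mem : ∀ j, ε j ∈ Icc (0 : ℝ) 1
  isProb : ∀ j, IsProbabilityMeasure (P j)
  mixed : ∀ j, ∃ (A : Finset ℝ) (p : ℝ → ℝ≥0) (f : ℝ → ℝ≥0∞),
    (A : Set ℝ) ⊆ Ico 0 L ∧ Measurable f ∧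
      P j = ∑ x ∈ A, p x • Measure.dirac x + (volume.restrict (Ico 0 L)).withDensity f

namespace Network

variable (S : Network N)

instance (j : Fin N) : IsProbabilityMeasure (S.P j) := S.isProb j

/-- Law of the coin that decides whether a user is rerouted for the `j`-th time. -/
def coin (j : Fin N) : Measure Bool :=
  ENNReal.ofReal (S.ε j) • Measure.dirac true + ENNReal.ofReal (1 - S.ε j) • Measure.dirac false

instance (j : Fin N) : IsProbabilityMeasure (S.coin j) := by
  constructor
  simp only [coin, Measure.add_apply, Measure.smul_apply, measure_univ, smul_eq_mul, mul_one]
  rw [← ENNReal.ofReal_add (S.ε_mem j).1 (by linarith [(S.ε_mem j).2])]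
  simp

section Law

/- `κ j q` is the law of the service time `B_{Q_j}` given that `Q_j = q`. -/
variable (κ : Fin N → Kernel ℝ ℝ≥0)

/-- The (unconditional) second moment of the `j`-th service time. -/
def secondMoment (j : Fin N) : ℝ≥0∞ := ∫⁻ q, ∫⁻ b, (b : ℝ≥0∞) ^ 2 ∂κ j q ∂S.P j

/-- Law of the mark of an external arrival. -/
def markLaw : Measure (Mark N) := Measure.pi fun j => (S.P j ⊗ₘ κ j).prod (S.coin j)

instance isProbabilityMeasure_exp : IsProbabilityMeasure (expMeasure S.lam) :=
  isProbabilityMeasure_expMeasure S.lam_pos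

variable [∀ j, IsMarkovKernel (κ j)]

instance : IsProbabilityMeasure (S.markLaw κ) := by
  unfold markLaw; infer_instance

/-- Law of the external arrivals after time `0`: a Poisson process of rate `lam` with independent
and identically distributed marks. -/
def arrivalLaw : Measure (ℕ → ℝ × Mark N) :=
  Measure.infinitePi fun _ => (expMeasure S.lam).prod (S.markLaw κ)

end Law

/-- `δ^σ(q)`, the point at which the server serves the users of position `q`, for the system with
`σ` discretization levels; `σ = ⊤` is the mixed system. -/
def delta (σ : ℕ∞) (q : ℝ) : ℝ :=
  if σ = ⊤ then q else ⌊q * σ.toNat / S.L⌋ * (S.L / σ.toNat)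

/-- The queue of the class `j` users at point `r` is visited in cycle `m` before the queue of the
class `0` (external) users at point `p` is visited in cycle `n`. At each stop the queues are visited
in the order `N - 1, …, 1, 0` of the classes. -/
def Precedes (m : ℕ) (r : ℝ) (j : Fin N) (n : ℕ) (p : ℝ) : Prop :=
  m < n ∨ m = n ∧ (r < p ∨ r = p ∧ 0 < j.1)

/-- The cycle in which the user `u` gets his `j`-th service, if `n₀` is the cycle in which he gets
his next one. A user who is rerouted to class `i` is served the next time that the server gets to
the class `i` queue of his stop. This is in the same cycle if that stop is ahead, and in the next
cycle if it is the current stop or one behind. -/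
def serviceCycle (σ : ℕ∞) (n₀ : ℕ) (u : User N) (j : Fin N) : ℕ :=
  n₀ + Set.ncard {i | u.1 < i ∧ i ≤ j ∧ S.delta σ (pos u.2 i) ≤ S.delta σ (pos u.2 (prev i))}

/-- The `j`-th service of the user `u` comes before the start of the external queue of point `p` in
cycle `n`, if his next service takes place in the first cycle of the set `A`. (The condition
gets more restrictive as `n₀` grows, so that only the least `n₀` in `A` matters.) -/
def ServedBefore (σ : ℕ∞) (A : Set ℕ) (u : User N) (j : Fin N) (n : ℕ) (p : ℝ) : Prop :=
  ∃ n₀ ∈ A, Precedes (S.serviceCycle σ n₀ u j) (S.delta σ (pos u.2 j)) j n p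

open scoped Classical in
/-- Total service received by the user `u` before the external queue of point `p` is started in
cycle `n`. -/
def workBefore (σ : ℕ∞) (A : Set ℕ) (u : User N) (n : ℕ) (p : ℝ) : ℝ≥0∞ :=
  ∑ j, if Attends u j ∧ S.ServedBefore σ A u j n p then (svc u.2 j : ℝ≥0∞) else 0

theorem workBefore_mono (σ : ℕ∞) {A A' : Set ℕ} (h : A ⊆ A') (u : User N) (n : ℕ) (p : ℝ) :
    S.workBefore σ A u n p ≤ S.workBefore σ A' u n p := by
  classical
  refine Finset.sum_le_sum fun j _ => ?_
  split_ifs with h₁ h₂ h₂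
  · exact le_rfl
  · obtain ⟨ha, n₀, hn, hp⟩ := h₁
    exact absurd ⟨ha, n₀, h hn, hp⟩ h₂
  · exact zero_le
  · exact le_rfl

open scoped Classical in
/-- The contribution of the user `u` to the configuration of the users that are waiting when cycle
`n` starts, i.e. at the start of the external queue of point `0`; `arrived` tells whether `u` is in
the system by then. The sum has at most one nonzero term. -/
def waiting (σ : ℕ∞) (A : Set ℕ) (arrived : Prop) (u : User N) (n : ℕ) : Config N :=
  ∑ j, if Attends u j ∧ (if j = u.1 then arrived else S.ServedBefore σ A u (prev j) n 0) ∧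
      ¬ S.ServedBefore σ A u j n 0 then Measure.dirac (j, u.2) else 0

/-- The cycle in which a user gets his next service if he is waiting at the start of the external
queue of point `0` in cycle `0`: in cycle `0`, unless he waits in one of the queues of point `0` that
the server has just visited. -/
def initialCycle (σ : ℕ∞) (u : User N) : Set ℕ :=
  {n₀ | n₀ = if S.delta σ (pos u.2 u.1) = 0 ∧ 0 < u.1.1 then 1 else 0}

variable [NeZero N]

/-- Arrival time of the `k`-th external user after time `0`. -/
def arrivalTime (ω : Path N) (k : ℕ) : ℝ := ∑ i ∈ Finset.range (k + 1), (ω.2 i).1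

/-- The `k`-th external user after time `0`. -/
def arrival (ω : Path N) (k : ℕ) : User N := (0, (ω.2 k).2)

/-- The cycles in which the external queue of the `k`-th external user is started after his
arrival, if `g n p` is the time at which the external queue of point `p` is started in cycle `n`.
He is served in the first of these (gated service). -/
def openCycles (σ : ℕ∞) (ω : Path N) (g : ℕ → ℝ → ℝ≥0∞) (k : ℕ) : Set ℕ :=
  {n₀ | ENNReal.ofReal (arrivalTime ω k) < g n₀ (S.delta σ (pos (ω.2 k).2 0))}

theorem openCycles_mono (σ : ℕ∞) (ω : Path N) {g g' : ℕ → ℝ → ℝ≥0∞} (h : g ≤ g') (k : ℕ) :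
    S.openCycles σ ω g k ⊆ S.openCycles σ ω g' k :=
  fun _ hn => lt_of_lt_of_le hn (h _ _)

/-- If `g n p` is the time at which the external queue of point `p` is started in cycle `n`, then it
is the sum of the travel time and of the durations of all services before: this is the equation
`S.dynamics σ ω g = g`. -/
def dynamics (σ : ℕ∞) (ω : Path N) (g : ℕ → ℝ → ℝ≥0∞) (n : ℕ) (p : ℝ) : ℝ≥0∞ :=
  ENNReal.ofReal ((n * S.L + p) / S.α)
    + ∫⁻ u, S.workBefore σ (S.initialCycle σ u) u n p ∂ω.1
    + ∑' k, S.workBefore σ (S.openCycles σ ω g k) (arrival ω k) n p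

theorem dynamics_mono (σ : ℕ∞) (ω : Path N) : Monotone (S.dynamics σ ω) := by
  intro g g' h n p
  unfold dynamics
  gcongr with k
  exact S.workBefore_mono _ (S.openCycles_mono σ ω h k) _ _ _

/-- The times at which the external queues are started. The equation of `dynamics` determines them
step by step; the least solution never counts a service that has not been caused. -/
def startTime (σ : ℕ∞) (ω : Path N) : ℕ → ℝ → ℝ≥0∞ :=
  OrderHom.lfp ⟨S.dynamics σ ω, S.dynamics_mono σ ω⟩

theorem dynamics_startTime (σ : ℕ∞) (ω : Path N) :
    S.dynamics σ ω (S.startTime σ ω) = S.startTime σ ω :=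
  OrderHom.map_lfp ⟨S.dynamics σ ω, S.dynamics_mono σ ω⟩

/-- The time `φ_n^σ(q)` at which the server starts, in cycle `n`, the service of the external queue
to which the point `q` belongs. Cycle `0` starts at time `0`. The order of service within a queue
has no influence on this time. -/
def epoch (σ : ℕ∞) (ω : Path N) (n : ℕ) (q : ℝ) : ℝ≥0∞ :=
  S.startTime σ ω n (S.delta σ q)

/-- The cycle time `C_n^σ(q)` with respect to the point `q`. -/
def cycleTime (σ : ℕ∞) (ω : Path N) (n : ℕ) (q : ℝ) : ℝ≥0∞ :=
  S.epoch σ ω (n + 1) q - S.epoch σ ω n q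

/-- The configuration of the users that are waiting when cycle `n` starts, that is at time
`φ_n^σ(0)`. -/
def state (σ : ℕ∞) (ω : Path N) (n : ℕ) : Config N :=
  ω.1.bind (fun u => S.waiting σ (S.initialCycle σ u) True u n)
    + Measure.sum fun k => S.waiting σ (S.openCycles σ ω (S.startTime σ ω) k)
        (ENNReal.ofReal (arrivalTime ω k) < S.epoch σ ω n 0) (arrival ω k) n

section Stationarity

variable (κ : Fin N → Kernel ℝ ℝ≥0) [∀ j, IsMarkovKernel (κ j)]

/-- The Palm stationary regime: `ν` is the law of the configuration of the waiting users at the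
start of a cycle that starts at time `0`, it is carried by the finite configurations of users on
the circle, and the sequence of the configurations and of the cycle times (as functions on the
circle) is a stationary process. -/
structure IsPalmStationary (σ : ℕ∞) (ν : Measure (Config N)) : Prop where
  isProb : IsProbabilityMeasure ν
  finite : ∀ᵐ X ∂ν, ∃ s : Multiset (User N), (∀ u ∈ s, ∀ j, pos u.2 j ∈ Ico 0 S.L) ∧
    X = (s.map Measure.dirac).sum
  stationary : IdentDistrib
    (fun ω (n : ℕ) => (S.state σ ω (n + 1), fun q : Ico 0 S.L => S.cycleTime σ ω (n + 1) q))
    (fun ω (n : ℕ) => (S.state σ ω n, fun q : Ico 0 S.L => S.cycleTime σ ω n q))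
    (ν.prod (S.arrivalLaw κ)) (ν.prod (S.arrivalLaw κ))

/-- The Palm stationary second moment `c_*^{(σ 2)}(q)` of the cycle time with respect to `q`. -/
def cycleSecondMoment (σ : ℕ∞) (ν : Measure (Config N)) (q : ℝ) : ℝ≥0∞ :=
  ∫⁻ ω, S.cycleTime σ ω 0 q ^ 2 ∂ν.prod (S.arrivalLaw κ)

end Stationarity

end Network

end Polling

end

/-! The second moment of a stationary cycle time can be computed explicitly, and the formula is
continuous in the discretization. The computation rests on a branching structure. Service delivered
during a visit (cycle, point, class) postpones the later starts; during each unit of it external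
users arrive at rate `lam`, and the visit alone determines in which cycle such a user gets his first
service. His services fall into further visits, which attract new arrivals, and so on. A unit of
service in a visit therefore has a mean effect `influence` on a given cycle time, and a variance
`varInfluence`, both Neumann series over generations of descendants.

Users are inserted one at a time in order of arrival. By causality a user moves no start before his
arrival, so the start times are the suprema of the tables with finitely many arrivals
(`startTime_eq_iSup`). Given the first arrivals, the second moment of a gap between successive
starts is `moment`: the square of its conditional mean plus a conditional variance, each an integral
over the remaining time. Because the exponential law has constant hazard rate, `moment` is a
martingale along the arrivals (`lintegral_moment_insertUser`). Letting all users arrive shows that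
the second moment of a cycle time, given the initial configuration, is `moment` of the table without
arrivals (`lintegral_limitSched_sub_sq`).

If service times are short, each generation is at most half as large as the one before, in a weight
that decays geometrically with the number of cycles elapsed. The effect of the initial users then
dies out, and `moment` tends to a number `limitMoment` that is the same for every finite initial
configuration (`tendsto_moment_baseSched`). Stationarity, with a truncation for one inequality and
Fatou for the other, identifies this number with the Palm second moment
(`IsPalmStationary.cycleSecondMoment_eq`). No coupling or compactness of stationary laws is needed.

For fixed points, a fine discretization preserves their order, so every cycle number in the formula
is eventually that of the mixed system. The geometric bounds do not depend on `σ`, and dominated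
convergence gives convergence at every point of the circle (`tendsto_limitMoment`), with the uniform
bound `limitMoment_le`. A small second moment of the services yields the required smallness of the
mean (`isLight_markLaw`). -/

noncomputable section

namespace Polling

set_option linter.unusedSectionVars false

/-! ### Visits, causality and insertion of users one at a time -/

section

variable {N : ℕ}

/-- The first cycle in which the external queue of the point `y` is started after the visit, in cycle
`e.1`, of the class `e.2.2` queue at the point `e.2.1`. -/
def nextCycle (e : ℕ × ℝ × Fin N) (y : ℝ) : ℕ :=
  if e.2.1 < y ∨ e.2.1 = y ∧ 0 < e.2.2.1 then e.1 else e.1 + 1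

theorem precedes_iff_nextCycle_le {m : ℕ} {r : ℝ} {j : Fin N} {n : ℕ} {p : ℝ} :
    Network.Precedes m r j n p ↔ nextCycle (m, r, j) p ≤ n := by
  unfold Network.Precedes nextCycle
  dsimp only
  split_ifs with h
  · constructor
    · rintro (h | h) <;> omega
    · intro h'
      rcases h'.lt_or_eq with h'' | h''
      · exact Or.inl h''
      · exact Or.inr ⟨h'', h⟩
  · constructor
    · rintro (h' | h')
      · omega
      · exact absurd h'.2 h
    · intro h'
      exact Or.inl (by omega)

theorem le_nextCycle (e : ℕ × ℝ × Fin N) (y : ℝ) : e.1 ≤ nextCycle e y := by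
  unfold nextCycle; split_ifs <;> omega

theorem nextCycle_le (e : ℕ × ℝ × Fin N) (y : ℝ) : nextCycle e y ≤ e.1 + 1 := by
  unfold nextCycle; split_ifs <;> omega

theorem nextCycle_add (k m : ℕ) (r : ℝ) (j : Fin N) (y : ℝ) :
    nextCycle (m + k, r, j) y = nextCycle (m, r, j) y + k := by
  unfold nextCycle; dsimp only; split_ifs <;> omega

theorem nextCycle_le_of_le {e : ℕ × ℝ × Fin N} {n n' : ℕ} {p p' : ℝ} (h : nextCycle e p ≤ n)
    (hle : n < n' ∨ n = n' ∧ p ≤ p') : nextCycle e p' ≤ n' := by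
  have h1 := nextCycle_le e p'
  have h2 := le_nextCycle e p
  rcases hle with hle | ⟨rfl, hle⟩
  · omega
  · unfold nextCycle at *
    split_ifs at * with h3 h4 h4 <;> try omega
    exfalso
    apply h3
    rcases h4 with h3 | h3
    · exact Or.inl (h3.trans_le hle)
    · rcases hle.lt_or_eq with h5 | h5
      · exact Or.inl (h3.1.trans_lt h5)
      · exact Or.inr ⟨h3.1.trans h5, h3.2⟩

open scoped Classical in
/-- The duration of the `j`-th service of a user, if he gets that service, and `0` otherwise. -/
def load (u : User N) (j : Fin N) : ℝ≥0 := if Attends u j then svc u.2 j else 0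

theorem load_le (u : User N) (j : Fin N) : load u j ≤ svc u.2 j := by
  unfold load; split_ifs <;> simp

/-- The total duration of all potential services of a user. -/
def totalSvc (m : Mark N) : ℝ≥0 := ∑ j, svc m j

theorem sum_load_le (u : User N) : ∑ j, load u j ≤ totalSvc u.2 :=
  Finset.sum_le_sum fun j _ => load_le u j

namespace Network

variable (S : Network N) (σ : ℕ∞)

/-- The number of cycles that pass between the next service of a user and his `j`-th service. -/
def lag (u : User N) (j : Fin N) : ℕ :=
  Set.ncard {i | u.1 < i ∧ i ≤ j ∧ S.delta σ (pos u.2 i) ≤ S.delta σ (pos u.2 (prev i))}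

theorem lag_le (u : User N) (j : Fin N) : S.lag σ u j ≤ N := by
  have := Set.ncard_le_card (s := {i | u.1 < i ∧ i ≤ j ∧
    S.delta σ (pos u.2 i) ≤ S.delta σ (pos u.2 (prev i))})
  simpa [lag] using this

/-- The visit (cycle, point, class) in which the user `u` gets his `j`-th service, if he gets his next
service in cycle `n₀`. -/
def visit (n₀ : ℕ) (u : User N) (j : Fin N) : ℕ × ℝ × Fin N :=
  (n₀ + S.lag σ u j, S.delta σ (pos u.2 j), j)

theorem le_visit (n₀ : ℕ) (u : User N) (j : Fin N) : n₀ ≤ (S.visit σ n₀ u j).1 :=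
  Nat.le_add_right _ _

theorem visit_le (n₀ : ℕ) (u : User N) (j : Fin N) : (S.visit σ n₀ u j).1 ≤ n₀ + N :=
  Nat.add_le_add_left (S.lag_le σ u j) _

theorem nextCycle_visit_add (k n₀ : ℕ) (u : User N) (j : Fin N) (y : ℝ) :
    nextCycle (S.visit σ (n₀ + k) u j) y = nextCycle (S.visit σ n₀ u j) y + k := by
  rw [visit, show n₀ + k + S.lag σ u j = n₀ + S.lag σ u j + k by ring, nextCycle_add]
  rfl

/-- Postponing the next service by `k` cycles postpones every later one by exactly `k`, so the least
admissible cycle gives the weakest condition. -/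
theorem servedBefore_iff_of_isLeast {A : Set ℕ} {c : ℕ} (hc : IsLeast A c) (u : User N) (j : Fin N)
    (n : ℕ) (p : ℝ) : S.ServedBefore σ A u j n p ↔ nextCycle (S.visit σ c u j) p ≤ n := by
  have hiff : ∀ n₀, Precedes (S.serviceCycle σ n₀ u j) (S.delta σ (pos u.2 j)) j n p ↔
      nextCycle (S.visit σ n₀ u j) p ≤ n := fun n₀ => precedes_iff_nextCycle_le
  unfold ServedBefore
  simp only [hiff]
  constructor
  · rintro ⟨n₀, h, hn⟩
    obtain ⟨k, rfl⟩ := Nat.exists_eq_add_of_le (hc.2 h)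
    rw [S.nextCycle_visit_add] at hn
    omega
  · intro h
    exact ⟨c, hc.1, h⟩

/-- The service received by the user `u` before the external queue of the point `p` is started in cycle
`n`, if he gets his next service in cycle `n₀`. -/
def bump (n₀ : ℕ) (u : User N) (n : ℕ) (p : ℝ) : ℝ≥0 :=
  ∑ j, if nextCycle (S.visit σ n₀ u j) p ≤ n then load u j else 0

theorem workBefore_eq_bump {A : Set ℕ} {c : ℕ} (hc : IsLeast A c) (u : User N) (n : ℕ) (p : ℝ) :
    S.workBefore σ A u n p = S.bump σ c u n p := by
  classical
  unfold workBefore bump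
  push_cast
  refine Finset.sum_congr rfl fun j _ => ?_
  rw [S.servedBefore_iff_of_isLeast σ hc]
  unfold load
  by_cases h1 : Attends u j <;> by_cases h2 : nextCycle (S.visit σ c u j) p ≤ n <;> simp [h1, h2]

theorem bump_mono (n₀ : ℕ) (u : User N) {n n' : ℕ} {p p' : ℝ}
    (hle : n < n' ∨ n = n' ∧ p ≤ p') : S.bump σ n₀ u n p ≤ S.bump σ n₀ u n' p' := by
  refine Finset.sum_le_sum fun j _ => ?_
  split_ifs with h1 h2 h2
  · exact le_rfl
  · exact absurd (nextCycle_le_of_le h1 hle) h2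
  · exact zero_le
  · exact le_rfl

theorem delta_mem {q : ℝ} (hσ : σ ≠ 0) (hq : q ∈ Ico 0 S.L) : S.delta σ q ∈ Ico 0 S.L := by
  unfold delta
  split_ifs with h
  · exact hq
  · obtain ⟨k, rfl⟩ := ENat.ne_top_iff_exists.1 h
    have hk : 0 < k := Nat.pos_of_ne_zero (by simpa using hσ)
    have hk' : (0 : ℝ) < k := by exact_mod_cast hk
    simp only [ENat.toNat_natCast]
    have hL := S.L_pos
    constructor
    · have : 0 ≤ ⌊q * k / S.L⌋ := Int.floor_nonneg.2 (by have := hq.1; positivity)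
      have : (0 : ℝ) ≤ (⌊q * k / S.L⌋ : ℝ) := by exact_mod_cast this
      positivity
    · have h1 : (⌊q * k / S.L⌋ : ℝ) ≤ q * k / S.L := Int.floor_le _
      calc (⌊q * k / S.L⌋ : ℝ) * (S.L / k) ≤ q * k / S.L * (S.L / k) := by gcongr
        _ = q := by field_simp
        _ < S.L := hq.2

/-- The lag counts the reroutings to a stop that is not strictly ahead. When there are none, the
stops increase strictly from one service to the next. -/
theorem lt_of_lag_eq_zero (m : Mark N) (z j : Fin N) (hz : z.1 = 0) (h : S.lag σ (z, m) j = 0)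
    (k : ℕ) (hk : k < N) (hkj : k ≤ j.1) :
    S.delta σ (pos m z) ≤ S.delta σ (pos m ⟨k, hk⟩) ∧
      (0 < k → S.delta σ (pos m z) < S.delta σ (pos m ⟨k, hk⟩)) := by
  have hempty : {i | z < i ∧ i ≤ j ∧ S.delta σ (pos m i) ≤ S.delta σ (pos m (prev i))} = ∅ :=
    (Set.ncard_eq_zero (Set.toFinite _)).1 h
  induction k with
  | zero =>
    have : z = ⟨0, hk⟩ := Fin.ext hz
    subst this
    simp
  | succ k ih =>
    have h1 := (ih (by omega) (by omega)).1
    have h2 : (⟨k + 1, hk⟩ : Fin N) ∉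
        {i | z < i ∧ i ≤ j ∧ S.delta σ (pos m i) ≤ S.delta σ (pos m (prev i))} := by
      rw [hempty]; simp
    simp only [mem_ofPred_eq, not_and, not_le] at h2
    have h3 := h2 (by rw [Fin.lt_def]; simp [hz]) (by rw [Fin.le_def]; simpa using hkj)
    have h4 : prev (⟨k + 1, hk⟩ : Fin N) = ⟨k, by omega⟩ := by simp [prev]
    rw [h4] at h3
    exact ⟨(h1.trans_lt h3).le, fun _ => h1.trans_lt h3⟩

variable [NeZero N]

/-- A service of an external user is followed only by starts of external queues after the start of his
own. -/
theorem lt_of_nextCycle_visit_le {n₀ n : ℕ} {m : Mark N} {j : Fin N} {p : ℝ}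
    (h : nextCycle (S.visit σ n₀ (0, m) j) p ≤ n) :
    n₀ < n ∨ n₀ = n ∧ S.delta σ (pos m 0) < p := by
  have h1 := le_nextCycle (S.visit σ n₀ (0, m) j) p
  have h2 := S.le_visit σ n₀ (0, m) j
  rcases (show n₀ ≤ n by omega).lt_or_eq with h3 | h3
  · exact Or.inl h3
  · refine Or.inr ⟨h3, ?_⟩
    have h4 : S.lag σ (0, m) j = 0 := by
      have : (S.visit σ n₀ (0, m) j).1 = n₀ + S.lag σ (0, m) j := rfl
      omega
    have h5 := S.lt_of_lag_eq_zero σ m 0 j (by simp) h4 j.1 j.2 le_rfl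
    -- With no lag the service is in cycle `n` itself, so the start at `p` can follow it only if `p`
    -- lies ahead, or is the same stop and the class is positive; in the latter case the stop is
    -- strictly beyond the first one.
    have h6 : S.delta σ (pos m j) < p ∨ S.delta σ (pos m j) = p ∧ 0 < j.1 := by
      by_contra h7
      unfold nextCycle visit at h
      dsimp only at h
      rw [if_neg h7] at h
      omega
    rcases h6 with h6 | h6
    · exact h5.1.trans_lt h6
    · exact (h5.2 h6.2).trans_eq h6.1

/-- A table of finite starting times of the external queues in which time does not go back. -/
structure IsSchedule (G : ℕ → ℝ → ℝ≥0) : Prop where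
  mono : ∀ {n n' : ℕ} {p p' : ℝ}, p ∈ Ico 0 S.L → p' ∈ Ico 0 S.L → (n < n' ∨ n = n' ∧ p ≤ p') →
    G n p ≤ G n' p'
  unbounded : ∀ (T : ℝ≥0) (p : ℝ), ∃ n, T < G n p

/-- The first cycle in which the external queue of `y` is started after time `T`. -/
def firstOpen (G : ℕ → ℝ → ℝ≥0) (T : ℝ≥0) (y : ℝ) : ℕ := sInf {n | T < G n y}

variable {S} in
theorem IsSchedule.isLeast {G : ℕ → ℝ → ℝ≥0} (hG : S.IsSchedule G) (T : ℝ≥0) (y : ℝ) :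
    IsLeast {n | T < G n y} (firstOpen G T y) :=
  ⟨Nat.sInf_mem (hG.unbounded T y), fun _ hn => Nat.sInf_le hn⟩

/-- The starting times after the insertion of an external user with mark `m` who arrives at time
`T`. -/
def insertUser (G : ℕ → ℝ → ℝ≥0) (T : ℝ≥0) (m : Mark N) (n : ℕ) (p : ℝ) : ℝ≥0 :=
  G n p + S.bump σ (firstOpen G T (S.delta σ (pos m 0))) (0, m) n p

variable {S σ} in
theorem IsSchedule.insertUser {G : ℕ → ℝ → ℝ≥0} (hG : S.IsSchedule G) (T : ℝ≥0) (m : Mark N) :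
    S.IsSchedule (S.insertUser σ G T m) where
  mono hp hp' h := add_le_add (hG.mono hp hp' h) (S.bump_mono σ _ _ h)
  unbounded T' p := by
    obtain ⟨n, hn⟩ := hG.unbounded T' p
    exact ⟨n, hn.trans_le le_self_add⟩

variable {S σ} in
/-- A user does not influence what happens before his arrival. -/
theorem IsSchedule.lt_of_nextCycle_le {G : ℕ → ℝ → ℝ≥0} (hG : S.IsSchedule G) {T : ℝ≥0}
    {m : Mark N} (hm : S.delta σ (pos m 0) ∈ Ico 0 S.L) {j : Fin N} {n : ℕ} {p : ℝ}
    (hp : p ∈ Ico 0 S.L)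
    (h : nextCycle (S.visit σ (firstOpen G T (S.delta σ (pos m 0))) (0, m) j) p ≤ n) :
    T < G n p := by
  refine lt_of_lt_of_le (hG.isLeast T (S.delta σ (pos m 0))).1 (hG.mono hm hp ?_)
  rcases S.lt_of_nextCycle_visit_le σ h with h | h
  · exact Or.inl h
  · exact Or.inr ⟨h.1, h.2.le⟩

variable {S σ} in
theorem IsSchedule.insertUser_of_le {G : ℕ → ℝ → ℝ≥0} (hG : S.IsSchedule G) {T : ℝ≥0}
    {m : Mark N} (hm : S.delta σ (pos m 0) ∈ Ico 0 S.L) {n : ℕ} {p : ℝ} (hp : p ∈ Ico 0 S.L)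
    (h : G n p ≤ T) : S.insertUser σ G T m n p = G n p := by
  unfold Network.insertUser bump
  rw [Finset.sum_eq_zero, add_zero]
  intro j _
  rw [if_neg]
  intro h'
  exact absurd (hG.lt_of_nextCycle_le hm hp h') (not_lt.2 h)

/-- The time at which the `k`-th external user arrives. -/
def arrTime (ω : ℕ → ℝ × Mark N) (k : ℕ) : ℝ≥0 := (∑ i ∈ Finset.range (k + 1), (ω i).1).toNNReal

/-- The starting times if only the first `k` external users arrive. -/
def sched (G₀ : ℕ → ℝ → ℝ≥0) (ω : ℕ → ℝ × Mark N) : ℕ → ℕ → ℝ → ℝ≥0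
  | 0 => G₀
  | k + 1 => S.insertUser σ (sched G₀ ω k) (arrTime ω k) (ω k).2

/-- The paths with nonnegative inter-arrival times and with all positions on the circle. -/
def IsRegular (ω : ℕ → ℝ × Mark N) : Prop :=
  ∀ k, 0 ≤ (ω k).1 ∧ ∀ j, pos (ω k).2 j ∈ Ico 0 S.L

variable {S σ}

theorem IsRegular.arrTime_mono {ω : ℕ → ℝ × Mark N} (hω : S.IsRegular ω) : Monotone (arrTime ω) := by
  refine monotone_nat_of_le_succ fun k => ?_
  refine Real.toNNReal_le_toNNReal ?_
  rw [Finset.sum_range_succ _ (k + 1)]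
  linarith [(hω (k + 1)).1]

theorem IsSchedule.sched {G₀ : ℕ → ℝ → ℝ≥0} (hG : S.IsSchedule G₀) (ω : ℕ → ℝ × Mark N) (k : ℕ) :
    S.IsSchedule (S.sched σ G₀ ω k) := by
  induction k with
  | zero => exact hG
  | succ k ih => exact ih.insertUser _ _

theorem sched_mono (G₀ : ℕ → ℝ → ℝ≥0) (ω : ℕ → ℝ × Mark N) : Monotone (S.sched σ G₀ ω) :=
  monotone_nat_of_le_succ fun _ _ _ => le_self_add

/-- Later users arrive no earlier than the `k`-th and by causality leave alone all starts up to
their arrival. A start that has not passed the `k`-th arrival is therefore final. -/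
theorem IsSchedule.sched_eq_of_le {G₀ : ℕ → ℝ → ℝ≥0} (hG : S.IsSchedule G₀) {ω : ℕ → ℝ × Mark N}
    (hω : S.IsRegular ω) (hσ : σ ≠ 0) {k n : ℕ} {p : ℝ} (hp : p ∈ Ico 0 S.L)
    (h : S.sched σ G₀ ω k n p ≤ arrTime ω k) {i : ℕ} (hi : k ≤ i) :
    S.sched σ G₀ ω i n p = S.sched σ G₀ ω k n p := by
  induction i, hi using Nat.le_induction with
  | base => rfl
  | succ i hi ih =>
    rw [← ih]
    exact (hG.sched ω i).insertUser_of_le (S.delta_mem σ hσ ((hω i).2 0)) hp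
      (ih.le.trans (h.trans (hω.arrTime_mono hi)))

/-- The starting times if only the users of `s` ever show up. -/
def baseSched (S : Network N) (σ : ℕ∞) (s : Multiset (User N)) (n : ℕ) (p : ℝ) : ℝ≥0 :=
  ((n * S.L + p) / S.α).toNNReal + (s.map fun u => S.bump σ
    (if S.delta σ (pos u.2 u.1) = 0 ∧ 0 < u.1.1 then 1 else 0) u n p).sum

theorem isSchedule_baseSched (s : Multiset (User N)) : S.IsSchedule (S.baseSched σ s) where
  mono {n n' p p'} hp hp' h := by
    have hL := S.L_pos
    have hα := S.α_pos
    refine add_le_add (Real.toNNReal_le_toNNReal ?_)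
      (Multiset.sum_map_le_sum_map _ _ fun u _ => S.bump_mono σ _ _ h)
    gcongr ?_ / _
    rcases h with h | ⟨rfl, h⟩
    · have : (n : ℝ) + 1 ≤ n' := by exact_mod_cast h
      nlinarith [hp.2, hp'.1]
    · linarith
  unbounded T p := by
    have hL := S.L_pos
    have hα := S.α_pos
    -- Travel time alone exceeds any bound.
    obtain ⟨n, hn⟩ := exists_nat_gt ((T * S.α - p) / S.L)
    refine ⟨n, lt_of_lt_of_le ?_ le_self_add⟩
    rw [Real.lt_toNNReal_iff_coe_lt, lt_div_iff₀ hα]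
    rw [div_lt_iff₀ hL] at hn
    linarith

end Network

end

/-! ### Start times as suprema over finitely many arrivals; gaps between starts -/

section

namespace Network

variable {N : ℕ} [NeZero N] {S : Network N} {σ : ℕ∞}

theorem sched_eq_sum (G₀ : ℕ → ℝ → ℝ≥0) (ω : ℕ → ℝ × Mark N) (k n : ℕ) (p : ℝ) :
    S.sched σ G₀ ω k n p = G₀ n p + ∑ i ∈ Finset.range k,
      S.bump σ (firstOpen (S.sched σ G₀ ω i) (arrTime ω i) (S.delta σ (pos (ω i).2 0)))
        (0, (ω i).2) n p := by
  induction k with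
  | zero => simp [sched]
  | succ k ih =>
    rw [Finset.sum_range_succ, ← add_assoc, ← ih]
    rfl

theorem IsSchedule.workBefore_eq {G : ℕ → ℝ → ℝ≥0} (hG : S.IsSchedule G) (T : ℝ≥0) (m : Mark N)
    (n : ℕ) (p : ℝ) :
    S.workBefore σ {n₀ | (T : ℝ≥0∞) < G n₀ (S.delta σ (pos m 0))} (0, m) n p
      = S.bump σ (firstOpen G T (S.delta σ (pos m 0))) (0, m) n p := by
  simp only [ENNReal.coe_lt_coe]
  exact S.workBefore_eq_bump σ (hG.isLeast T _) _ _ _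

theorem lintegral_workBefore_eq (s : Multiset (User N)) (n : ℕ) (p : ℝ) :
    ENNReal.ofReal ((n * S.L + p) / S.α) + ∫⁻ u, S.workBefore σ (S.initialCycle σ u) u n p
      ∂(s.map Measure.dirac).sum = S.baseSched σ s n p := by
  have h : ∀ u, S.workBefore σ (S.initialCycle σ u) u n p = S.bump σ
      (if S.delta σ (pos u.2 u.1) = 0 ∧ 0 < u.1.1 then 1 else 0) u n p := by
    intro u
    refine S.workBefore_eq_bump σ (A := S.initialCycle σ u) ⟨?_, fun a ha => ?_⟩ _ _ _
    · rw [initialCycle, mem_ofPred_eq]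
    · rw [initialCycle, mem_ofPred_eq] at ha
      exact ha.ge
  simp only [h]
  rw [baseSched, ENNReal.coe_add]
  congr 1
  induction s using Multiset.induction_on with
  | empty => simp
  | cons a s ih =>
    rw [Multiset.map_cons, Multiset.sum_cons, lintegral_add_measure, ih, lintegral_dirac,
      Multiset.map_cons, Multiset.sum_cons, ENNReal.coe_add]

/-- The starting times are the limits of those with finitely many arrivals. -/
theorem startTime_eq_iSup (s : Multiset (User N)) {ω : ℕ → ℝ × Mark N} (hω : S.IsRegular ω)
    (hσ : σ ≠ 0) (n : ℕ) (p : ℝ) :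
    S.startTime σ ((s.map Measure.dirac).sum, ω) n p
      = ⨆ k, (S.sched σ (S.baseSched σ s) ω k n p : ℝ≥0∞) := by
  set G₀ := S.baseSched σ s
  have hG : S.IsSchedule G₀ := isSchedule_baseSched s
  set X : Config N := (s.map Measure.dirac).sum
  have hdyn : ∀ g n p, S.dynamics σ (X, ω) g n p = G₀ n p
      + ∑' k, S.workBefore σ (S.openCycles σ (X, ω) g k) (arrival (X, ω) k) n p := by
    intro g n p
    rw [← lintegral_workBefore_eq]
    rfl
  have hmono : ∀ n p, Monotone fun k => (S.sched σ G₀ ω k n p : ℝ≥0∞) := fun n p i j hij =>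
    ENNReal.coe_le_coe.2 (sched_mono G₀ ω hij n p)
  have hbump : ∀ k n p, (S.bump σ (firstOpen (S.sched σ G₀ ω k) (arrTime ω k)
      (S.delta σ (pos (ω k).2 0))) (0, (ω k).2) n p : ℝ≥0∞) = S.workBefore σ
      {n₀ | (arrTime ω k : ℝ≥0∞) < S.sched σ G₀ ω k n₀ (S.delta σ (pos (ω k).2 0))}
        (0, (ω k).2) n p := fun k n p => ((hG.sched ω k).workBefore_eq _ _ _ _).symm
  have key : S.startTime σ (X, ω) = fun n p => ⨆ k, (S.sched σ G₀ ω k n p : ℝ≥0∞) := by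
    apply le_antisymm
    -- The supremum is a pre-fixed point. What has to be seen is that the first `k` users already
    -- decide which starts are later than the `k`-th arrival.
    · refine OrderHom.lfp_le _ ?_
      change S.dynamics σ (X, ω) _ ≤ _
      intro n p
      rw [hdyn]
      have hopen : ∀ k, S.openCycles σ (X, ω) (fun n p => ⨆ k, (S.sched σ G₀ ω k n p : ℝ≥0∞)) k
          = {n₀ | (arrTime ω k : ℝ≥0∞) < S.sched σ G₀ ω k n₀ (S.delta σ (pos (ω k).2 0))} := by
        intro k
        ext n₀
        change (arrTime ω k : ℝ≥0∞) < ⨆ i, (S.sched σ G₀ ω i n₀ (S.delta σ (pos (ω k).2 0)) : ℝ≥0∞)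
          ↔ (arrTime ω k : ℝ≥0∞) < S.sched σ G₀ ω k n₀ (S.delta σ (pos (ω k).2 0))
        have hp := S.delta_mem σ hσ ((hω k).2 0)
        refine ⟨fun h => ?_, fun h => h.trans_le (le_iSup (fun i =>
          (S.sched σ G₀ ω i n₀ (S.delta σ (pos (ω k).2 0)) : ℝ≥0∞)) k)⟩
        by_contra h'
        refine absurd h (not_lt.2 (iSup_le fun i => ?_))
        have h'' := ENNReal.coe_le_coe.1 (not_lt.1 h')
        rcases le_total k i with hi | hi
        · rw [hG.sched_eq_of_le hω hσ hp h'' hi]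
          exact not_lt.1 h'
        · exact (hmono _ _ hi).trans (not_lt.1 h')
      simp only [hopen]
      rw [ENNReal.tsum_eq_iSup_nat, ENNReal.add_iSup]
      refine iSup_mono fun k => ?_
      rw [sched_eq_sum]
      push_cast
      simp only [hbump]
      exact le_rfl
    · have hfix := S.dynamics_startTime σ (X, ω)
      -- Conversely, if the earlier tables lie below the least fixed point, its sets of open cycles
      -- contain theirs, and it counts at least as much work.
      have : ∀ k n p, (S.sched σ G₀ ω k n p : ℝ≥0∞) ≤ S.startTime σ (X, ω) n p := by
        intro k
        induction k using Nat.strong_induction_on with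
        | _ k ih =>
          intro n p
          rw [← hfix, hdyn, sched_eq_sum]
          push_cast
          gcongr
          refine le_trans ?_ (ENNReal.sum_le_tsum (Finset.range k))
          refine Finset.sum_le_sum fun i hi => ?_
          rw [hbump]
          refine S.workBefore_mono σ (fun n₀ hn => ?_) _ _ _
          exact lt_of_lt_of_le hn (ih i (Finset.mem_range.1 hi) _ _)
      exact fun n p => iSup_le fun k => this k n p
  rw [key]

/-- The time that is spent after `T` between the starts of the external queue of `y` in the cycles
`i - 1` and `i`. -/
def gap (G : ℕ → ℝ → ℝ≥0) (T : ℝ≥0) (i : ℕ) (y : ℝ) : ℝ≥0 :=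
  max (G i y) T - if i = 0 then T else max (G (i - 1) y) T

/-- Only starts at or after `T` are moved, so the truncation at `T` hides no part of the shift.
Differences of consecutive shifts leave in gap `i` exactly the services whose next start at `y` is
in cycle `i`. -/
theorem gap_add_bump {G G' : ℕ → ℝ → ℝ≥0} {T : ℝ≥0} {n₀ : ℕ} {u : User N} {y : ℝ}
    (hG : Monotone fun i => G i y) (hG' : ∀ i, G' i y = G i y + S.bump σ n₀ u i y)
    (hT : ∀ j i, nextCycle (S.visit σ n₀ u j) y ≤ i → T ≤ G i y) (i : ℕ) :
    gap G' T i y = gap G T i y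
      + ∑ j, if nextCycle (S.visit σ n₀ u j) y = i then load u j else 0 := by
  have hmax : ∀ i, max (G' i y) T = max (G i y) T + S.bump σ n₀ u i y := by
    intro i
    rw [hG']
    by_cases h : T ≤ G i y
    · rw [max_eq_left h, max_eq_left (h.trans le_self_add)]
    · have : S.bump σ n₀ u i y = 0 := by
        refine Finset.sum_eq_zero fun j _ => if_neg fun h' => h (hT j i h')
      simp [this]
  have hb : ∀ i, S.bump σ n₀ u i y = (if i = 0 then 0 else S.bump σ n₀ u (i - 1) y)
      + ∑ j, if nextCycle (S.visit σ n₀ u j) y = i then load u j else 0 := by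
    intro i
    rcases i with _ | i
    · simp [bump]
    · simp only [Nat.add_eq_zero_iff, one_ne_zero, and_false, if_false, Nat.add_sub_cancel]
      unfold bump
      rw [← Finset.sum_add_distrib]
      refine Finset.sum_congr rfl fun j _ => ?_
      rcases lt_trichotomy (nextCycle (S.visit σ n₀ u j) y) (i + 1) with h | h | h
      · rw [if_pos h.le, if_pos (by omega), if_neg h.ne, add_zero]
      · rw [if_pos h.le, if_neg (by omega), if_pos h, zero_add]
      · rw [if_neg (by omega), if_neg (by omega), if_neg (by omega), add_zero]
  unfold gap
  rw [hmax, hb]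
  rcases i with _ | i
  · simp only [if_true, zero_add]
    rw [tsub_add_eq_add_tsub (le_max_right _ _)]
  · simp only [Nat.add_eq_zero_iff, one_ne_zero, and_false, if_false, Nat.add_sub_cancel]
    rw [hmax, ← add_assoc, add_right_comm, add_tsub_add_eq_tsub_right,
      tsub_add_eq_add_tsub (max_le_max (hG (Nat.le_succ i)) le_rfl)]

theorem gap_eq_zero {G : ℕ → ℝ → ℝ≥0} {T : ℝ≥0} {i : ℕ} {y : ℝ} (h : G i y ≤ T) :
    gap G T i y = 0 := by
  unfold gap
  rw [max_eq_right h, tsub_eq_zero_iff_le]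
  split_ifs
  · exact le_rfl
  · exact le_max_right _ _

theorem sum_gap {G : ℕ → ℝ → ℝ≥0} {T : ℝ≥0} {y : ℝ} (hG : Monotone fun i => G i y) (n : ℕ) :
    ∑ i ∈ Finset.range (n + 1), gap G T i y = max (G n y) T - T := by
  induction n with
  | zero => simp [gap]
  | succ n ih =>
    rw [Finset.sum_range_succ, ih]
    simp only [gap, Nat.add_eq_zero_iff, one_ne_zero, and_false, if_false, Nat.add_sub_cancel]
    rw [add_comm]
    exact tsub_add_tsub_cancel (max_le_max (hG (Nat.le_succ n)) le_rfl) (le_max_right _ _)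

theorem sum_gap_le {G : ℕ → ℝ → ℝ≥0} {T : ℝ≥0} {y : ℝ} (hG : Monotone fun i => G i y) (n : ℕ) :
    ∑ i ∈ Finset.range (n + 1), gap G T i y ≤ G n y := by
  rw [sum_gap hG, tsub_le_iff_right]
  exact max_le le_self_add le_add_self

theorem gap_zero_succ (G : ℕ → ℝ → ℝ≥0) (n : ℕ) (y : ℝ) : gap G 0 (n + 1) y = G (n + 1) y - G n y := by
  simp [gap]

variable (S σ) in
/-- The integral over the time after `T` of the value of an external user who arrives then, if the value
of a user with mark `m` who gets his first service in cycle `i` is `W m i`. -/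
def future (μ : Measure (Mark N)) (W : Mark N → ℕ → ℝ≥0∞) (G : ℕ → ℝ → ℝ≥0) (T : ℝ≥0) : ℝ≥0∞ :=
  ∫⁻ m, ∑' i, W m i * gap G T i (S.delta σ (pos m 0)) ∂μ

variable (S σ) in
/-- The mean value of an external user who arrives during the visit `e`. -/
def meanValue (μ : Measure (Mark N)) (W : Mark N → ℕ → ℝ≥0∞) (e : ℕ × ℝ × Fin N) : ℝ≥0∞ :=
  ∫⁻ m, W m (nextCycle e (S.delta σ (pos m 0))) ∂μ

variable (S σ) in
/-- The sum over the services of an external user of their duration times a function of the visit. -/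
def total (f : ℕ × ℝ × Fin N → ℝ≥0∞) (m : Mark N) (n₀ : ℕ) : ℝ≥0∞ :=
  ∑ j, load (0, m) j * f (S.visit σ n₀ (0, m) j)

end Network

end

/-! ### Integral identities for the exponential law -/

section

theorem expMeasure_Ioi {r : ℝ} (hr : 0 < r) {s : ℝ} (hs : 0 ≤ s) :
    expMeasure r (Ioi s) = ENNReal.ofReal (Real.exp (-(r * s))) := by
  have := isProbabilityMeasure_expMeasure hr
  rw [← compl_Iic, prob_compl_eq_one_sub measurableSet_Iic, ← ofReal_cdf, cdf_expMeasure_eq hr,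
    if_pos hs, ← ENNReal.ofReal_one, ← ENNReal.ofReal_sub _ (by
      rw [sub_nonneg, Real.exp_le_one_iff]; have := mul_nonneg hr.le hs; linarith)]
  simp

theorem ae_expMeasure_pos {r : ℝ} (hr : 0 < r) : ∀ᵐ s ∂expMeasure r, 0 < s := by
  have := isProbabilityMeasure_expMeasure hr
  have h : expMeasure r (Ioi 0) = 1 := by rw [expMeasure_Ioi hr le_rfl]; simp
  exact (prob_compl_eq_zero_iff measurableSet_Ioi).2 h

/-- The exponential distribution has a constant hazard rate. -/
theorem lintegral_expMeasure_eq {r : ℝ} (hr : 0 < r) {b : ℝ → ℝ≥0∞} (hb : Measurable b) :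
    ∫⁻ τ, b τ ∂expMeasure r
      = ENNReal.ofReal r * ∫⁻ τ, (∫⁻ s in Ioo 0 τ, b s) ∂expMeasure r := by
  have := isProbabilityMeasure_expMeasure hr
  -- Tonelli: `b s` is weighted with the probability that `τ` exceeds `s`, which is the density
  -- divided by the rate.
  have h1 : ∫⁻ τ, (∫⁻ s in Ioo 0 τ, b s) ∂expMeasure r
      = ∫⁻ s in Ioi 0, b s * ENNReal.ofReal (Real.exp (-(r * s))) := by
    have h2 : ∀ τ, ∫⁻ s in Ioo 0 τ, b s = ∫⁻ s in Ioi (0 : ℝ), b s * (Ioi s).indicator 1 τ := by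
      intro τ
      rw [← lintegral_indicator measurableSet_Ioo, ← lintegral_indicator measurableSet_Ioi]
      refine lintegral_congr fun s => ?_
      by_cases h3 : 0 < s <;> by_cases h4 : s < τ <;> simp [indicator, h3, h4]
    simp only [h2]
    rw [lintegral_lintegral_swap]
    · refine setLIntegral_congr_fun measurableSet_Ioi fun s hs => ?_
      rw [lintegral_const_mul _ (measurable_one.indicator measurableSet_Ioi),
        lintegral_indicator_one measurableSet_Ioi, expMeasure_Ioi hr (le_of_lt hs)]
    · refine Measurable.aemeasurable ?_
      have : MeasurableSet {z : ℝ × ℝ | z.2 < z.1} := measurableSet_lt measurable_snd measurable_fst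
      have h5 : (Function.uncurry fun τ s : ℝ => b s * (Ioi s).indicator 1 τ)
          = fun z : ℝ × ℝ => b z.2 * {z : ℝ × ℝ | z.2 < z.1}.indicator 1 z := by
        ext ⟨τ, s⟩
        simp [indicator]
      rw [h5]
      exact (hb.comp measurable_snd).mul (measurable_one.indicator this)
  rw [h1, ← lintegral_const_mul _ (by fun_prop)]
  have h6 : expMeasure r = volume.withDensity (exponentialPDF r) := rfl
  rw [h6, lintegral_withDensity_eq_lintegral_mul _ (by unfold exponentialPDF; fun_prop) hb,
    ← lintegral_indicator measurableSet_Ioi]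
  refine lintegral_congr_ae ?_
  filter_upwards [compl_mem_ae_iff.2 (measure_singleton (μ := volume) (0 : ℝ))] with s hs
  have hs' : s ≠ 0 := hs
  rw [Pi.mul_apply]
  rcases lt_or_gt_of_ne hs' with h | h
  · rw [exponentialPDF_of_neg h, zero_mul, indicator_of_notMem (by simpa using h.le)]
  · rw [exponentialPDF_of_nonneg h.le, indicator_of_mem (by simpa using h),
      ENNReal.ofReal_mul hr.le]
    ring

theorem lintegral_Ioi_split (b : ℝ → ℝ≥0∞) {s τ : ℝ} (h : s < τ) :
    ∫⁻ t in Ioi s, b t = (∫⁻ t in Ioi τ, b t) + ∫⁻ t in Ioo s τ, b t := by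
  rw [← Ioc_union_Ioi_eq_Ioi h.le, lintegral_union measurableSet_Ioi
    (by rw [Set.disjoint_left]; intro x hx hx'; exact absurd hx.2 (not_le.2 hx')),
    setLIntegral_congr Ioo_ae_eq_Ioc.symm, add_comm]

/-- The square is a double integral, symmetric about a diagonal that is null because `ν` has no
atoms. This replaces differentiation of a squared primitive, which would require finite integrals.
-/
theorem lintegral_sq_eq_two_mul (ν : Measure ℝ) [SFinite ν] [NullSingletonClass ν] {b : ℝ → ℝ≥0∞}
    (hb : Measurable b) :
    (∫⁻ t, b t ∂ν) ^ 2 = 2 * ∫⁻ s, b s * ∫⁻ t, (Ioi s).indicator b t ∂ν ∂ν := by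
  have hm1 : Measurable (Function.uncurry fun s t : ℝ => b s * (Ioi s).indicator b t) := by
    have h5 : (Function.uncurry fun s t : ℝ => b s * (Ioi s).indicator b t)
        = fun z : ℝ × ℝ => b z.1 * {z : ℝ × ℝ | z.1 < z.2}.indicator (fun z => b z.2) z := by
      ext ⟨τ, s⟩
      simp [indicator]
    rw [h5]
    exact (hb.comp measurable_fst).mul
      ((hb.comp measurable_snd).indicator (measurableSet_lt measurable_fst measurable_snd))
  have hind : ∀ s, Measurable fun t => (Ioi s).indicator b t := fun s => hb.indicator measurableSet_Ioi
  have h1 : ∫⁻ s, b s * ∫⁻ t, (Ioi s).indicator b t ∂ν ∂ν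
      = ∫⁻ s, ∫⁻ t, b s * (Ioi s).indicator b t ∂ν ∂ν := by
    refine lintegral_congr fun s => ?_
    rw [lintegral_const_mul _ (hind s)]
  have h2 : ∫⁻ s, ∫⁻ t, b s * (Ioi s).indicator b t ∂ν ∂ν
      = ∫⁻ s, ∫⁻ t, b t * (Ioi t).indicator b s ∂ν ∂ν :=
    lintegral_lintegral_swap hm1.aemeasurable
  rw [two_mul, h1]
  nth_rw 2 [h2]
  rw [← lintegral_add_left (Measurable.lintegral_prod_right' (f := fun z : ℝ × ℝ =>
    b z.1 * (Ioi z.1).indicator b z.2) hm1), sq, ← lintegral_mul_const _ hb]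
  refine lintegral_congr fun s => ?_
  dsimp only
  rw [← lintegral_add_left ((hind s).const_mul _), ← lintegral_const_mul _ hb]
  refine lintegral_congr_ae ?_
  filter_upwards [compl_mem_ae_iff.2 (measure_singleton (μ := ν) s)] with t ht
  have ht' : t ≠ s := ht
  rcases lt_or_gt_of_ne ht' with h | h
  · simp [indicator, h, not_lt.2 h.le, mul_comm]
  · simp [indicator, h, not_lt.2 h.le]

/-- By the constant hazard rate, the mean of `b τ` makes up for the part of the integral before `τ`.
This preserves the variance part of `moment` in the mean. -/
theorem lintegral_expMeasure_future {r : ℝ} (hr : 0 < r) {b : ℝ → ℝ≥0∞} (hb : Measurable b) :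
    ∫⁻ τ, (ENNReal.ofReal r * (∫⁻ s in Ioi τ, b s) + b τ) ∂expMeasure r
      = ENNReal.ofReal r * ∫⁻ s in Ioi 0, b s := by
  have := isProbabilityMeasure_expMeasure hr
  have hm : Measurable fun τ => ∫⁻ s in Ioi τ, b s :=
    Antitone.measurable fun s t h => lintegral_mono_set (Ioi_subset_Ioi h)
  have hm' : Measurable fun τ => ∫⁻ s in Ioo 0 τ, b s :=
    Monotone.measurable fun s t h => lintegral_mono_set (Ioo_subset_Ioo_right h)
  rw [lintegral_add_left (hm.const_mul _), lintegral_expMeasure_eq hr hb, lintegral_const_mul _ hm,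
    ← mul_add, ← lintegral_add_left hm]
  congr 1
  trans ∫⁻ _, (∫⁻ s in Ioi 0, b s) ∂expMeasure r
  · refine lintegral_congr_ae ?_
    filter_upwards [ae_expMeasure_pos hr] with τ hτ
    rw [lintegral_Ioi_split b hτ]
  · simp

/-- Formally, `F τ = Z + r ∫_τ^∞ b` has slope `-r b`, so `r ∫_0^τ 2 F b = F(0)² - F(τ)²`, and by the
constant hazard rate the left side has the mean of `2 F(τ) b(τ)`. Infinite values are allowed. This
handles the squared mean in `moment`. -/
theorem lintegral_expMeasure_sq {r : ℝ} (hr : 0 < r) {b : ℝ → ℝ≥0∞} (hb : Measurable b) (Z : ℝ≥0∞) :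
    ∫⁻ τ, ((Z + ENNReal.ofReal r * ∫⁻ s in Ioi τ, b s) ^ 2
        + 2 * (Z + ENNReal.ofReal r * ∫⁻ s in Ioi τ, b s) * b τ) ∂expMeasure r
      = (Z + ENNReal.ofReal r * ∫⁻ s in Ioi 0, b s) ^ 2 := by
  have := isProbabilityMeasure_expMeasure hr
  set ρ := ENNReal.ofReal r
  set F : ℝ → ℝ≥0∞ := fun τ => Z + ρ * ∫⁻ s in Ioi τ, b s with hF
  have hm : Measurable F :=
    Antitone.measurable fun s t h => by
      simp only [hF]
      gcongr
  have hmb : Measurable fun τ => 2 * F τ * b τ := (hm.const_mul _).mul hb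
  have hm' : Measurable fun τ => ∫⁻ s in Ioo 0 τ, 2 * F s * b s :=
    Monotone.measurable fun s t h => lintegral_mono_set (Ioo_subset_Ioo_right h)
  change ∫⁻ τ, (F τ ^ 2 + 2 * F τ * b τ) ∂expMeasure r = F 0 ^ 2
  rw [lintegral_add_left (hm.pow_const _), lintegral_expMeasure_eq hr hmb,
    ← lintegral_const_mul _ hm', ← lintegral_add_left (hm.pow_const _)]
  trans ∫⁻ _, F 0 ^ 2 ∂expMeasure r
  · refine lintegral_congr_ae ?_
    filter_upwards [ae_expMeasure_pos hr] with τ hτ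
    set ν := volume.restrict (Ioo 0 τ)
    have hFs : ∀ s ∈ Ioo 0 τ, F s = F τ + ρ * ∫⁻ t, (Ioi s).indicator b t ∂ν := by
      intro s hs
      simp only [hF]
      rw [lintegral_Ioi_split b hs.2, lintegral_indicator measurableSet_Ioi,
        Measure.restrict_restrict measurableSet_Ioi, mul_add, add_assoc]
      congr 6
      ext t
      simp only [mem_Ioo, mem_inter_iff, mem_Ioi]
      have := hs.1
      constructor
      · intro h; exact ⟨h.1, by linarith, h.2⟩
      · intro h; exact ⟨h.1, h.2.2⟩
    have h0 : F 0 = F τ + ρ * ∫⁻ t, b t ∂ν := by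
      simp only [hF]
      rw [lintegral_Ioi_split b hτ, mul_add, add_assoc]
    have hmi : Measurable fun s => ∫⁻ t, (Ioi s).indicator b t ∂ν :=
      Antitone.measurable fun s t h => lintegral_mono fun x =>
        indicator_le_indicator_of_subset (Ioi_subset_Ioi h) (fun _ => zero_le) x
    have hmul : Measurable fun s => b s * ∫⁻ t, (Ioi s).indicator b t ∂ν := hb.mul hmi
    have h3 : ∫⁻ s in Ioo 0 τ, 2 * F s * b s = 2 * F τ * (∫⁻ t, b t ∂ν)
        + ρ * (∫⁻ t, b t ∂ν) ^ 2 := by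
      rw [lintegral_sq_eq_two_mul ν hb, ← lintegral_const_mul _ hb, ← mul_assoc,
        ← lintegral_const_mul _ hmul, ← lintegral_add_left (hb.const_mul _)]
      refine setLIntegral_congr_fun measurableSet_Ioo fun s hs => ?_
      rw [hFs s hs]
      ring
    rw [h3, h0]
    ring
  · simp

end

/-! ### Measurability -/

section

theorem measurable_sInf_nat {α : Type*} [MeasurableSpace α] {P : α → ℕ → Prop}
    (hP : ∀ n, MeasurableSet {x | P x n}) : Measurable fun x => sInf {n | P x n} := by
  classical
  refine measurable_to_countable' fun k => ?_
  -- The level `0` also contains the points where no `n` qualifies, since the infimum of the empty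
  -- set is `0`.
  have : (fun x => sInf {n | P x n}) ⁻¹' {k} = ({x | P x k} ∩ ⋂ i, {x | i < k → ¬ P x i}) ∪
      (if k = 0 then ⋂ i, {x | ¬ P x i} else ∅) := by
    ext x
    simp only [mem_preimage, mem_singleton_iff, mem_union, mem_inter_iff, mem_iInter]
    constructor
    · intro h
      by_cases hne : {n | P x n}.Nonempty
      · refine Or.inl ⟨h ▸ Nat.sInf_mem hne, fun i hi hPi => ?_⟩
        exact absurd (Nat.sInf_le (s := {n | P x n}) hPi) (by omega)
      · rw [not_nonempty_iff_eq_empty] at hne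
        rw [hne, Nat.sInf_empty] at h
        right
        rw [if_pos h.symm, mem_iInter]
        intro i hi
        have : i ∈ {n | P x n} := hi
        rw [hne] at this
        exact this
    · rintro (⟨h1, h2⟩ | h)
      · apply le_antisymm (Nat.sInf_le h1)
        by_contra h3
        exact h2 _ (not_le.1 h3) (Nat.sInf_mem (s := {n | P x n}) ⟨k, h1⟩)
      · split_ifs at h with hk
        · rw [mem_iInter] at h
          have : {n | P x n} = ∅ := by
            ext i
            simpa using h i
          rw [this, Nat.sInf_empty, hk]
        · exact absurd h (by simp)
  rw [this]
  refine (MeasurableSet.inter (hP k) (MeasurableSet.iInter fun i => ?_)).union ?_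
  · by_cases hi : i < k
    · simp only [hi, true_imp_iff]
      exact (hP i).compl
    · simp [hi]
  · split_ifs
    · exact MeasurableSet.iInter fun i => (hP i).compl
    · exact MeasurableSet.empty

variable {N : ℕ}

theorem measurable_pos (j : Fin N) : Measurable fun m : Mark N => pos m j :=
  ((measurable_pi_apply j).fst).fst

theorem measurable_svc (j : Fin N) : Measurable fun m : Mark N => svc m j :=
  ((measurable_pi_apply j).fst).snd

theorem measurable_load (z j : Fin N) : Measurable fun m : Mark N => load (z, m) j := by
  unfold load
  refine Measurable.ite ?_ (measurable_svc j) measurable_const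
  have : {m : Mark N | Attends (z, m) j} = if z ≤ j then
      ⋂ i, {m : Mark N | z < i → i ≤ j → (m i).2 = true} else ∅ := by
    ext m
    split_ifs with h <;> simp [Attends, h]
  rw [this]
  split_ifs
  · refine MeasurableSet.iInter fun i => ?_
    by_cases h1 : z < i <;> by_cases h2 : i ≤ j <;> simp only [h1, h2, true_imp_iff,
      false_imp_iff, ofPred_true, MeasurableSet.univ]
    exact (measurable_pi_apply (X := fun _ : Fin N => (ℝ × ℝ≥0) × Bool) i).snd
      (measurableSet_singleton true)
  · exact MeasurableSet.empty

theorem measurable_nextCycle :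
    Measurable fun z : (ℕ × ℝ × Fin N) × ℝ => nextCycle z.1 z.2 := by
  unfold nextCycle
  have h1 : Measurable fun z : (ℕ × ℝ × Fin N) × ℝ => z.1.2.1 := by fun_prop
  have h2 : Measurable fun z : (ℕ × ℝ × Fin N) × ℝ => z.2 := by fun_prop
  have h3 : Measurable fun z : (ℕ × ℝ × Fin N) × ℝ => z.1.1 := by fun_prop
  have h4 : Measurable fun z : (ℕ × ℝ × Fin N) × ℝ => z.1.2.2 := by fun_prop
  refine Measurable.ite ?_ h3 (h3.add_const 1)
  exact (measurableSet_lt h1 h2).union ((measurableSet_eq_fun h1 h2).inter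
    (h4 (Set.toFinite {j : Fin N | 0 < j.1}).measurableSet))

namespace Network

variable (S : Network N) (σ : ℕ∞)

theorem measurable_delta : Measurable (S.delta σ) := by
  unfold delta
  split_ifs
  · exact measurable_id
  · refine Measurable.mul_const ?_ _
    exact (measurable_from_top (f := fun k : ℤ => (k : ℝ))).comp
      (Int.measurable_floor.comp (by fun_prop))

theorem measurable_delta_pos (j : Fin N) : Measurable fun m : Mark N => S.delta σ (pos m j) :=
  (S.measurable_delta σ).comp (measurable_pos j)

theorem measurable_lag (z j : Fin N) : Measurable fun m : Mark N => S.lag σ (z, m) j := by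
  classical
  have : (fun m : Mark N => S.lag σ (z, m) j) = fun m => ∑ i, if z < i ∧ i ≤ j ∧
      S.delta σ (pos m i) ≤ S.delta σ (pos m (prev i)) then 1 else 0 := by
    ext m
    rw [lag, Set.ncard_eq_toFinset_card', Set.toFinset_ofPred, Finset.card_filter]
  rw [this]
  refine Finset.measurable_sum _ fun i _ => Measurable.ite ?_ measurable_const measurable_const
  by_cases h1 : z < i <;> by_cases h2 : i ≤ j <;> simp only [h1, h2, true_and,
      false_and, ofPred_false, MeasurableSet.empty]
  exact measurableSet_le (S.measurable_delta_pos σ _) (S.measurable_delta_pos σ _)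

theorem measurable_visit (z j : Fin N) :
    Measurable fun x : ℕ × Mark N => S.visit σ x.1 (z, x.2) j := by
  unfold visit
  exact (measurable_fst.add ((S.measurable_lag σ z j).comp measurable_snd)).prodMk
    (((S.measurable_delta_pos σ j).comp measurable_snd).prodMk measurable_const)

theorem measurable_bump (z : Fin N) (n : ℕ) :
    Measurable fun x : (ℕ × Mark N) × ℝ => S.bump σ x.1.1 (z, x.1.2) n x.2 := by
  unfold bump
  refine Finset.measurable_sum _ fun j _ => Measurable.ite ?_ ?_ measurable_const
  · have h : Measurable fun x : (ℕ × Mark N) × ℝ =>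
        nextCycle (S.visit σ x.1.1 (z, x.1.2) j) x.2 :=
      measurable_nextCycle.comp (((S.measurable_visit σ z j).comp measurable_fst).prodMk
        measurable_snd)
    exact h (Set.to_countable (Iic n)).measurableSet
  · exact (measurable_load z j).comp (measurable_snd.comp measurable_fst)

section Family

variable {A : Type*} [MeasurableSpace A] {G : A → ℕ → ℝ → ℝ≥0} {T : A → ℝ≥0}

theorem measurable_firstOpen (hG : ∀ n, Measurable fun z : A × ℝ => G z.1 n z.2)
    (hT : Measurable T) : Measurable fun z : A × ℝ => firstOpen (G z.1) (T z.1) z.2 :=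
  measurable_sInf_nat fun n => measurableSet_lt (hT.comp measurable_fst) (hG n)

theorem measurable_gap (hG : ∀ n, Measurable fun z : A × ℝ => G z.1 n z.2) (hT : Measurable T)
    (i : ℕ) : Measurable fun z : A × ℝ => gap (G z.1) (T z.1) i z.2 := by
  unfold gap
  refine ((hG i).max (hT.comp measurable_fst)).sub ?_
  split_ifs
  · exact hT.comp measurable_fst
  · exact (hG _).max (hT.comp measurable_fst)

theorem measurable_future [NeZero N] {μ : Measure (Mark N)} [SFinite μ] {W : Mark N → ℕ → ℝ≥0∞}
    (hW : ∀ i, Measurable fun m => W m i) (hG : ∀ n, Measurable fun z : A × ℝ => G z.1 n z.2)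
    (hT : Measurable T) : Measurable fun a => S.future σ μ W (G a) (T a) := by
  unfold future
  refine Measurable.lintegral_prod_right' (f := fun z : A × Mark N =>
    ∑' i, W z.2 i * gap (G z.1) (T z.1) i (S.delta σ (pos z.2 0))) ?_
  refine Measurable.tsum fun i => ((hW i).comp measurable_snd).mul ?_
  refine Measurable.coe_nnreal_ennreal ?_
  exact (measurable_gap hG hT i).comp (measurable_fst.prodMk
    ((S.measurable_delta_pos σ 0).comp measurable_snd))

theorem measurable_insertUser [NeZero N] (hG : ∀ n, Measurable fun z : A × ℝ => G z.1 n z.2)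
    (hT : Measurable T) {m : A → Mark N} (hm : Measurable m) (n : ℕ) :
    Measurable fun z : A × ℝ => S.insertUser σ (G z.1) (T z.1) (m z.1) n z.2 := by
  have h1 : Measurable fun z : A × ℝ =>
      firstOpen (G z.1) (T z.1) (S.delta σ (pos (m z.1) 0)) :=
    (measurable_firstOpen hG hT).comp (measurable_fst.prodMk
      ((S.measurable_delta_pos σ 0).comp (hm.comp measurable_fst)))
  have h2 : Measurable fun z : A × ℝ =>
      ((firstOpen (G z.1) (T z.1) (S.delta σ (pos (m z.1) 0)), m z.1), z.2) :=
    (h1.prodMk (hm.comp measurable_fst)).prodMk measurable_snd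
  have h3 := (S.measurable_bump σ 0 n).comp h2
  exact (hG n).add h3

end Family

theorem measurable_baseSched (s : Multiset (User N)) (n : ℕ) :
    Measurable (S.baseSched σ s n) := by
  unfold baseSched
  refine Measurable.add (by fun_prop) ?_
  induction s using Multiset.induction_on with
  | empty => simp
  | cons a s ih =>
    simp only [Multiset.map_cons, Multiset.sum_cons]
    have h1 : ∀ k : ℕ, Measurable fun p : ℝ => (((k, a.2) : ℕ × Mark N), p) := fun k =>
      measurable_const.prodMk measurable_id
    exact ((S.measurable_bump σ a.1 n).comp (h1 _)).add ih

theorem measurable_arrTime (k : ℕ) : Measurable fun ω : ℕ → ℝ × Mark N => arrTime ω k := by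
  unfold arrTime
  exact (Finset.measurable_sum _ fun i _ => (measurable_pi_apply i).fst).real_toNNReal

theorem measurable_sched [NeZero N] {G₀ : ℕ → ℝ → ℝ≥0} (hG₀ : ∀ n, Measurable (G₀ n)) (k : ℕ) :
    ∀ n, Measurable fun z : (ℕ → ℝ × Mark N) × ℝ => S.sched σ G₀ z.1 k n z.2 := by
  induction k with
  | zero => exact fun n => (hG₀ n).comp measurable_snd
  | succ k ih =>
    intro n
    have h1 : Measurable fun ω : ℕ → ℝ × Mark N => (ω k).2 := (measurable_pi_apply k).snd
    have h2 := S.measurable_insertUser σ (G := fun ω => S.sched σ G₀ ω k) ih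
      (measurable_arrTime k) h1 n
    exact h2

section Values

variable [NeZero N] {μ : Measure (Mark N)} {W : Mark N → ℕ → ℝ≥0∞} {f : ℕ × ℝ × Fin N → ℝ≥0∞}

theorem measurable_value (hW : ∀ i, Measurable fun m => W m i) :
    Measurable fun z : Mark N × ℕ => W z.1 z.2 :=
  measurable_from_prod_countable_left fun i => hW i

theorem measurable_total (hf : Measurable f) (i : ℕ) : Measurable fun m => S.total σ f m i := by
  unfold total
  refine Finset.measurable_sum _ fun j _ => ((measurable_load 0 j).coe_nnreal_ennreal).mul ?_
  exact hf.comp ((S.measurable_visit σ 0 j).comp (measurable_const.prodMk measurable_id))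

theorem measurable_nextCycle_mark : Measurable fun z : (ℕ × ℝ × Fin N) × Mark N =>
    nextCycle z.1 (S.delta σ (pos z.2 0)) :=
  measurable_nextCycle.comp (measurable_fst.prodMk
    ((S.measurable_delta_pos σ 0).comp measurable_snd))

theorem measurable_meanValue [SFinite μ] (hW : ∀ i, Measurable fun m => W m i) :
    Measurable (S.meanValue σ μ W) := by
  unfold meanValue
  refine Measurable.lintegral_prod_right' (f := fun z : (ℕ × ℝ × Fin N) × Mark N =>
    W z.2 (nextCycle z.1 (S.delta σ (pos z.2 0)))) ?_
  exact (measurable_value hW).comp (measurable_snd.prodMk (S.measurable_nextCycle_mark σ))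

end Values

end Network

end

/-! ### Future values as integrals over time -/

section

namespace Network

variable {N : ℕ} [NeZero N] {S : Network N} {σ : ℕ∞} {μ : Measure (Mark N)}

theorem IsSchedule.monotone {G : ℕ → ℝ → ℝ≥0} (hG : S.IsSchedule G) {y : ℝ} (hy : y ∈ Ico 0 S.L) :
    Monotone fun i => G i y :=
  monotone_nat_of_le_succ fun i => hG.mono hy hy (Or.inl (Nat.lt_succ_self i))

theorem IsSchedule.firstOpen_eq_iff {G : ℕ → ℝ → ℝ≥0} (hG : S.IsSchedule G) {y : ℝ}
    (hy : y ∈ Ico 0 S.L) (T : ℝ≥0) (i : ℕ) :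
    firstOpen G T y = i ↔ T < G i y ∧ (i = 0 ∨ G (i - 1) y ≤ T) := by
  have hl := hG.isLeast T y
  constructor
  · rintro rfl
    refine ⟨hl.1, ?_⟩
    by_contra! h
    have := hl.2 h.2
    omega
  · rintro ⟨h1, h2⟩
    apply le_antisymm (hl.2 h1)
    by_contra h3
    have h4 : G (firstOpen G T y) y ≤ T := by
      rcases h2 with h2 | h2
      · omega
      · exact (hG.monotone hy (by omega)).trans h2
    exact absurd hl.1 (not_lt.2 h4)

/-- The times whose first open cycle is `i` run from one start to the next; cutting this interval at
`T` leaves the length `gap`. -/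
theorem IsSchedule.coe_gap_eq {G : ℕ → ℝ → ℝ≥0} (hG : S.IsSchedule G) {y : ℝ}
    (hy : y ∈ Ico 0 S.L) (T : ℝ≥0) (i : ℕ) :
    (gap G T i y : ℝ≥0∞)
      = volume (Ioi (T : ℝ) ∩ (fun t : ℝ => firstOpen G t.toNNReal y) ⁻¹' {i}) := by
  have hmem : ∀ t, t ∈ Ioi (T : ℝ) ∩ (fun t : ℝ => firstOpen G t.toNNReal y) ⁻¹' {i} ↔
      (T : ℝ) < t ∧ t < G i y ∧ (i = 0 ∨ (G (i - 1) y : ℝ) ≤ t) := by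
    intro t
    simp only [mem_inter_iff, mem_Ioi, mem_preimage, mem_singleton_iff, hG.firstOpen_eq_iff hy]
    refine and_congr_right fun ht => ?_
    have h0 : 0 ≤ t := T.2.trans ht.le
    rw [Real.toNNReal_lt_iff_lt_coe h0, ← NNReal.coe_le_coe, Real.coe_toNNReal _ h0]
  have hgap : (gap G T i y : ℝ≥0∞)
      = ENNReal.ofReal ((max (G i y) T : ℝ≥0) - (if i = 0 then T else max (G (i - 1) y) T : ℝ≥0)) := by
    unfold gap
    rw [ENNReal.coe_sub, ENNReal.ofReal_sub _ NNReal.zero_le_coe,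
      ENNReal.ofReal_coe_nnreal, ENNReal.ofReal_coe_nnreal]
  rw [hgap]
  rcases le_or_gt (G i y) T with h | h
  · have : Ioi (T : ℝ) ∩ (fun t : ℝ => firstOpen G t.toNNReal y) ⁻¹' {i} = ∅ := by
      ext t
      rw [hmem]
      have : (G i y : ℝ) ≤ T := h
      simp only [mem_empty_iff_false, iff_false]
      rintro ⟨h1, h2, -⟩
      linarith
    rw [this, measure_empty, max_eq_right h]
    split_ifs
    · simp
    · simp
  · have h' : (T : ℝ) < G i y := h
    rw [max_eq_left h.le]
    by_cases hi : i = 0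
    · have : Ioi (T : ℝ) ∩ (fun t : ℝ => firstOpen G t.toNNReal y) ⁻¹' {i} = Ioo (T : ℝ) (G i y) := by
        ext t
        rw [hmem]
        simp [hi]
      rw [this, Real.volume_Ioo, if_pos hi]
    · rw [if_neg hi]
      rcases le_or_gt (G (i - 1) y) T with h2 | h2
      · have : Ioi (T : ℝ) ∩ (fun t : ℝ => firstOpen G t.toNNReal y) ⁻¹' {i}
            = Ioo (T : ℝ) (G i y) := by
          ext t
          rw [hmem]
          have h2' : (G (i - 1) y : ℝ) ≤ T := h2
          constructor
          · rintro ⟨h3, h4, -⟩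
            exact ⟨h3, h4⟩
          · rintro ⟨h3, h4⟩
            exact ⟨h3, h4, Or.inr (h2'.trans h3.le)⟩
        rw [this, Real.volume_Ioo, max_eq_right h2]
      · have : Ioi (T : ℝ) ∩ (fun t : ℝ => firstOpen G t.toNNReal y) ⁻¹' {i}
            = Ico (G (i - 1) y : ℝ) (G i y) := by
          ext t
          rw [hmem]
          have h2' : (T : ℝ) < G (i - 1) y := h2
          constructor
          · rintro ⟨h3, h4, h5⟩
            exact ⟨h5.resolve_left hi, h4⟩
          · rintro ⟨h3, h4⟩
            exact ⟨h2'.trans_le h3, h4, Or.inr h3⟩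
        rw [this, Real.volume_Ico, max_eq_left h2.le]

theorem measurable_firstOpen_time {G : ℕ → ℝ → ℝ≥0} (hm : ∀ n, Measurable (G n)) :
    Measurable fun z : ℝ × ℝ => firstOpen G z.1.toNNReal z.2 :=
  measurable_firstOpen (A := ℝ) (G := fun _ => G) (T := Real.toNNReal)
    (fun n => (hm n).comp measurable_snd) measurable_real_toNNReal

variable (S σ μ) in
/-- The mean value of an external user who arrives at time `t`. -/
def valueAt (W : Mark N → ℕ → ℝ≥0∞) (G : ℕ → ℝ → ℝ≥0) (t : ℝ) : ℝ≥0∞ :=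
  ∫⁻ m, W m (firstOpen G t.toNNReal (S.delta σ (pos m 0))) ∂μ

theorem measurable_valueAt_aux {G : ℕ → ℝ → ℝ≥0} (hm : ∀ n, Measurable (G n))
    {W : Mark N → ℕ → ℝ≥0∞} (hW : ∀ i, Measurable fun m => W m i) :
    Measurable fun z : ℝ × Mark N => W z.2 (firstOpen G z.1.toNNReal (S.delta σ (pos z.2 0))) := by
  have h1 : Measurable fun z : ℝ × Mark N => (z.1, S.delta σ (pos z.2 0)) :=
    measurable_fst.prodMk ((S.measurable_delta_pos σ 0).comp measurable_snd)
  have h2 : Measurable fun z : ℝ × Mark N => firstOpen G z.1.toNNReal (S.delta σ (pos z.2 0)) :=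
    (measurable_firstOpen_time hm).comp h1
  have h3 : Measurable fun z : ℝ × Mark N =>
      (z.2, firstOpen G z.1.toNNReal (S.delta σ (pos z.2 0))) := measurable_snd.prodMk h2
  exact (measurable_value hW).comp h3

theorem measurable_valueAt [SFinite μ] {G : ℕ → ℝ → ℝ≥0} (hm : ∀ n, Measurable (G n))
    {W : Mark N → ℕ → ℝ≥0∞} (hW : ∀ i, Measurable fun m => W m i) :
    Measurable (S.valueAt σ μ W G) :=
  Measurable.lintegral_prod_right' (measurable_valueAt_aux hm hW)

variable (S μ) in
/-- Almost all marks have all their positions on the circle. -/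
def OnCircle : Prop := ∀ᵐ m ∂μ, ∀ j, pos m j ∈ Ico 0 S.L

/-- For a fixed mark, the times after `T` are grouped by the cycle of first service, each group
having length `gap`; Tonelli does the rest. The integral form is the one to which the exponential
identities apply, the form with gaps the one that behaves well under insertion. -/
theorem IsSchedule.future_eq [SFinite μ] (hμ : S.OnCircle μ) (hσ : σ ≠ 0) {G : ℕ → ℝ → ℝ≥0}
    (hG : S.IsSchedule G) (hm : ∀ n, Measurable (G n)) {W : Mark N → ℕ → ℝ≥0∞}
    (hW : ∀ i, Measurable fun m => W m i) (T : ℝ≥0) :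
    S.future σ μ W G T = ∫⁻ t in Ioi (T : ℝ), S.valueAt σ μ W G t := by
  unfold valueAt
  rw [lintegral_lintegral_swap (measurable_valueAt_aux hm hW).aemeasurable]
  refine lintegral_congr_ae ?_
  filter_upwards [hμ] with m hmpos
  have hy := S.delta_mem σ hσ (hmpos 0)
  have hmeas : Measurable fun t : ℝ => firstOpen G t.toNNReal (S.delta σ (pos m 0)) :=
    (measurable_firstOpen_time hm).comp (measurable_id.prodMk measurable_const)
  rw [← lintegral_map (μ := volume.restrict (Ioi (T : ℝ))) (f := fun i => W m i)
    (measurable_from_top) hmeas, lintegral_countable']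
  refine tsum_congr fun i => ?_
  rw [hG.coe_gap_eq hy, Measure.map_apply hmeas (measurableSet_singleton i),
    Measure.restrict_apply (hmeas (measurableSet_singleton i)), inter_comm]

theorem tsum_value_mul_gap_add_bump {G G' : ℕ → ℝ → ℝ≥0} {T : ℝ≥0} {n₀ : ℕ} {u : User N} {y : ℝ}
    (hG : Monotone fun i => G i y) (hG' : ∀ i, G' i y = G i y + S.bump σ n₀ u i y)
    (hT : ∀ j i, nextCycle (S.visit σ n₀ u j) y ≤ i → T ≤ G i y) (w : ℕ → ℝ≥0∞) :
    ∑' i, w i * gap G' T i y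
      = ∑' i, w i * gap G T i y + ∑ j, load u j * w (nextCycle (S.visit σ n₀ u j) y) := by
  simp only [gap_add_bump hG hG' hT]
  push_cast
  simp only [mul_add, ENNReal.tsum_add]
  congr 1
  simp only [Finset.mul_sum]
  rw [Summable.tsum_finsetSum fun _ _ => ENNReal.summable]
  refine Finset.sum_congr rfl fun j _ => ?_
  rw [tsum_eq_single (nextCycle (S.visit σ n₀ u j) y)]
  · simp [mul_comm]
  · intro i hi
    rw [if_neg hi.symm]
    simp

/-- The change of the future value if a user is inserted. -/
theorem future_add_bump [SFinite μ] (hμ : S.OnCircle μ) (hσ : σ ≠ 0) {G G' : ℕ → ℝ → ℝ≥0}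
    {T : ℝ≥0} {n₀ : ℕ} {u : User N} (hG : S.IsSchedule G)
    (hG' : ∀ i y, G' i y = G i y + S.bump σ n₀ u i y)
    (hT : ∀ j i, ∀ y ∈ Ico 0 S.L, nextCycle (S.visit σ n₀ u j) y ≤ i → T ≤ G i y)
    {W : Mark N → ℕ → ℝ≥0∞} (hW : ∀ i, Measurable fun m => W m i) :
    S.future σ μ W G' T
      = S.future σ μ W G T + ∑ j, load u j * S.meanValue σ μ W (S.visit σ n₀ u j) := by
  have hmW : ∀ e, Measurable fun m => W m (nextCycle e (S.delta σ (pos m 0))) := fun e =>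
    (measurable_value hW).comp (measurable_id.prodMk
      ((S.measurable_nextCycle_mark σ).comp (measurable_const.prodMk measurable_id)))
  unfold future meanValue
  have : ∫⁻ m, ∑' i, W m i * gap G' T i (S.delta σ (pos m 0)) ∂μ
      = ∫⁻ m, (∑' i, W m i * gap G T i (S.delta σ (pos m 0))
        + ∑ j, load u j * W m (nextCycle (S.visit σ n₀ u j) (S.delta σ (pos m 0)))) ∂μ := by
    refine lintegral_congr_ae ?_
    filter_upwards [hμ] with m hmpos
    have hy := S.delta_mem σ hσ (hmpos 0)
    exact tsum_value_mul_gap_add_bump (hG.monotone hy) (fun i => hG' i _)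
      (fun j i => hT j i _ hy) (W m)
  rw [this, lintegral_add_right _ (Finset.measurable_sum _ fun j _ => (hmW _).const_mul _),
    lintegral_finsetSum _ fun j _ => (hmW _).const_mul _]
  congr 1
  refine Finset.sum_congr rfl fun j _ => ?_
  rw [lintegral_const_mul _ (hmW _)]

theorem gap_insert {G G' : ℕ → ℝ → ℝ≥0} {n₀ : ℕ} {u : User N} {p : ℝ} (hG : S.IsSchedule G)
    (hp : p ∈ Ico 0 S.L)
    (hG' : ∀ i y, G' i y = G i y + S.bump σ n₀ u i y) (n : ℕ) :
    (gap G' 0 n p : ℝ≥0∞) = gap G 0 n p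
      + ∑ j, (load u j : ℝ≥0∞) * (if nextCycle (S.visit σ n₀ u j) p = n then 1 else 0 : ℝ≥0∞) := by
  rw [gap_add_bump (hG.monotone hp) (fun i => hG' i p) (fun _ _ _ => zero_le) n]
  push_cast
  congr 1
  refine Finset.sum_congr rfl fun j _ => ?_
  split_ifs <;> simp

end Network

end

/-! ### Mean and variance over generations; the martingale of second moments -/

section

namespace Network

variable {N : ℕ} [NeZero N] (S : Network N) (σ : ℕ∞) (μ : Measure (Mark N))

/-- The mean, over the external users who arrive during one unit of time of the visit `e`, of the sum of
their service times weighted by the function `f` of the visit. -/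
def offspring (f : ℕ × ℝ × Fin N → ℝ≥0∞) (e : ℕ × ℝ × Fin N) : ℝ≥0∞ :=
  ENNReal.ofReal S.lam * S.meanValue σ μ (S.total σ f) e

/-- The sum of `f` over all generations of offspring. -/
def resolvent (f : ℕ × ℝ × Fin N → ℝ≥0∞) (e : ℕ × ℝ × Fin N) : ℝ≥0∞ :=
  ∑' k, (S.offspring σ μ)^[k] f e

/-- Indicator of the visits that come between the starts of the external queue of `p` in the cycles
`n - 1` and `n`. -/
def passes (n : ℕ) (p : ℝ) (e : ℕ × ℝ × Fin N) : ℝ≥0∞ := if nextCycle e p = n then 1 else 0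

/-- The mean delay, in the `n`-th gap of `p`, that is due to one unit of service in a visit. -/
def influence (n : ℕ) (p : ℝ) : ℕ × ℝ × Fin N → ℝ≥0∞ := S.resolvent σ μ (passes n p)

/-- Intensity of the squares of the delays in the `n`-th gap of `p` that are due to the users who arrive
during a visit. -/
def meanSq (n : ℕ) (p : ℝ) (e : ℕ × ℝ × Fin N) : ℝ≥0∞ :=
  ENNReal.ofReal S.lam * S.meanValue σ μ (fun m i => S.total σ (S.influence σ μ n p) m i ^ 2) e

/-- The variance of the delay in the `n`-th gap of `p` that is due to one unit of service in a visit. -/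
def varInfluence (n : ℕ) (p : ℝ) : ℕ × ℝ × Fin N → ℝ≥0∞ := S.resolvent σ μ (S.meanSq σ μ n p)

/-- The contribution of an external user to the variance of the `n`-th gap of `p`. -/
def varValue (n : ℕ) (p : ℝ) (m : Mark N) (i : ℕ) : ℝ≥0∞ :=
  S.total σ (S.influence σ μ n p) m i ^ 2 + S.total σ (S.varInfluence σ μ n p) m i

/-- The conditional second moment of the `n`-th gap of `p` given the external users who arrive before
time `T`, if `G` are the starting times in the absence of later arrivals. -/
def moment (n : ℕ) (p : ℝ) (G : ℕ → ℝ → ℝ≥0) (T : ℝ≥0) : ℝ≥0∞ :=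
  (gap G 0 n p + ENNReal.ofReal S.lam * S.future σ μ (S.total σ (S.influence σ μ n p)) G T) ^ 2
    + ENNReal.ofReal S.lam * S.future σ μ (S.varValue σ μ n p) G T

variable {S σ μ}

theorem measurable_meanValue_arg {W : Mark N → ℕ → ℝ≥0∞} (hW : ∀ i, Measurable fun m => W m i)
    (e : ℕ × ℝ × Fin N) : Measurable fun m => W m (nextCycle e (S.delta σ (pos m 0))) :=
  (measurable_value hW).comp (measurable_id.prodMk
    ((S.measurable_nextCycle_mark σ).comp (measurable_const.prodMk measurable_id)))

theorem meanValue_add {W W' : Mark N → ℕ → ℝ≥0∞} (hW : ∀ i, Measurable fun m => W m i)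
    (e : ℕ × ℝ × Fin N) : S.meanValue σ μ (fun m i => W m i + W' m i) e
      = S.meanValue σ μ W e + S.meanValue σ μ W' e :=
  lintegral_add_left (measurable_meanValue_arg hW e) _

theorem measurable_passes (n : ℕ) (p : ℝ) :
    Measurable (passes n p : ℕ × ℝ × Fin N → ℝ≥0∞) := by
  unfold passes
  refine Measurable.ite ?_ measurable_const measurable_const
  have h : Measurable fun e : ℕ × ℝ × Fin N => nextCycle e p :=
    measurable_nextCycle.comp (measurable_id.prodMk measurable_const)
  exact h (measurableSet_singleton n)

section Measurability

variable [SFinite μ] {f : ℕ × ℝ × Fin N → ℝ≥0∞}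

theorem measurable_offspring (hf : Measurable f) : Measurable (S.offspring σ μ f) :=
  (S.measurable_meanValue σ (S.measurable_total σ hf)).const_mul _

theorem measurable_iterate_offspring (hf : Measurable f) (k : ℕ) :
    Measurable ((S.offspring σ μ)^[k] f) := by
  induction k with
  | zero => exact hf
  | succ k ih =>
    rw [Function.iterate_succ_apply']
    exact measurable_offspring ih

theorem measurable_resolvent (hf : Measurable f) : Measurable (S.resolvent σ μ f) :=
  Measurable.tsum fun k => measurable_iterate_offspring hf k

/-- Splitting off generation zero of the Neumann series. All terms are nonnegative, so `offspring`
commutes with the sum whether or not it converges. -/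
theorem resolvent_eq (hf : Measurable f) (e : ℕ × ℝ × Fin N) :
    S.resolvent σ μ f e = f e + S.offspring σ μ (S.resolvent σ μ f) e := by
  have h : S.offspring σ μ (S.resolvent σ μ f) e = ∑' k, (S.offspring σ μ)^[k + 1] f e := by
    have h1 : ∀ k, (S.offspring σ μ)^[k + 1] f e
        = ENNReal.ofReal S.lam * S.meanValue σ μ (S.total σ ((S.offspring σ μ)^[k] f)) e := by
      intro k
      rw [Function.iterate_succ_apply']
      rfl
    simp only [h1]
    rw [ENNReal.tsum_mul_left, offspring]
    congr 1
    unfold meanValue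
    rw [← lintegral_tsum fun k => (measurable_meanValue_arg
      (S.measurable_total σ (measurable_iterate_offspring hf k)) e).aemeasurable]
    refine lintegral_congr fun m => ?_
    unfold total resolvent
    simp only [← ENNReal.tsum_mul_left]
    rw [Summable.tsum_finsetSum fun _ _ => ENNReal.summable]
  rw [h]
  unfold resolvent
  rw [tsum_eq_zero_add' ENNReal.summable]
  rfl

theorem measurable_influence (n : ℕ) (p : ℝ) : Measurable (S.influence σ μ n p) :=
  measurable_resolvent (measurable_passes n p)

theorem measurable_sq_total (n : ℕ) (p : ℝ) (i : ℕ) :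
    Measurable fun m => S.total σ (S.influence σ μ n p) m i ^ 2 :=
  (S.measurable_total σ (measurable_influence n p) i).pow_const 2

theorem measurable_meanSq (n : ℕ) (p : ℝ) : Measurable (S.meanSq σ μ n p) :=
  (S.measurable_meanValue σ (measurable_sq_total n p)).const_mul _

theorem measurable_varInfluence (n : ℕ) (p : ℝ) : Measurable (S.varInfluence σ μ n p) :=
  measurable_resolvent (measurable_meanSq n p)

theorem measurable_varValue (n : ℕ) (p : ℝ) (i : ℕ) :
    Measurable fun m => S.varValue σ μ n p m i :=
  (measurable_sq_total n p i).add (S.measurable_total σ (measurable_varInfluence n p) i)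

theorem influence_eq (n : ℕ) (p : ℝ) (e : ℕ × ℝ × Fin N) :
    S.influence σ μ n p e = passes n p e
      + ENNReal.ofReal S.lam * S.meanValue σ μ (S.total σ (S.influence σ μ n p)) e :=
  resolvent_eq (measurable_passes n p) e

/-- The variance of a compound Poisson sum comes from the second moments of its summands: the
squared mean effect of each arriving user plus the variance due to his descendants, which together
form `varValue`. -/
theorem varInfluence_eq (n : ℕ) (p : ℝ) (e : ℕ × ℝ × Fin N) :
    S.varInfluence σ μ n p e
      = ENNReal.ofReal S.lam * S.meanValue σ μ (S.varValue σ μ n p) e := by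
  rw [varInfluence, resolvent_eq (measurable_meanSq n p), meanSq, offspring, ← mul_add]
  congr 1
  exact (meanValue_add (measurable_sq_total n p) e).symm

/-- Each service delays the gap directly, through `passes`, and lengthens the time in which others
arrive. By the recursion these two effects add up to `influence`, and likewise for the variance. -/
theorem moment_add_bump (hμ : S.OnCircle μ) (hσ : σ ≠ 0) {G G' : ℕ → ℝ → ℝ≥0}
    {T : ℝ≥0} {n₀ : ℕ} {u : User N} (hG : S.IsSchedule G)
    (hG' : ∀ i y, G' i y = G i y + S.bump σ n₀ u i y)
    (hT : ∀ j i, ∀ y ∈ Ico 0 S.L, nextCycle (S.visit σ n₀ u j) y ≤ i → T ≤ G i y)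
    (n : ℕ) {p : ℝ} (hp : p ∈ Ico 0 S.L) :
    S.moment σ μ n p G' T
      = (gap G 0 n p + ENNReal.ofReal S.lam * S.future σ μ (S.total σ (S.influence σ μ n p)) G T
          + ∑ j, load u j * S.influence σ μ n p (S.visit σ n₀ u j)) ^ 2
        + (ENNReal.ofReal S.lam * S.future σ μ (S.varValue σ μ n p) G T
          + ∑ j, load u j * S.varInfluence σ μ n p (S.visit σ n₀ u j)) := by
  unfold moment
  rw [gap_insert hG hp hG', future_add_bump hμ hσ hG hG' hT
    (S.measurable_total σ (measurable_influence n p)), future_add_bump hμ hσ hG hG' hT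
    (measurable_varValue n p)]
  simp only [influence_eq n p (S.visit σ n₀ u _), varInfluence_eq n p, mul_add, Finset.mul_sum,
    Finset.sum_add_distrib, passes, mul_left_comm (ENNReal.ofReal S.lam)]
  congr 2
  abel

section Family

variable {A : Type*} [MeasurableSpace A] {G : A → ℕ → ℝ → ℝ≥0} {T : A → ℝ≥0}

theorem measurable_moment (hG : ∀ n, Measurable fun z : A × ℝ => G z.1 n z.2)
    (hT : Measurable T) (n : ℕ) (p : ℝ) :
    Measurable fun a => S.moment σ μ n p (G a) (T a) := by
  unfold moment
  have h1 : Measurable fun a => gap (G a) 0 n p :=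
    (measurable_gap hG measurable_const n).comp (measurable_id.prodMk measurable_const)
  exact ((h1.coe_nnreal_ennreal.add ((S.measurable_future σ (S.measurable_total σ
    (measurable_influence n p)) hG hT).const_mul _)).pow_const 2).add
    ((S.measurable_future σ (measurable_varValue n p) hG hT).const_mul _)

end Family

end Measurability

theorem setLIntegral_Ioi_add (b : ℝ → ℝ≥0∞) (T τ : ℝ) :
    ∫⁻ s in Ioi τ, b (T + s) = ∫⁻ t in Ioi (T + τ), b t := by
  rw [← lintegral_indicator measurableSet_Ioi, ← lintegral_indicator measurableSet_Ioi,
    ← lintegral_add_left_eq_self ((Ioi (T + τ)).indicator b) T]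
  refine lintegral_congr fun s => ?_
  simp [indicator]

/-- The conditional second moments form a martingale. -/
theorem lintegral_moment_insertUser [IsProbabilityMeasure μ] (hμ : S.OnCircle μ) (hσ : σ ≠ 0)
    {G : ℕ → ℝ → ℝ≥0} (hG : S.IsSchedule G) (hm : ∀ n, Measurable (G n)) (T : ℝ≥0) (n : ℕ)
    {p : ℝ} (hp : p ∈ Ico 0 S.L) :
    ∫⁻ z, S.moment σ μ n p (S.insertUser σ G (T + z.1).toNNReal z.2) (T + z.1).toNNReal
      ∂(expMeasure S.lam).prod μ = S.moment σ μ n p G T := by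
  have := S.isProbabilityMeasure_exp
  set U := S.total σ (S.influence σ μ n p) with hU
  set V := S.varValue σ μ n p with hV
  have hUm : ∀ i, Measurable fun m => U m i := S.measurable_total σ (measurable_influence n p)
  have hVm : ∀ i, Measurable fun m => V m i := measurable_varValue n p
  have hTm : Measurable fun z : ℝ × Mark N => (T + z.1).toNNReal := by fun_prop
  have hmeas : Measurable fun z : ℝ × Mark N =>
      S.moment σ μ n p (S.insertUser σ G (T + z.1).toNNReal z.2) (T + z.1).toNNReal :=
    measurable_moment (S.measurable_insertUser σ (A := ℝ × Mark N) (G := fun _ => G)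
      (fun n => (hm n).comp measurable_snd) hTm measurable_snd) hTm n p
  rw [lintegral_prod _ hmeas.aemeasurable]
  set ρ := ENNReal.ofReal S.lam with hρ
  set b : ℝ → ℝ≥0∞ := fun s => S.valueAt σ μ U G (T + s) with hb
  set c : ℝ → ℝ≥0∞ := fun s => S.valueAt σ μ V G (T + s) with hc
  have hbm : Measurable b := (measurable_valueAt hm hUm).comp (by fun_prop)
  have hcm : Measurable c := (measurable_valueAt hm hVm).comp (by fun_prop)
  have hfut : ∀ {W : Mark N → ℕ → ℝ≥0∞}, (∀ i, Measurable fun m => W m i) → ∀ τ : ℝ, 0 ≤ τ →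
      S.future σ μ W G (T + τ).toNNReal = ∫⁻ s in Ioi τ, S.valueAt σ μ W G (T + s) := by
    intro W hW τ hτ
    rw [hG.future_eq hμ hσ hm hW, setLIntegral_Ioi_add, Real.coe_toNNReal _ (by positivity)]
  have hstep : ∀ τ : ℝ, 0 < τ → ∫⁻ m, S.moment σ μ n p (S.insertUser σ G (T + τ).toNNReal m)
        (T + τ).toNNReal ∂μ
      = ((gap G 0 n p + ρ * ∫⁻ s in Ioi τ, b s) ^ 2
          + 2 * (gap G 0 n p + ρ * ∫⁻ s in Ioi τ, b s) * b τ)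
        + (ρ * (∫⁻ s in Ioi τ, c s) + c τ) := by
    intro τ hτ
    set a := gap G 0 n p + ρ * ∫⁻ s in Ioi τ, b s
    set i : Mark N → ℕ := fun m => firstOpen G (T + τ).toNNReal (S.delta σ (pos m 0))
    have him : Measurable i := (measurable_firstOpen_time hm).comp
      (measurable_const.prodMk (S.measurable_delta_pos σ 0))
    have hWi : ∀ {W : Mark N → ℕ → ℝ≥0∞}, (∀ i, Measurable fun m => W m i) →
        Measurable fun m => W m (i m) := fun hW =>
      (measurable_value hW).comp (measurable_id.prodMk him)
    have h1 : ∫⁻ m, S.moment σ μ n p (S.insertUser σ G (T + τ).toNNReal m) (T + τ).toNNReal ∂μ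
        = ∫⁻ m, (a ^ 2 + 2 * a * U m (i m) + (ρ * (∫⁻ s in Ioi τ, c s) + V m (i m))) ∂μ := by
      refine lintegral_congr_ae ?_
      filter_upwards [hμ] with m hmpos
      rw [moment_add_bump hμ hσ hG
        (G' := S.insertUser σ G (T + τ).toNNReal m) (n₀ := i m) (u := (0, m)) (fun _ _ => rfl)
        (fun j i y hy h => (hG.lt_of_nextCycle_le (S.delta_mem σ hσ (hmpos 0)) hy h).le) n hp,
        ← hU, ← hV, ← hρ, hfut hUm τ hτ.le, hfut hVm τ hτ.le]
      change (a + U m (i m)) ^ 2 + (ρ * (∫⁻ s in Ioi τ, c s)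
        + S.total σ (S.varInfluence σ μ n p) m (i m)) = _
      -- Expanding the square, the term `U²` joins the variance of the descendants and forms
      -- `varValue`.
      rw [hV]
      unfold varValue
      rw [← hU]
      ring
    have hadd : Measurable fun m => a ^ 2 + 2 * a * U m (i m) :=
      measurable_const.add ((hWi hUm).const_mul _)
    rw [h1, lintegral_add_left hadd,
      lintegral_add_left measurable_const, lintegral_add_left measurable_const,
      lintegral_const_mul _ (hWi hUm), lintegral_const, lintegral_const, measure_univ, mul_one,
      mul_one]
    rfl
  have h2 : ∫⁻ τ, ∫⁻ m, S.moment σ μ n p (S.insertUser σ G (T + (τ, m).1).toNNReal (τ, m).2)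
        (T + (τ, m).1).toNNReal ∂μ ∂expMeasure S.lam
      = ∫⁻ τ, (((gap G 0 n p + ρ * ∫⁻ s in Ioi τ, b s) ^ 2
          + 2 * (gap G 0 n p + ρ * ∫⁻ s in Ioi τ, b s) * b τ)
        + (ρ * (∫⁻ s in Ioi τ, c s) + c τ)) ∂expMeasure S.lam := by
    refine lintegral_congr_ae ?_
    filter_upwards [ae_expMeasure_pos S.lam_pos] with τ hτ
    exact hstep τ hτ
  have hcI : Measurable fun τ => ∫⁻ s in Ioi τ, c s :=
    Antitone.measurable fun s t h => lintegral_mono_set (Ioi_subset_Ioi h)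
  have hadd : Measurable fun τ => ρ * (∫⁻ s in Ioi τ, c s) + c τ := (hcI.const_mul _).add hcm
  -- The squared mean is preserved by the quadratic exponential identity, the variance by the linear
  -- one.
  rw [h2, lintegral_add_right _ hadd, lintegral_expMeasure_sq S.lam_pos hbm,
    lintegral_expMeasure_future S.lam_pos hcm]
  unfold moment
  have h3 := hfut hUm 0 le_rfl
  have h4 := hfut hVm 0 le_rfl
  rw [add_zero, Real.toNNReal_coe] at h3 h4
  rw [← hU, ← hV, h3, h4]

end Network

end

/-! ### Independent arrivals and the constant mean of `moment` -/

section

section Resampling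

variable {X : Type*} [MeasurableSpace X] (ζ : Measure X) [IsProbabilityMeasure ζ]

/-- Resampling one coordinate of a sequence of independent and identically distributed random
variables. -/
theorem lintegral_infinitePi_update (k : ℕ) {F : (ℕ → X) → ℝ≥0∞} (hF : Measurable F) :
    ∫⁻ ω, F ω ∂Measure.infinitePi (fun _ : ℕ => ζ)
      = ∫⁻ ω, ∫⁻ z, F (Function.update ω k z) ∂ζ ∂Measure.infinitePi (fun _ : ℕ => ζ) := by
  set P := Measure.infinitePi (fun _ : ℕ => ζ) with hP
  have hm : Measurable fun x : (ℕ → X) × X => Function.update x.1 k x.2 := by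
    refine measurable_pi_iff.2 fun i => ?_
    by_cases h : i = k
    · subst h
      simpa using measurable_snd
    · simp only [Function.update_of_ne h]
      exact (measurable_pi_apply i).comp measurable_fst
  have hmap : (P.prod ζ).map (fun x : (ℕ → X) × X => Function.update x.1 k x.2) = P := by
    refine Measure.eq_infinitePi _ fun s t ht => ?_
    rw [Measure.map_apply hm (MeasurableSet.pi s.countable_toSet fun i _ => ht i)]
    have : (fun x : (ℕ → X) × X => Function.update x.1 k x.2) ⁻¹' (Set.pi s t)
        = (Set.pi (s.erase k) t) ×ˢ (if k ∈ s then t k else univ) := by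
      ext x
      simp only [mem_preimage, Set.mem_pi, Finset.mem_coe, mem_prod, Finset.mem_erase]
      constructor
      · intro h
        refine ⟨fun i hi => by simpa [hi.1] using h i hi.2, ?_⟩
        split_ifs with hk
        · simpa using h k hk
        · trivial
      · rintro ⟨h1, h2⟩ i hi
        by_cases hik : i = k
        · subst hik
          rw [if_pos hi] at h2
          simpa using h2
        · simpa [hik] using h1 i ⟨hik, hi⟩
    rw [this, Measure.prod_prod, hP, Measure.infinitePi_pi _ fun i _ => ht i]
    by_cases hk : k ∈ s
    · rw [if_pos hk, Finset.prod_erase_mul _ _ hk]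
    · rw [if_neg hk, measure_univ, mul_one, Finset.erase_eq_of_notMem hk]
  conv_lhs => rw [← hmap]
  have hc : Measurable fun x : (ℕ → X) × X => F (Function.update x.1 k x.2) := hF.comp hm
  rw [lintegral_map hF hm, lintegral_prod _ hc.aemeasurable]

theorem ae_infinitePi {p : X → Prop} (hp : ∀ᵐ x ∂ζ, p x) :
    ∀ᵐ ω ∂Measure.infinitePi (fun _ : ℕ => ζ), ∀ k, p (ω k) := by
  rw [ae_all_iff]
  intro k
  exact (measurePreserving_eval_infinitePi (fun _ : ℕ => ζ) k).quasiMeasurePreserving.ae hp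

end Resampling

namespace Network

variable {N : ℕ} [NeZero N] {S : Network N} {σ : ℕ∞} {μ : Measure (Mark N)}

variable (S μ) in
/-- Law of the external arrivals, if the marks have law `μ`. -/
def pathLaw : Measure (ℕ → ℝ × Mark N) :=
  Measure.infinitePi fun _ => (expMeasure S.lam).prod μ

instance [IsProbabilityMeasure μ] : IsProbabilityMeasure (S.pathLaw μ) := by
  unfold pathLaw; infer_instance

/-- The arrival time of the user before the `k`-th one. -/
def prevTime (ω : ℕ → ℝ × Mark N) (k : ℕ) : ℝ≥0 := (∑ i ∈ Finset.range k, (ω i).1).toNNReal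

theorem measurable_prevTime (k : ℕ) : Measurable fun ω : ℕ → ℝ × Mark N => prevTime ω k := by
  unfold prevTime
  exact (Finset.measurable_sum _ fun i _ => (measurable_pi_apply i).fst).real_toNNReal

theorem ae_isRegular [IsProbabilityMeasure μ] (hμ : S.OnCircle μ) :
    ∀ᵐ ω ∂S.pathLaw μ, S.IsRegular ω := by
  refine ae_infinitePi ((expMeasure S.lam).prod μ)
    (p := fun z => 0 ≤ z.1 ∧ ∀ j, pos z.2 j ∈ Ico 0 S.L) ?_
  have h1 := Measure.quasiMeasurePreserving_fst (μ := expMeasure S.lam) (ν := μ) |>.ae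
    (ae_expMeasure_pos S.lam_pos)
  have h2 := Measure.quasiMeasurePreserving_snd (μ := expMeasure S.lam) (ν := μ) |>.ae hμ
  filter_upwards [h1, h2] with z hz1 hz2
  exact ⟨hz1.le, hz2⟩

/-- The mean of `exp(-prevTime)` is a power of a constant below one, so the infimum over `k` of
these exponentials is almost surely zero. -/
theorem ae_exists_lt_prevTime [IsProbabilityMeasure μ] :
    ∀ᵐ ω ∂S.pathLaw μ, ∀ t : ℝ≥0, ∃ k, t < prevTime ω k := by
  set ζ := (expMeasure S.lam).prod μ with hζ
  set e : ℝ × Mark N → ℝ≥0∞ := fun z => ENNReal.ofReal (Real.exp (-z.1)) with he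
  have hem : Measurable e := by fun_prop
  set F : ℕ → (ℕ → ℝ × Mark N) → ℝ≥0∞ := fun k ω => ∏ i ∈ Finset.range k, e (ω i) with hF
  have hFm : ∀ k, Measurable (F k) := fun k =>
    Finset.measurable_prod _ fun i _ => hem.comp (measurable_pi_apply i)
  set c := ∫⁻ z, e z ∂ζ with hc
  have hc1 : c < 1 := by
    have h1 : ∫⁻ _, (1 : ℝ≥0∞) ∂ζ = 1 := by simp
    rw [← h1]
    refine lintegral_strict_mono (IsProbabilityMeasure.ne_zero ζ) aemeasurable_const ?_ ?_
    · refine ne_top_of_le_ne_top ENNReal.one_ne_top (h1 ▸ lintegral_mono_ae ?_)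
      have h2 := Measure.quasiMeasurePreserving_fst (μ := expMeasure S.lam) (ν := μ) |>.ae
        (ae_expMeasure_pos S.lam_pos)
      filter_upwards [h2] with z hz
      simp only [he]
      rw [ENNReal.ofReal_le_one, Real.exp_le_one_iff]
      linarith
    · have h2 := Measure.quasiMeasurePreserving_fst (μ := expMeasure S.lam) (ν := μ) |>.ae
        (ae_expMeasure_pos S.lam_pos)
      filter_upwards [h2] with z hz
      simp only [he]
      rw [ENNReal.ofReal_lt_one, Real.exp_lt_one_iff]
      linarith
  have hint : ∀ k, ∫⁻ ω, F k ω ∂S.pathLaw μ = c ^ k := by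
    intro k
    induction k with
    | zero => simp [hF]
    | succ k ih =>
      unfold pathLaw at ih ⊢
      rw [lintegral_infinitePi_update ζ k (hFm (k + 1)), pow_succ, ← ih,
        ← lintegral_mul_const _ (hFm k)]
      refine lintegral_congr fun ω => ?_
      rw [hc, ← lintegral_const_mul _ hem]
      refine lintegral_congr fun z => ?_
      simp only [hF]
      rw [Finset.prod_range_succ, Function.update_self]
      congr 1
      refine Finset.prod_congr rfl fun i hi => ?_
      rw [Function.update_of_ne (Finset.mem_range.1 hi).ne]
  have h0 : ∫⁻ ω, ⨅ k, F k ω ∂S.pathLaw μ = 0 := by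
    refine le_antisymm ?_ zero_le
    refine ge_of_tendsto' (ENNReal.tendsto_pow_atTop_nhds_zero_of_lt_one hc1) fun k => ?_
    rw [← hint k]
    exact lintegral_mono fun ω => iInf_le _ k
  rw [lintegral_eq_zero_iff (Measurable.iInf hFm)] at h0
  filter_upwards [h0] with ω hω t
  have h3 : ⨅ k, F k ω < ENNReal.ofReal (Real.exp (-t)) := by
    rw [hω]
    simpa using Real.exp_pos _
  obtain ⟨k, hk⟩ := iInf_lt_iff.1 h3
  refine ⟨k, ?_⟩
  simp only [hF, he] at hk
  rw [← ENNReal.ofReal_prod_of_nonneg fun _ _ => (Real.exp_pos _).le, ← Real.exp_sum,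
    ENNReal.ofReal_lt_ofReal_iff (Real.exp_pos _), Real.exp_lt_exp, Finset.sum_neg_distrib,
    neg_lt_neg_iff] at hk
  unfold prevTime
  rwa [Real.lt_toNNReal_iff_coe_lt]

/-- The first `k` insertions ignore later coordinates, so resampling coordinate `k` keeps them
fixed. -/
theorem sched_congr {G₀ : ℕ → ℝ → ℝ≥0} {ω ω' : ℕ → ℝ × Mark N} {k : ℕ}
    (h : ∀ i < k, ω i = ω' i) : S.sched σ G₀ ω k = S.sched σ G₀ ω' k := by
  induction k with
  | zero => rfl
  | succ k ih =>
    have h1 : arrTime ω k = arrTime ω' k := by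
      unfold arrTime
      congr 1
      exact Finset.sum_congr rfl fun i hi => by rw [h i (Finset.mem_range.1 hi)]
    rw [sched, sched, ih fun i hi => h i (by omega), h1, h k (by omega)]

/-- The mean of the conditional second moments does not depend on the number of arrivals that are
taken into account. -/
theorem lintegral_moment_sched [IsProbabilityMeasure μ] (hμ : S.OnCircle μ) (hσ : σ ≠ 0)
    {G₀ : ℕ → ℝ → ℝ≥0} (hG : S.IsSchedule G₀) (hm : ∀ n, Measurable (G₀ n)) (n : ℕ)
    {p : ℝ} (hp : p ∈ Ico 0 S.L) (k : ℕ) :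
    ∫⁻ ω, S.moment σ μ n p (S.sched σ G₀ ω k) (prevTime ω k) ∂S.pathLaw μ
      = S.moment σ μ n p G₀ 0 := by
  induction k with
  | zero => simp [sched, prevTime]
  | succ k ih =>
    rw [← ih]
    have hmeas : Measurable fun ω : ℕ → ℝ × Mark N =>
        S.moment σ μ n p (S.sched σ G₀ ω (k + 1)) (prevTime ω (k + 1)) :=
      measurable_moment (G := fun ω => S.sched σ G₀ ω (k + 1)) (S.measurable_sched σ hm (k + 1))
        (measurable_prevTime (k + 1)) n p
    -- Resampling coordinate `k` averages over the next arrival while the first `k` stay fixed,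
    -- which takes the place of a conditional expectation.
    have h1 : ∫⁻ ω, S.moment σ μ n p (S.sched σ G₀ ω (k + 1)) (prevTime ω (k + 1)) ∂S.pathLaw μ
        = ∫⁻ ω, ∫⁻ z, S.moment σ μ n p (S.sched σ G₀ (Function.update ω k z) (k + 1))
          (prevTime (Function.update ω k z) (k + 1)) ∂(expMeasure S.lam).prod μ ∂S.pathLaw μ :=
      have := S.isProbabilityMeasure_exp
      lintegral_infinitePi_update ((expMeasure S.lam).prod μ) k hmeas
    rw [h1]
    refine lintegral_congr_ae ?_
    filter_upwards [ae_isRegular hμ] with ω hω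
    have hmk : ∀ n, Measurable (S.sched σ G₀ ω k n) := fun n =>
      (S.measurable_sched σ hm k n).comp (measurable_const.prodMk measurable_id)
    rw [← lintegral_moment_insertUser hμ hσ (hG.sched ω k) hmk (prevTime ω k) n hp]
    refine lintegral_congr fun z => ?_
    have h2 : ∀ i < k, Function.update ω k z i = ω i := fun i hi => Function.update_of_ne hi.ne _ _
    have h3 : prevTime (Function.update ω k z) (k + 1) = (prevTime ω k + z.1).toNNReal := by
      unfold prevTime
      rw [Finset.sum_range_succ, Function.update_self, Real.coe_toNNReal _
        (Finset.sum_nonneg fun i _ => (hω i).1)]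
      congr 2
      exact Finset.sum_congr rfl fun i hi => by rw [h2 i (Finset.mem_range.1 hi)]
    have h4 : arrTime (Function.update ω k z) k = prevTime (Function.update ω k z) (k + 1) := rfl
    rw [sched, h4, h3, sched_congr h2, Function.update_self]

end Network

end

/-! ### Light traffic and geometric decay -/

section

/-- A weight that decays geometrically with the number of cycles between `i` and `n`. -/
def wt (n i : ℕ) : ℝ≥0∞ := if i ≤ n then 2 * 2⁻¹ ^ (n - i) else 0

theorem wt_of_lt {n i : ℕ} (h : n < i) : wt n i = 0 := if_neg (not_le.2 h)

theorem wt_le_two (n i : ℕ) : wt n i ≤ 2 := by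
  unfold wt
  split_ifs
  · calc (2 : ℝ≥0∞) * 2⁻¹ ^ (n - i) ≤ 2 * 1 := by
          gcongr
          exact pow_le_one₀ zero_le (by simp)
      _ = 2 := mul_one 2
  · exact zero_le

theorem wt_succ_le (n i : ℕ) : wt n (i + 1) ≤ 2 * wt n i := by
  unfold wt
  by_cases h : i + 1 ≤ n
  · rw [if_pos h, if_pos (by omega)]
    have : n - i = (n - (i + 1)) + 1 := by omega
    rw [this, pow_succ, mul_comm _ (2⁻¹ : ℝ≥0∞), ← mul_assoc 2 2⁻¹,
      ENNReal.mul_inv_cancel (by simp) (by simp), one_mul]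
  · rw [if_neg h]; exact zero_le

theorem wt_add_le (n i d : ℕ) : wt n (i + d) ≤ 2 ^ d * wt n i := by
  induction d with
  | zero => simp
  | succ d ih =>
    calc wt n (i + d + 1) ≤ 2 * wt n (i + d) := wt_succ_le _ _
      _ ≤ 2 * (2 ^ d * wt n i) := by gcongr
      _ = 2 ^ (d + 1) * wt n i := by ring

theorem wt_le_of_le {n i i' d : ℕ} (h : i ≤ i') (h' : i' ≤ i + d) : wt n i' ≤ 2 ^ d * wt n i := by
  obtain ⟨k, rfl⟩ := Nat.exists_eq_add_of_le h
  refine (wt_add_le n i k).trans ?_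
  gcongr
  · exact one_le_two
  · omega

theorem tendsto_wt (i : ℕ) : Tendsto (fun n => wt n i) atTop (𝓝 0) := by
  have h : Tendsto (fun n : ℕ => (2 : ℝ≥0∞) * 2⁻¹ ^ n) atTop (𝓝 (2 * 0)) :=
    ENNReal.Tendsto.const_mul (ENNReal.tendsto_pow_atTop_nhds_zero_of_lt_one (by simp))
      (Or.inr (by simp))
  rw [mul_zero] at h
  rw [← tendsto_add_atTop_iff_nat i]
  refine h.congr fun n => ?_
  simp [wt]

theorem tsum_wt_one_lt_top (c : ℝ≥0∞) (hc : c ≠ ⊤) : ∑' d, c * wt d 1 ≠ ⊤ := by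
  rw [ENNReal.tsum_mul_left]
  refine ENNReal.mul_ne_top hc ?_
  -- For `d ≥ 1` the weight `wt d 1` is `2 · 2^{-(d-1)} = 4 · 2^{-d}`.
  refine ne_top_of_le_ne_top (b := ∑' d, 4 * 2⁻¹ ^ d) ?_ (ENNReal.tsum_le_tsum fun d => ?_)
  · rw [ENNReal.tsum_mul_left, ENNReal.tsum_geometric]
    refine ENNReal.mul_ne_top (by simp) ?_
    simp
  · unfold wt
    split_ifs with h
    · obtain ⟨k, rfl⟩ := Nat.exists_eq_add_of_le' h
      rw [Nat.add_sub_cancel, pow_succ, mul_comm _ (2⁻¹ : ℝ≥0∞), ← mul_assoc 4]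
      gcongr
      rw [← div_eq_mul_inv, ENNReal.le_div_iff_mul_le (by simp) (by simp)]
      norm_num
    · exact zero_le

variable {N : ℕ}

theorem measurable_totalSvc : Measurable fun m : Mark N => totalSvc m := by
  unfold totalSvc
  exact Finset.measurable_sum _ fun j _ => measurable_svc j

namespace Network

variable [NeZero N] {S : Network N} {σ : ℕ∞} {μ : Measure (Mark N)}

variable (S μ) in
/-- The service times are short, compared to the inter-arrival times, and have a second moment. -/
structure IsLight : Prop where
  mean : ENNReal.ofReal S.lam * (2 ^ (N + 1) * ∫⁻ m, totalSvc m ∂μ) ≤ 2⁻¹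
  sq : ∫⁻ m, (totalSvc m : ℝ≥0∞) ^ 2 ∂μ ≠ ⊤

variable {f : ℕ × ℝ × Fin N → ℝ≥0∞} {n : ℕ} {c : ℝ≥0∞}

/-- Every service of a user falls at most `N` cycles after his first one, which costs a factor `2 ^
N` in the weight. -/
theorem total_le (hf : ∀ e, f e ≤ c * wt n e.1) (m : Mark N) (i : ℕ) :
    S.total σ f m i ≤ totalSvc m * (2 ^ N * c * wt n i) := by
  have h : (∑ j, (load (0, m) j : ℝ≥0∞)) ≤ totalSvc m := by
    exact_mod_cast sum_load_le ((0, m) : User N)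
  calc S.total σ f m i ≤ ∑ j, (load (0, m) j : ℝ≥0∞) * (2 ^ N * c * wt n i) := by
        unfold total
        gcongr with j
        refine (hf _).trans ?_
        calc c * wt n (S.visit σ i (0, m) j).1 ≤ c * (2 ^ N * wt n i) := by
              gcongr
              exact wt_le_of_le (S.le_visit σ i _ j) (S.visit_le σ i _ j)
          _ = _ := by ring
    _ = (∑ j, (load (0, m) j : ℝ≥0∞)) * (2 ^ N * c * wt n i) := by rw [Finset.sum_mul]
    _ ≤ _ := by gcongr

theorem meanValue_le {W : Mark N → ℕ → ℝ≥0∞} {w : Mark N → ℝ≥0∞} (hw : Measurable w)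
    (hW : ∀ m i, W m i ≤ w m * wt n i) (e : ℕ × ℝ × Fin N) :
    S.meanValue σ μ W e ≤ (∫⁻ m, w m ∂μ) * (2 * wt n e.1) := by
  unfold meanValue
  rw [← lintegral_mul_const _ hw]
  refine lintegral_mono fun m => (hW _ _).trans ?_
  gcongr
  simpa using wt_le_of_le (n := n) (d := 1) (le_nextCycle e (S.delta σ (pos m 0)))
    (nextCycle_le e (S.delta σ (pos m 0)))

/-- The contraction: a factor `2 ^ N` for the later services and `2` for a first service in the next
cycle give the `2 ^ (N + 1)` of `IsLight.mean`. -/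
theorem offspring_le (hμ : S.IsLight μ) (hf : ∀ e, f e ≤ c * wt n e.1) (e : ℕ × ℝ × Fin N) :
    S.offspring σ μ f e ≤ 2⁻¹ * c * wt n e.1 := by
  have h1 : ∀ m i, S.total σ f m i ≤ (totalSvc m * (2 ^ N * c)) * wt n i := fun m i =>
    (total_le hf m i).trans_eq (by ring)
  have h2 := meanValue_le (S := S) (σ := σ) (μ := μ)
    (measurable_totalSvc.coe_nnreal_ennreal.mul_const (2 ^ N * c)) h1 e
  rw [lintegral_mul_const _ measurable_totalSvc.coe_nnreal_ennreal] at h2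
  calc S.offspring σ μ f e ≤ ENNReal.ofReal S.lam *
        ((∫⁻ m, totalSvc m ∂μ) * (2 ^ N * c) * (2 * wt n e.1)) := by unfold offspring; gcongr
    _ = ENNReal.ofReal S.lam * (2 ^ (N + 1) * ∫⁻ m, totalSvc m ∂μ) * (c * wt n e.1) := by ring
    _ ≤ 2⁻¹ * (c * wt n e.1) := by gcongr; exact hμ.mean
    _ = _ := by ring

theorem iterate_offspring_le (hμ : S.IsLight μ) (hf : ∀ e, f e ≤ c * wt n e.1) (k : ℕ)
    (e : ℕ × ℝ × Fin N) : (S.offspring σ μ)^[k] f e ≤ 2⁻¹ ^ k * c * wt n e.1 := by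
  induction k generalizing e with
  | zero => simpa using hf e
  | succ k ih =>
    rw [Function.iterate_succ_apply', pow_succ']
    exact (offspring_le hμ ih e).trans_eq (by ring)

theorem resolvent_le (hμ : S.IsLight μ) (hf : ∀ e, f e ≤ c * wt n e.1) (e : ℕ × ℝ × Fin N) :
    S.resolvent σ μ f e ≤ 2 * c * wt n e.1 := by
  calc S.resolvent σ μ f e ≤ ∑' k, 2⁻¹ ^ k * (c * wt n e.1) :=
        ENNReal.tsum_le_tsum fun k => (iterate_offspring_le hμ hf k e).trans_eq (by ring)
    _ = 2 * c * wt n e.1 := by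
        rw [ENNReal.tsum_mul_right, ENNReal.tsum_geometric, ENNReal.one_sub_inv_two, inv_inv]
        ring

/-- A visit is passed only in its own cycle or the next, where the weight is `2` or `1`; hence the
leading factor in `wt`. -/
theorem passes_le (n : ℕ) (p : ℝ) (e : ℕ × ℝ × Fin N) : passes n p e ≤ 1 * wt n e.1 := by
  unfold passes
  split_ifs with h
  · have h1 := le_nextCycle e p
    have h2 := nextCycle_le e p
    unfold wt
    rw [if_pos (by omega), one_mul]
    rcases (show n - e.1 = 0 ∨ n - e.1 = 1 by omega) with h3 | h3
    · rw [h3, pow_zero, mul_one]; exact one_le_two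
    · rw [h3, pow_one, ENNReal.mul_inv_cancel (by simp) (by simp)]
  · exact zero_le

theorem influence_le (hμ : S.IsLight μ) (n : ℕ) (p : ℝ) (e : ℕ × ℝ × Fin N) :
    S.influence σ μ n p e ≤ 2 * wt n e.1 :=
  (resolvent_le hμ (passes_le n p) e).trans_eq (by ring)

theorem total_influence_le (hμ : S.IsLight μ) (n : ℕ) (p : ℝ) (m : Mark N) (i : ℕ) :
    S.total σ (S.influence σ μ n p) m i ≤ (totalSvc m * 2 ^ (N + 1)) * wt n i :=
  (total_le (influence_le hμ n p) m i).trans_eq (by ring)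

/-- Squaring produces two weights; one is replaced by its maximum `2`, and the other keeps the
decay. -/
theorem sq_total_influence_le (hμ : S.IsLight μ) (n : ℕ) (p : ℝ) (m : Mark N) (i : ℕ) :
    S.total σ (S.influence σ μ n p) m i ^ 2
      ≤ ((totalSvc m : ℝ≥0∞) ^ 2 * (2 * (2 ^ (N + 1)) ^ 2)) * wt n i := by
  calc S.total σ (S.influence σ μ n p) m i ^ 2 ≤ ((totalSvc m * 2 ^ (N + 1)) * wt n i) ^ 2 := by
        gcongr; exact total_influence_le hμ n p m i
    _ = ((totalSvc m : ℝ≥0∞) ^ 2 * (2 ^ (N + 1)) ^ 2) * wt n i * wt n i := by ring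
    _ ≤ ((totalSvc m : ℝ≥0∞) ^ 2 * (2 ^ (N + 1)) ^ 2) * wt n i * 2 := by gcongr; exact wt_le_two _ _
    _ = _ := by ring

variable (S μ) in
/-- A bound of the intensity `meanSq`. -/
def sqBound : ℝ≥0∞ :=
  ENNReal.ofReal S.lam * ((∫⁻ m, (totalSvc m : ℝ≥0∞) ^ 2 ∂μ) * (2 * (2 ^ (N + 1)) ^ 2) * 2)

theorem meanSq_le (hμ : S.IsLight μ) (n : ℕ) (p : ℝ) (e : ℕ × ℝ × Fin N) :
    S.meanSq σ μ n p e ≤ S.sqBound μ * wt n e.1 := by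
  have hm : Measurable fun m : Mark N => (totalSvc m : ℝ≥0∞) ^ 2 :=
    measurable_totalSvc.coe_nnreal_ennreal.pow_const 2
  have h := meanValue_le (S := S) (σ := σ) (μ := μ) (hm.mul_const (2 * (2 ^ (N + 1)) ^ 2))
    (sq_total_influence_le (S := S) (σ := σ) hμ n p) e
  rw [lintegral_mul_const _ hm] at h
  unfold meanSq sqBound
  calc _ ≤ ENNReal.ofReal S.lam * ((∫⁻ m, (totalSvc m : ℝ≥0∞) ^ 2 ∂μ) * (2 * (2 ^ (N + 1)) ^ 2)
        * (2 * wt n e.1)) := by gcongr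
    _ = _ := by ring

theorem varInfluence_le (hμ : S.IsLight μ) (n : ℕ) (p : ℝ) (e : ℕ × ℝ × Fin N) :
    S.varInfluence σ μ n p e ≤ 2 * S.sqBound μ * wt n e.1 :=
  resolvent_le hμ (meanSq_le hμ n p) e

variable (S μ) in
/-- A bound of `varValue`. -/
def varBound (m : Mark N) : ℝ≥0∞ :=
  (totalSvc m : ℝ≥0∞) ^ 2 * (2 * (2 ^ (N + 1)) ^ 2) + totalSvc m * (2 ^ N * (2 * S.sqBound μ))

theorem varValue_le (hμ : S.IsLight μ) (n : ℕ) (p : ℝ) (m : Mark N) (i : ℕ) :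
    S.varValue σ μ n p m i ≤ S.varBound μ m * wt n i := by
  unfold varValue varBound
  rw [add_mul]
  gcongr
  · exact sq_total_influence_le hμ n p m i
  · exact (total_le (varInfluence_le hμ n p) m i).trans_eq (by ring)

theorem IsLight.lintegral_totalSvc_ne_top (hμ : S.IsLight μ) : ∫⁻ m, totalSvc m ∂μ ≠ ⊤ := by
  intro h
  have h1 := hμ.mean
  rw [h, ENNReal.mul_top (by simp), ENNReal.mul_top (by simpa using S.lam_pos)] at h1
  simp at h1

theorem IsLight.sqBound_ne_top (hμ : S.IsLight μ) : S.sqBound μ ≠ ⊤ := by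
  unfold sqBound
  have := hμ.sq
  finiteness

theorem measurable_varBound : Measurable (S.varBound μ) := by
  unfold varBound
  exact ((measurable_totalSvc.coe_nnreal_ennreal.pow_const 2).mul_const _).add
    (measurable_totalSvc.coe_nnreal_ennreal.mul_const _)

theorem IsLight.lintegral_varBound_ne_top (hμ : S.IsLight μ) : ∫⁻ m, S.varBound μ m ∂μ ≠ ⊤ := by
  have hm : Measurable fun m : Mark N => (totalSvc m : ℝ≥0∞) ^ 2 :=
    measurable_totalSvc.coe_nnreal_ennreal.pow_const 2
  unfold varBound
  rw [lintegral_add_left (hm.mul_const _), lintegral_mul_const _ hm,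
    lintegral_mul_const _ measurable_totalSvc.coe_nnreal_ennreal]
  have h1 := hμ.sq
  have h2 := hμ.lintegral_totalSvc_ne_top
  have h3 := hμ.sqBound_ne_top
  finiteness

/-- No user first served after cycle `n` counts, and the gaps up to cycle `n` add up to at most the
start at `y`. The start at `0` one cycle later bounds this for all `y` at once, which makes it
usable for domination. -/
theorem future_le (hμ : S.OnCircle μ) (hσ : σ ≠ 0) {G : ℕ → ℝ → ℝ≥0} (hG : S.IsSchedule G)
    {W : Mark N → ℕ → ℝ≥0∞} {w : Mark N → ℝ≥0∞} (hw : Measurable w)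
    (hW : ∀ m i, W m i ≤ w m * wt n i) (T : ℝ≥0) :
    S.future σ μ W G T ≤ (∫⁻ m, w m ∂μ) * (2 * G (n + 1) 0) := by
  unfold future
  rw [← lintegral_mul_const _ hw]
  refine lintegral_mono_ae ?_
  filter_upwards [hμ] with m hm
  set y := S.delta σ (pos m 0)
  have hy : y ∈ Ico 0 S.L := S.delta_mem σ hσ (hm 0)
  have h0 : (0 : ℝ) ∈ Ico 0 S.L := ⟨le_rfl, S.L_pos⟩
  calc ∑' i, W m i * gap G T i y = ∑ i ∈ Finset.range (n + 1), W m i * gap G T i y := by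
        refine tsum_eq_sum fun i hi => ?_
        have : W m i = 0 := by
          refine le_antisymm ((hW m i).trans_eq ?_) zero_le
          rw [wt_of_lt (by simpa using hi), mul_zero]
        rw [this, zero_mul]
    _ ≤ ∑ i ∈ Finset.range (n + 1), (w m * 2) * gap G T i y := by
        gcongr with i
        exact (hW m i).trans (by gcongr; exact wt_le_two _ _)
    _ = (w m * 2) * ((∑ i ∈ Finset.range (n + 1), gap G T i y : ℝ≥0) : ℝ≥0∞) := by
        rw [← Finset.mul_sum]; push_cast; rfl
    _ ≤ (w m * 2) * G (n + 1) 0 := by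
        gcongr
        exact (sum_gap_le (hG.monotone hy) n).trans (hG.mono hy h0 (Or.inl (Nat.lt_succ_self n)))
    _ = w m * (2 * G (n + 1) 0) := by ring

end Network

end

/-! ### Letting all users arrive -/

section

namespace Network

variable {N : ℕ} [NeZero N] {S : Network N} {σ : ℕ∞} {μ : Measure (Mark N)} {n : ℕ}

/-- Once `T` has passed all starts up to cycle `n`, new arrivals can no longer affect gap `n`. -/
theorem future_eq_zero (hμ : S.OnCircle μ) (hσ : σ ≠ 0) {G : ℕ → ℝ → ℝ≥0} {T : ℝ≥0}
    {W : Mark N → ℕ → ℝ≥0∞} {w : Mark N → ℝ≥0∞} (hW : ∀ m i, W m i ≤ w m * wt n i)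
    (hT : ∀ i ≤ n, ∀ y ∈ Ico 0 S.L, G i y ≤ T) : S.future σ μ W G T = 0 := by
  unfold future
  refine (lintegral_congr_ae ?_).trans lintegral_zero
  filter_upwards [hμ] with m hm
  refine ENNReal.tsum_eq_zero.2 fun i => ?_
  rcases le_or_gt i n with hi | hi
  · rw [gap_eq_zero (hT i hi _ (S.delta_mem σ hσ (hm 0)))]
    simp
  · have : W m i = 0 := le_antisymm ((hW m i).trans_eq (by rw [wt_of_lt hi, mul_zero])) zero_le
    rw [this, zero_mul]

theorem moment_le [SFinite μ] (hμ : S.OnCircle μ) (hl : S.IsLight μ) (hσ : σ ≠ 0)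
    {G : ℕ → ℝ → ℝ≥0} (hG : S.IsSchedule G) (n : ℕ) {p : ℝ} (hp : p ∈ Ico 0 S.L) (T : ℝ≥0) :
    S.moment σ μ n p G T
      ≤ (G (n + 1) 0 + ENNReal.ofReal S.lam *
          ((∫⁻ m, totalSvc m * 2 ^ (N + 1) ∂μ) * (2 * G (n + 1) 0))) ^ 2
        + ENNReal.ofReal S.lam * ((∫⁻ m, S.varBound μ m ∂μ) * (2 * G (n + 1) 0)) := by
  unfold moment
  have h0 : (0 : ℝ) ∈ Ico 0 S.L := ⟨le_rfl, S.L_pos⟩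
  gcongr
  · refine le_trans ?_ (hG.mono hp h0 (Or.inl (Nat.lt_succ_self n)))
    exact (Finset.single_le_sum (f := fun i => gap G 0 i p) (fun _ _ => zero_le)
      (Finset.self_mem_range_succ n)).trans (sum_gap_le (hG.monotone hp) n)
  · exact future_le hμ hσ hG (measurable_totalSvc.coe_nnreal_ennreal.mul_const _)
      (total_influence_le hl n p) T
  · exact future_le hμ hσ hG measurable_varBound (varValue_le hl n p) T

theorem IsLight.lintegral_mul_ne_top (hl : S.IsLight μ) :
    ∫⁻ m, totalSvc m * 2 ^ (N + 1) ∂μ ≠ ⊤ := by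
  rw [lintegral_mul_const _ measurable_totalSvc.coe_nnreal_ennreal]
  have := hl.lintegral_totalSvc_ne_top
  finiteness

theorem moment_ne_top [SFinite μ] (hμ : S.OnCircle μ) (hl : S.IsLight μ) (hσ : σ ≠ 0)
    {G : ℕ → ℝ → ℝ≥0} (hG : S.IsSchedule G) (n : ℕ) {p : ℝ} (hp : p ∈ Ico 0 S.L) (T : ℝ≥0) :
    S.moment σ μ n p G T ≠ ⊤ := by
  refine ne_top_of_le_ne_top ?_ (moment_le hμ hl hσ hG n hp T)
  have h1 := hl.lintegral_mul_ne_top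
  have h2 := hl.lintegral_varBound_ne_top
  finiteness

variable (S σ) in
/-- The starting times of the external queues if all users arrive. -/
def limitSched (G₀ : ℕ → ℝ → ℝ≥0) (ω : ℕ → ℝ × Mark N) (n : ℕ) (p : ℝ) : ℝ≥0∞ :=
  ⨆ k, (S.sched σ G₀ ω k n p : ℝ≥0∞)

theorem measurable_sched_at {G₀ : ℕ → ℝ → ℝ≥0} (hm : ∀ n, Measurable (G₀ n)) (k n : ℕ) (p : ℝ) :
    Measurable fun ω : ℕ → ℝ × Mark N => S.sched σ G₀ ω k n p :=
  (S.measurable_sched σ hm k n).comp (measurable_id.prodMk measurable_const)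

/-- A start time is a sum of gaps. Cauchy–Schwarz reduces its square to their squares, whose means
are bounded by `moment`; the bound is independent of the number of arrivals, so monotone convergence
applies. -/
theorem lintegral_limitSched_sq_ne_top [IsProbabilityMeasure μ] (hμ : S.OnCircle μ)
    (hl : S.IsLight μ) (hσ : σ ≠ 0) {G₀ : ℕ → ℝ → ℝ≥0} (hG : S.IsSchedule G₀)
    (hm : ∀ n, Measurable (G₀ n)) (n : ℕ) :
    ∫⁻ ω, S.limitSched σ G₀ ω n 0 ^ 2 ∂S.pathLaw μ ≠ ⊤ := by
  have h0 : (0 : ℝ) ∈ Ico 0 S.L := ⟨le_rfl, S.L_pos⟩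
  have hmeas : ∀ k, Measurable fun ω : ℕ → ℝ × Mark N => (S.sched σ G₀ ω k n 0 : ℝ≥0∞) ^ 2 :=
    fun k => (measurable_sched_at hm k n 0).coe_nnreal_ennreal.pow_const 2
  have hgm : ∀ k i, Measurable fun ω : ℕ → ℝ × Mark N =>
      (gap (S.sched σ G₀ ω k) 0 i 0 : ℝ≥0∞) ^ 2 := fun k i =>
    (((measurable_gap (G := fun ω => S.sched σ G₀ ω k) (S.measurable_sched σ hm k)
      measurable_const i).comp (measurable_id.prodMk measurable_const)).coe_nnreal_ennreal).pow_const 2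
  have hb : ∀ k, ∫⁻ ω, (S.sched σ G₀ ω k n 0 : ℝ≥0∞) ^ 2 ∂S.pathLaw μ
      ≤ (n + 1 : ℕ) * ∑ i ∈ Finset.range (n + 1), S.moment σ μ i 0 G₀ 0 := by
    intro k
    have h1 : ∀ ω, (S.sched σ G₀ ω k n 0 : ℝ≥0∞) ^ 2
        ≤ (n + 1 : ℕ) * ∑ i ∈ Finset.range (n + 1), (gap (S.sched σ G₀ ω k) 0 i 0 : ℝ≥0∞) ^ 2 := by
      intro ω
      have h2 : S.sched σ G₀ ω k n 0
          = ∑ i ∈ Finset.range (n + 1), gap (S.sched σ G₀ ω k) 0 i 0 := by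
        rw [sum_gap ((hG.sched ω k).monotone h0)]
        simp
      have h3 := sq_sum_le_card_mul_sum_sq (s := Finset.range (n + 1))
        (f := fun i => gap (S.sched σ G₀ ω k) 0 i 0)
      rw [← h2, Finset.card_range] at h3
      exact_mod_cast h3
    refine (lintegral_mono h1).trans ?_
    rw [lintegral_const_mul _ (Finset.measurable_sum _ fun i _ => hgm k i),
      lintegral_finsetSum _ fun i _ => hgm k i]
    gcongr with i
    rw [← lintegral_moment_sched hμ hσ hG hm i h0 k]
    refine lintegral_mono fun ω => ?_
    unfold moment
    exact le_add_right (pow_le_pow_left₀ zero_le le_self_add 2)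
  refine ne_top_of_le_ne_top (b := (n + 1 : ℕ) * ∑ i ∈ Finset.range (n + 1),
    S.moment σ μ i 0 G₀ 0) ?_ ?_
  · refine ENNReal.mul_ne_top (by simp) (ENNReal.sum_ne_top.2 fun i _ => ?_)
    exact moment_ne_top hμ hl hσ hG i h0 0
  · have hlim : ∀ᵐ ω ∂S.pathLaw μ, Tendsto (fun k => (S.sched σ G₀ ω k n 0 : ℝ≥0∞) ^ 2) atTop
        (𝓝 (S.limitSched σ G₀ ω n 0 ^ 2)) := by
      refine ae_of_all _ fun ω => ?_
      refine (ENNReal.continuous_pow 2).continuousAt.tendsto.comp (tendsto_atTop_iSup ?_)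
      exact fun i j hij => ENNReal.coe_le_coe.2 (sched_mono G₀ ω hij n 0)
    refine le_of_tendsto' (lintegral_tendsto_of_tendsto_of_monotone
      (fun k => (hmeas k).aemeasurable) (ae_of_all _ fun ω i j hij => ?_) hlim) hb
    have := sched_mono (S := S) (σ := σ) G₀ ω hij n 0
    dsimp only
    gcongr

/-- The mean of `moment` is constant along the arrivals, while the integrand becomes the squared gap
as soon as all relevant starts are past. Dominated convergence equates the two; the majorant is a
quadratic polynomial in a later start `g`, which has a finite second moment. -/
theorem lintegral_limitSched_sub_sq [IsProbabilityMeasure μ] (hμ : S.OnCircle μ)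
    (hl : S.IsLight μ) (hσ : σ ≠ 0) {G₀ : ℕ → ℝ → ℝ≥0} (hG : S.IsSchedule G₀)
    (hm : ∀ n, Measurable (G₀ n)) (n : ℕ) {p : ℝ} (hp : p ∈ Ico 0 S.L) :
    ∫⁻ ω, (S.limitSched σ G₀ ω (n + 1) p - S.limitSched σ G₀ ω n p) ^ 2 ∂S.pathLaw μ
      = S.moment σ μ (n + 1) p G₀ 0 := by
  have h0 : (0 : ℝ) ∈ Ico 0 S.L := ⟨le_rfl, S.L_pos⟩
  set A := ∫⁻ m, totalSvc m * 2 ^ (N + 1) ∂μ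
  set B := ∫⁻ m, S.varBound μ m ∂μ
  have hA : A ≠ ⊤ := hl.lintegral_mul_ne_top
  have hB : B ≠ ⊤ := hl.lintegral_varBound_ne_top
  set g : (ℕ → ℝ × Mark N) → ℝ≥0∞ := fun ω => S.limitSched σ G₀ ω (n + 1 + 1) 0 with hg
  have hgm : Measurable g :=
    Measurable.iSup fun k => (measurable_sched_at hm k _ 0).coe_nnreal_ennreal
  have hgsq : ∫⁻ ω, g ω ^ 2 ∂S.pathLaw μ ≠ ⊤ :=
    lintegral_limitSched_sq_ne_top hμ hl hσ hG hm (n + 1 + 1)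
  have hg1 : ∫⁻ ω, g ω ∂S.pathLaw μ ≠ ⊤ := by
    have h : ∫⁻ ω, (1 + g ω ^ 2) ∂S.pathLaw μ ≠ ⊤ := by
      rw [lintegral_add_left measurable_const, lintegral_const, measure_univ, mul_one]
      finiteness
    refine ne_top_of_le_ne_top h (lintegral_mono fun ω => ?_)
    rcases le_total (g ω) 1 with h1 | h1
    · exact h1.trans le_self_add
    · exact (le_self_pow₀ h1 two_ne_zero).trans le_add_self
  have hgfin : ∀ᵐ ω ∂S.pathLaw μ, g ω < ⊤ := ae_lt_top hgm hg1
  have hmono : ∀ ω n p, Monotone fun k => (S.sched σ G₀ ω k n p : ℝ≥0∞) := fun ω n p i j hij =>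
    ENNReal.coe_le_coe.2 (sched_mono G₀ ω hij n p)
  have hle : ∀ ω k, ∀ i ≤ n + 1, ∀ y ∈ Ico 0 S.L, (S.sched σ G₀ ω k i y : ℝ≥0∞) ≤ g ω := by
    intro ω k i hi y hy
    refine le_trans ?_ (le_iSup (fun k => (S.sched σ G₀ ω k (n + 1 + 1) 0 : ℝ≥0∞)) k)
    exact ENNReal.coe_le_coe.2 ((hG.sched ω k).mono hy h0 (Or.inl (by omega)))
  have hlim : ∀ᵐ ω ∂S.pathLaw μ, Tendsto
      (fun k => S.moment σ μ (n + 1) p (S.sched σ G₀ ω k) (prevTime ω k)) atTop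
      (𝓝 ((S.limitSched σ G₀ ω (n + 1) p - S.limitSched σ G₀ ω n p) ^ 2)) := by
    filter_upwards [hgfin, ae_exists_lt_prevTime, ae_isRegular hμ] with ω hω htime hreg
    have h1 : Tendsto (fun k => ((S.sched σ G₀ ω k (n + 1) p : ℝ≥0∞) - S.sched σ G₀ ω k n p) ^ 2)
        atTop (𝓝 ((S.limitSched σ G₀ ω (n + 1) p - S.limitSched σ G₀ ω n p) ^ 2)) := by
      refine (ENNReal.continuous_pow 2).continuousAt.tendsto.comp (ENNReal.Tendsto.sub
        (tendsto_atTop_iSup (hmono ω _ _)) (tendsto_atTop_iSup (hmono ω _ _)) (Or.inl ?_))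
      exact ((iSup_le fun k => hle ω k (n + 1) le_rfl p hp).trans_lt hω).ne
    refine h1.congr' ?_
    -- From the first arrival time beyond `g ω` on, the future terms vanish.
    obtain ⟨k₀, hk₀⟩ := htime (g ω).toNNReal
    filter_upwards [eventually_ge_atTop k₀] with k hk
    have h2 : prevTime ω k₀ ≤ prevTime ω k := by
      refine Real.toNNReal_le_toNNReal ?_
      exact Finset.sum_le_sum_of_subset_of_nonneg (Finset.range_mono hk) fun i _ _ => (hreg i).1
    have h3 : ∀ i ≤ n + 1, ∀ y ∈ Ico 0 S.L, S.sched σ G₀ ω k i y ≤ prevTime ω k := by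
      intro i hi y hy
      refine le_trans ?_ (hk₀.le.trans h2)
      rw [← ENNReal.coe_le_coe, ENNReal.coe_toNNReal hω.ne]
      exact hle ω k i hi y hy
    unfold moment
    rw [future_eq_zero hμ hσ (total_influence_le hl (n + 1) p) h3,
      future_eq_zero hμ hσ (varValue_le hl (n + 1) p) h3, gap_zero_succ, ENNReal.coe_sub]
    simp
  have hdom := tendsto_lintegral_of_dominated_convergence
    (fun ω => (g ω + ENNReal.ofReal S.lam * (A * (2 * g ω))) ^ 2
      + ENNReal.ofReal S.lam * (B * (2 * g ω)))
    (fun k => measurable_moment (G := fun ω => S.sched σ G₀ ω k) (S.measurable_sched σ hm k)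
      (measurable_prevTime k) (n + 1) p) (fun k => ae_of_all _ fun ω => ?_) ?_ hlim
  · simp only [lintegral_moment_sched hμ hσ hG hm (n + 1) hp] at hdom
    exact tendsto_nhds_unique tendsto_const_nhds hdom |>.symm
  · refine (moment_le hμ hl hσ (hG.sched ω k) (n + 1) hp _).trans ?_
    have h4 : (S.sched σ G₀ ω k (n + 1 + 1) 0 : ℝ≥0∞) ≤ g ω :=
      le_iSup (fun k => (S.sched σ G₀ ω k (n + 1 + 1) 0 : ℝ≥0∞)) k
    dsimp only
    gcongr
  · have h5 : ∀ ω, (g ω + ENNReal.ofReal S.lam * (A * (2 * g ω))) ^ 2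
        + ENNReal.ofReal S.lam * (B * (2 * g ω))
        = (1 + ENNReal.ofReal S.lam * (A * 2)) ^ 2 * g ω ^ 2
          + ENNReal.ofReal S.lam * (B * 2) * g ω := fun ω => by ring
    simp only [h5]
    rw [lintegral_add_left ((hgm.pow_const 2).const_mul _), lintegral_const_mul _ (hgm.pow_const 2),
      lintegral_const_mul _ hgm]
    finiteness

end Network

end

/-! ### The limit of late cycles does not depend on the initial users -/

section

namespace Network

variable {N : ℕ} [NeZero N] {S : Network N} {σ : ℕ∞} {μ : Measure (Mark N)}

section Shift

variable {f f' : ℕ × ℝ × Fin N → ℝ≥0∞}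

theorem total_shift (h : ∀ e, f (e.1 + 1, e.2) = f' e) (m : Mark N) (i : ℕ) :
    S.total σ f m (i + 1) = S.total σ f' m i := by
  unfold total
  refine Finset.sum_congr rfl fun j _ => ?_
  rw [← h]
  unfold visit
  rw [add_right_comm]

theorem meanValue_shift {W W' : Mark N → ℕ → ℝ≥0∞} (h : ∀ m i, W m (i + 1) = W' m i)
    (e : ℕ × ℝ × Fin N) : S.meanValue σ μ W (e.1 + 1, e.2) = S.meanValue σ μ W' e := by
  unfold meanValue
  refine lintegral_congr fun m => ?_
  rw [nextCycle_add 1 e.1 e.2.1 e.2.2, h]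

/-- The rules of service are invariant under renumbering the cycles, so effects depend only on the
difference between the cycle of the cause and that of the gap. -/
theorem resolvent_shift (h : ∀ e, f (e.1 + 1, e.2) = f' e) (e : ℕ × ℝ × Fin N) :
    S.resolvent σ μ f (e.1 + 1, e.2) = S.resolvent σ μ f' e := by
  unfold resolvent
  refine tsum_congr fun k => ?_
  induction k generalizing e with
  | zero => exact h e
  | succ k ih =>
    rw [Function.iterate_succ_apply', Function.iterate_succ_apply', offspring, offspring,
      meanValue_shift (total_shift ih)]

theorem influence_shift (n : ℕ) (p : ℝ) (e : ℕ × ℝ × Fin N) :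
    S.influence σ μ (n + 1) p (e.1 + 1, e.2) = S.influence σ μ n p e := by
  refine resolvent_shift (fun e => ?_) e
  unfold passes
  rw [nextCycle_add 1 e.1 e.2.1 e.2.2]
  simp

theorem varInfluence_shift (n : ℕ) (p : ℝ) (e : ℕ × ℝ × Fin N) :
    S.varInfluence σ μ (n + 1) p (e.1 + 1, e.2) = S.varInfluence σ μ n p e := by
  refine resolvent_shift (fun e => ?_) e
  unfold meanSq
  rw [meanValue_shift]
  intro m i
  rw [total_shift (influence_shift n p)]

theorem varValue_shift (n : ℕ) (p : ℝ) (m : Mark N) (i : ℕ) :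
    S.varValue σ μ (n + 1) p m (i + 1) = S.varValue σ μ n p m i := by
  unfold varValue
  rw [total_shift (influence_shift n p), total_shift (varInfluence_shift n p)]

end Shift

variable (S) in
/-- The travel time of one cycle. -/
def tour : ℝ≥0 := (S.L / S.α).toNNReal

theorem gap_travel_succ {y : ℝ} (hy : y ∈ Ico 0 S.L) (i : ℕ) :
    gap (S.baseSched σ 0) 0 (i + 1) y = S.tour := by
  have hL := S.L_pos
  have hα := S.α_pos
  have hy0 := hy.1
  rw [gap_zero_succ]
  unfold baseSched tour
  simp only [Multiset.map_zero, Multiset.sum_zero, add_zero]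
  rw [tsub_eq_iff_eq_add_of_le (Real.toNNReal_le_toNNReal (by push_cast; gcongr; linarith)),
    ← Real.toNNReal_add (by positivity) (by positivity)]
  congr 1
  push_cast
  field_simp
  ring

theorem gap_travel_zero_le {y : ℝ} (hy : y ∈ Ico 0 S.L) : gap (S.baseSched σ 0) 0 0 y ≤ S.tour := by
  have hα := S.α_pos
  unfold gap baseSched tour
  simp only [Multiset.map_zero, Multiset.sum_zero, add_zero, if_true, tsub_zero, Nat.cast_zero,
    zero_mul, zero_add]
  refine max_le (Real.toNNReal_le_toNNReal ?_) zero_le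
  gcongr
  exact hy.2.le

/-- In the empty system all gaps but the zeroth equal one tour. Shift invariance brings each
remaining term back to a first service in cycle `1`, and reversing the order of summation gives
partial sums of one fixed series. -/
theorem tsum_value_mul_gap_travel {W : ℕ → Mark N → ℕ → ℝ≥0∞} {w : Mark N → ℝ≥0∞}
    (hWs : ∀ n m i, W (n + 1) m (i + 1) = W n m i) (hW : ∀ n m i, W n m i ≤ w m * wt n i)
    (n : ℕ) (m : Mark N) {y : ℝ} (hy : y ∈ Ico 0 S.L) :
    ∑' i, W (n + 1) m i * gap (S.baseSched σ 0) 0 i y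
      = W (n + 1) m 0 * gap (S.baseSched σ 0) 0 0 y
        + S.tour * ∑ d ∈ Finset.range (n + 2), W d m 1 := by
  have hshift : ∀ i d, W (d + i) m (1 + i) = W d m 1 := by
    intro i d
    induction i with
    | zero => rfl
    | succ i ih => exact (hWs (d + i) m (1 + i)).trans ih
  have hzero : ∀ n m i, n < i → W n m i = 0 := fun n m i h =>
    le_antisymm ((hW n m i).trans_eq (by rw [wt_of_lt h, mul_zero])) zero_le
  rw [tsum_eq_zero_add' ENNReal.summable]
  congr 1
  simp only [gap_travel_succ hy]
  rw [ENNReal.tsum_mul_right, mul_comm]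
  congr 1
  rw [tsum_eq_sum (s := Finset.range (n + 1)) fun i hi => hzero _ _ _ (by simpa using hi),
    Finset.sum_range_succ' (fun d => W d m 1) (n + 1), hzero 0 m 1 one_pos, add_zero, ← Finset.sum_range_reflect]
  refine Finset.sum_congr rfl fun i hi => ?_
  have hi' := Finset.mem_range.1 hi
  rw [← hshift (n + 1 - 1 - i) (i + 1)]
  congr 1 <;> omega

/-- The incomplete zeroth gap contributes a term that decays with the weight; the remainder consists
of partial sums of the limiting series. -/
theorem tendsto_future_travel (hμ : S.OnCircle μ) (hσ : σ ≠ 0) {W : ℕ → Mark N → ℕ → ℝ≥0∞}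
    {w : Mark N → ℝ≥0∞} (hWm : ∀ n i, Measurable fun m => W n m i)
    (hwm : Measurable w) (hw : ∫⁻ m, w m ∂μ ≠ ⊤)
    (hWs : ∀ n m i, W (n + 1) m (i + 1) = W n m i) (hW : ∀ n m i, W n m i ≤ w m * wt n i) :
    Tendsto (fun n => S.future σ μ (W (n + 1)) (S.baseSched σ 0) 0) atTop
      (𝓝 (S.tour * ∑' d, ∫⁻ m, W d m 1 ∂μ)) := by
  have h1 : ∀ n, S.future σ μ (W (n + 1)) (S.baseSched σ 0) 0
      = (∫⁻ m, W (n + 1) m 0 * gap (S.baseSched σ 0) 0 0 (S.delta σ (pos m 0)) ∂μ)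
        + S.tour * ∑ d ∈ Finset.range (n + 2), ∫⁻ m, W d m 1 ∂μ := by
    intro n
    unfold future
    rw [← lintegral_finsetSum _ fun d _ => hWm d 1, ← lintegral_const_mul _
      (Finset.measurable_sum _ fun d _ => hWm d 1), ← lintegral_add_right _
      ((Finset.measurable_sum _ fun d _ => hWm d 1).const_mul _)]
    refine lintegral_congr_ae ?_
    filter_upwards [hμ] with m hm
    exact tsum_value_mul_gap_travel hWs hW n m (S.delta_mem σ hσ (hm 0))
  simp only [h1]
  rw [← zero_add (S.tour * ∑' d, ∫⁻ m, W d m 1 ∂μ)]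
  refine Tendsto.add ?_ (ENNReal.Tendsto.const_mul ?_ (Or.inr ENNReal.coe_ne_top))
  · have h2 : Tendsto (fun n => (∫⁻ m, w m ∂μ) * (wt (n + 1) 0 * S.tour)) atTop (𝓝 0) := by
      have h3 := ENNReal.Tendsto.const_mul (a := ∫⁻ m, w m ∂μ) (ENNReal.Tendsto.mul_const
        ((tendsto_add_atTop_iff_nat 1).2 (tendsto_wt 0)) (Or.inr (ENNReal.coe_ne_top (r := S.tour))))
        (Or.inr hw)
      simpa using h3
    refine tendsto_of_tendsto_of_tendsto_of_le_of_le tendsto_const_nhds h2 (fun _ => zero_le)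
      fun n => ?_
    dsimp only
    rw [← lintegral_mul_const _ hwm]
    refine lintegral_mono_ae ?_
    filter_upwards [hμ] with m hm
    rw [← mul_assoc]
    gcongr
    · exact hW _ _ _
    · exact gap_travel_zero_le (S.delta_mem σ hσ (hm 0))
  · exact (tendsto_add_atTop_iff_nat 2).2 (ENNReal.tendsto_nat_tsum fun d => ∫⁻ m, W d m 1 ∂μ)

variable (S σ μ) in
/-- The limit of the mean cycle time with respect to the point `p`. -/
def limitMean (p : ℝ) : ℝ≥0∞ := S.tour + ENNReal.ofReal S.lam *
  (S.tour * ∑' d, ∫⁻ m, S.total σ (S.influence σ μ d p) m 1 ∂μ)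

variable (S σ μ) in
/-- The limit of the variance of the cycle time with respect to the point `p`. -/
def limitVar (p : ℝ) : ℝ≥0∞ := ENNReal.ofReal S.lam *
  (S.tour * ∑' d, ∫⁻ m, S.varValue σ μ d p m 1 ∂μ)

theorem baseSched_cons (a : User N) (s : Multiset (User N)) (i : ℕ) (y : ℝ) :
    S.baseSched σ (a ::ₘ s) i y = S.baseSched σ s i y + S.bump σ
      (if S.delta σ (pos a.2 a.1) = 0 ∧ 0 < a.1.1 then 1 else 0) a i y := by
  unfold baseSched
  rw [Multiset.map_cons, Multiset.sum_cons]
  ring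

/-- Adding an initial user changes the mean by the influence of his finitely many visits, which
tends to zero. By induction the limit is that of the system started empty. -/
theorem tendsto_mean_baseSched [SFinite μ] (hμ : S.OnCircle μ) (hl : S.IsLight μ) (hσ : σ ≠ 0)
    {p : ℝ} (hp : p ∈ Ico 0 S.L) (s : Multiset (User N)) :
    Tendsto (fun n => gap (S.baseSched σ s) 0 (n + 1) p + ENNReal.ofReal S.lam *
      S.future σ μ (S.total σ (S.influence σ μ (n + 1) p)) (S.baseSched σ s) 0) atTop
      (𝓝 (S.limitMean σ μ p)) := by
  induction s using Multiset.induction_on with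
  | empty =>
    simp only [gap_travel_succ hp]
    refine tendsto_const_nhds.add (ENNReal.Tendsto.const_mul ?_ (Or.inr ENNReal.ofReal_ne_top))
    exact tendsto_future_travel (W := fun n => S.total σ (S.influence σ μ n p)) hμ hσ
      (fun n => S.measurable_total σ (measurable_influence n p))
      (measurable_totalSvc.coe_nnreal_ennreal.mul_const _) hl.lintegral_mul_ne_top
      (fun n m i => total_shift (influence_shift n p) m i) fun n m i => total_influence_le hl n p m i
  | cons a s ih =>
    set n₀ := if S.delta σ (pos a.2 a.1) = 0 ∧ 0 < a.1.1 then 1 else 0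
    have h : ∀ n, gap (S.baseSched σ (a ::ₘ s)) 0 n p + ENNReal.ofReal S.lam *
        S.future σ μ (S.total σ (S.influence σ μ n p)) (S.baseSched σ (a ::ₘ s)) 0
        = gap (S.baseSched σ s) 0 n p + ENNReal.ofReal S.lam *
          S.future σ μ (S.total σ (S.influence σ μ n p)) (S.baseSched σ s) 0
          + ∑ j, load a j * S.influence σ μ n p (S.visit σ n₀ a j) := by
      intro n
      rw [gap_insert (isSchedule_baseSched s) hp (baseSched_cons a s),
        future_add_bump hμ hσ (isSchedule_baseSched s) (baseSched_cons a s)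
        (fun _ _ _ _ _ => zero_le) (S.measurable_total σ (measurable_influence n p))]
      simp only [influence_eq n p (S.visit σ n₀ a _), mul_add, Finset.mul_sum,
        Finset.sum_add_distrib, passes, mul_left_comm (ENNReal.ofReal S.lam)]
      abel
    simp only [h]
    rw [← add_zero (S.limitMean σ μ p)]
    refine ih.add ?_
    rw [← Finset.sum_const_zero (s := Finset.univ (α := Fin N))]
    refine tendsto_finsetSum _ fun j _ => ?_
    have h2 := ENNReal.Tendsto.const_mul (a := (load a j : ℝ≥0∞) * 2)
      ((tendsto_add_atTop_iff_nat 1).2 (tendsto_wt (S.visit σ n₀ a j).1))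
      (Or.inr (by finiteness))
    rw [mul_zero] at h2
    refine tendsto_of_tendsto_of_tendsto_of_le_of_le tendsto_const_nhds h2 (fun _ => zero_le)
      fun n => ?_
    dsimp only
    rw [mul_assoc]
    gcongr
    exact influence_le hl _ _ _

theorem tendsto_var_baseSched [SFinite μ] (hμ : S.OnCircle μ) (hl : S.IsLight μ) (hσ : σ ≠ 0)
    (p : ℝ) (s : Multiset (User N)) :
    Tendsto (fun n => ENNReal.ofReal S.lam *
      S.future σ μ (S.varValue σ μ (n + 1) p) (S.baseSched σ s) 0) atTop
      (𝓝 (S.limitVar σ μ p)) := by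
  induction s using Multiset.induction_on with
  | empty =>
    refine ENNReal.Tendsto.const_mul ?_ (Or.inr ENNReal.ofReal_ne_top)
    exact tendsto_future_travel (W := fun n => S.varValue σ μ n p) hμ hσ
      (fun n => measurable_varValue n p) measurable_varBound hl.lintegral_varBound_ne_top
      (fun n m i => varValue_shift n p m i) fun n m i => varValue_le hl n p m i
  | cons a s ih =>
    set n₀ := if S.delta σ (pos a.2 a.1) = 0 ∧ 0 < a.1.1 then 1 else 0
    have h : ∀ n, ENNReal.ofReal S.lam *
        S.future σ μ (S.varValue σ μ n p) (S.baseSched σ (a ::ₘ s)) 0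
        = ENNReal.ofReal S.lam * S.future σ μ (S.varValue σ μ n p) (S.baseSched σ s) 0
          + ∑ j, load a j * S.varInfluence σ μ n p (S.visit σ n₀ a j) := by
      intro n
      rw [future_add_bump hμ hσ (isSchedule_baseSched s) (baseSched_cons a s)
        (fun _ _ _ _ _ => zero_le) (measurable_varValue n p)]
      simp only [varInfluence_eq n p, mul_add, Finset.mul_sum,
        mul_left_comm (ENNReal.ofReal S.lam)]
      rfl
    simp only [h]
    rw [← add_zero (S.limitVar σ μ p)]
    refine ih.add ?_
    rw [← Finset.sum_const_zero (s := Finset.univ (α := Fin N))]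
    refine tendsto_finsetSum _ fun j _ => ?_
    have h3 := hl.sqBound_ne_top
    have h2 := ENNReal.Tendsto.const_mul (a := (load a j : ℝ≥0∞) * (2 * S.sqBound μ))
      ((tendsto_add_atTop_iff_nat 1).2 (tendsto_wt (S.visit σ n₀ a j).1))
      (Or.inr (by finiteness))
    rw [mul_zero] at h2
    refine tendsto_of_tendsto_of_tendsto_of_le_of_le tendsto_const_nhds h2 (fun _ => zero_le)
      fun n => ?_
    dsimp only
    rw [mul_assoc]
    gcongr
    exact varInfluence_le hl _ _ _

variable (S σ μ) in
/-- The limit of the second moment of the cycle time with respect to the point `p`. -/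
def limitMoment (p : ℝ) : ℝ≥0∞ := S.limitMean σ μ p ^ 2 + S.limitVar σ μ p

theorem tendsto_moment_baseSched [SFinite μ] (hμ : S.OnCircle μ) (hl : S.IsLight μ) (hσ : σ ≠ 0)
    {p : ℝ} (hp : p ∈ Ico 0 S.L) (s : Multiset (User N)) :
    Tendsto (fun n => S.moment σ μ (n + 1) p (S.baseSched σ s) 0) atTop
      (𝓝 (S.limitMoment σ μ p)) :=
  ((ENNReal.continuous_pow 2).continuousAt.tendsto.comp
    (tendsto_mean_baseSched hμ hl hσ hp s)).add (tendsto_var_baseSched hμ hl hσ p s)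

variable (S μ) in
/-- A bound of the limits of the second moments that depends neither on the discretization nor on the
point. -/
def limitBound : ℝ≥0∞ :=
  (S.tour + ENNReal.ofReal S.lam *
    (S.tour * ∑' d, (∫⁻ m, totalSvc m * 2 ^ (N + 1) ∂μ) * wt d 1)) ^ 2
  + ENNReal.ofReal S.lam * (S.tour * ∑' d, (∫⁻ m, S.varBound μ m ∂μ) * wt d 1)

theorem IsLight.limitBound_ne_top (hl : S.IsLight μ) : S.limitBound μ ≠ ⊤ := by
  have h1 := tsum_wt_one_lt_top _ hl.lintegral_mul_ne_top
  have h2 := tsum_wt_one_lt_top _ hl.lintegral_varBound_ne_top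
  unfold limitBound
  finiteness

theorem lintegral_total_le (hl : S.IsLight μ) (d : ℕ) (p : ℝ) :
    ∫⁻ m, S.total σ (S.influence σ μ d p) m 1 ∂μ
      ≤ (∫⁻ m, totalSvc m * 2 ^ (N + 1) ∂μ) * wt d 1 := by
  rw [← lintegral_mul_const _ (measurable_totalSvc.coe_nnreal_ennreal.mul_const _)]
  exact lintegral_mono fun m => total_influence_le hl d p m 1

theorem lintegral_varValue_le (hl : S.IsLight μ) (d : ℕ) (p : ℝ) :
    ∫⁻ m, S.varValue σ μ d p m 1 ∂μ ≤ (∫⁻ m, S.varBound μ m ∂μ) * wt d 1 := by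
  rw [← lintegral_mul_const _ measurable_varBound]
  exact lintegral_mono fun m => varValue_le hl d p m 1

theorem limitMoment_le (hl : S.IsLight μ) (p : ℝ) : S.limitMoment σ μ p ≤ S.limitBound μ := by
  unfold limitMoment limitBound limitMean limitVar
  gcongr with d d
  · exact lintegral_total_le hl d p
  · exact lintegral_varValue_le hl d p

end Network

end

/-! ### Identification of the Palm second moment -/

section

namespace Network

variable {N : ℕ} {S : Network N}

variable (S) in
theorem ae_mem_Ico (j : Fin N) : ∀ᵐ q ∂S.P j, q ∈ Ico 0 S.L := by
  obtain ⟨A, p, f, hA, -, h⟩ := S.mixed j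
  rw [h, ae_add_measure_iff]
  constructor
  · rw [ae_iff, Measure.finsetSum_apply]
    refine Finset.sum_eq_zero fun x hx => ?_
    have hx' : x ∈ Ico 0 S.L := hA hx
    have hm : MeasurableSet {a | ¬ a ∈ Ico 0 S.L} := measurableSet_Ico.compl
    rw [Measure.smul_apply, Measure.dirac_apply' _ hm, indicator_of_notMem (by simpa using hx'),
      smul_zero]
  · exact (withDensity_absolutelyContinuous _ f).ae_le (ae_restrict_mem measurableSet_Ico)

section

variable (κ : Fin N → Kernel ℝ ℝ≥0) [∀ j, IsMarkovKernel (κ j)]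

theorem lintegral_markLaw (j : Fin N) {f : ℝ → ℝ≥0 → ℝ≥0∞} (hf : Measurable (Function.uncurry f)) :
    ∫⁻ m, f (pos m j) (svc m j) ∂S.markLaw κ = ∫⁻ q, ∫⁻ b, f q b ∂κ j q ∂S.P j := by
  have h1 := measurePreserving_eval (fun j => (S.P j ⊗ₘ κ j).prod (S.coin j)) j
  have h2 : Measurable fun z : (ℝ × ℝ≥0) × Bool => f z.1.1 z.1.2 :=
    hf.comp measurable_fst
  have h3 := h1.lintegral_comp h2
  rw [lintegral_prod _ h2.aemeasurable] at h3
  simp only [lintegral_const, measure_univ, mul_one] at h3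
  rw [Measure.lintegral_compProd (f := fun z : ℝ × ℝ≥0 => f z.1 z.2) hf] at h3
  exact h3

theorem onCircle_markLaw : S.OnCircle (S.markLaw κ) := by
  unfold OnCircle
  rw [ae_all_iff]
  intro j
  have hi : Measurable ((Ico 0 S.L)ᶜ.indicator (1 : ℝ → ℝ≥0∞)) :=
    measurable_one.indicator measurableSet_Ico.compl
  have hi1 : Measurable (Function.uncurry fun (q : ℝ) (_ : ℝ≥0) =>
      (Ico 0 S.L)ᶜ.indicator (1 : ℝ → ℝ≥0∞) q) := hi.comp measurable_fst
  have hi2 : Measurable fun m : Mark N => (Ico 0 S.L)ᶜ.indicator (1 : ℝ → ℝ≥0∞) (pos m j) :=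
    hi.comp (measurable_pos j)
  have h1 : ∫⁻ m, (Ico 0 S.L)ᶜ.indicator 1 (pos m j) ∂S.markLaw κ = 0 := by
    rw [lintegral_markLaw κ j hi1]
    refine (lintegral_congr_ae ?_).trans lintegral_zero
    filter_upwards [S.ae_mem_Ico j] with q hq
    rw [indicator_of_notMem (by simpa using hq)]
    simp
  rw [lintegral_eq_zero_iff hi2] at h1
  filter_upwards [h1] with m hm
  by_contra h
  rw [indicator_of_mem (by simpa using h)] at hm
  simp at hm

variable [NeZero N] {κ} {σ : ℕ∞}

/-- The cycle time of cycle `n` is the gap with index `n + 1`, since a gap is numbered by the start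
that ends it. -/
theorem lintegral_cycleTime_sq (hl : S.IsLight (S.markLaw κ)) (hσ : σ ≠ 0) (s : Multiset (User N))
    (n : ℕ) {q : ℝ} (hq : q ∈ Ico 0 S.L) :
    ∫⁻ ω, S.cycleTime σ ((s.map Measure.dirac).sum, ω) n q ^ 2 ∂S.arrivalLaw κ
      = S.moment σ (S.markLaw κ) (n + 1) (S.delta σ q) (S.baseSched σ s) 0 := by
  have hμ := onCircle_markLaw (S := S) κ
  rw [← lintegral_limitSched_sub_sq hμ hl hσ (isSchedule_baseSched s) (S.measurable_baseSched σ s) n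
    (S.delta_mem σ hσ hq)]
  refine lintegral_congr_ae ?_
  filter_upwards [ae_isRegular hμ] with ω hω
  unfold cycleTime epoch
  rw [startTime_eq_iSup s hω hσ, startTime_eq_iSup s hω hσ]
  rfl

theorem IsPalmStationary.identDistrib_cycleTime {ν : Measure (Config N)}
    (hν : S.IsPalmStationary κ σ ν) (n : ℕ) {q : ℝ} (hq : q ∈ Ico 0 S.L) :
    IdentDistrib (fun ω => S.cycleTime σ ω (n + 1) q) (fun ω => S.cycleTime σ ω n q)
      (ν.prod (S.arrivalLaw κ)) (ν.prod (S.arrivalLaw κ)) := by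
  have hu : Measurable fun x : ℕ → Config N × (Ico 0 S.L → ℝ≥0∞) => (x n).2 ⟨q, hq⟩ :=
    (measurable_pi_apply _).comp (measurable_snd.comp (measurable_pi_apply n))
  exact hν.stationary.comp hu

/-- The second moment of the cycle time is the same in all Palm stationary regimes. -/
theorem IsPalmStationary.cycleSecondMoment_eq {ν : Measure (Config N)}
    (hν : S.IsPalmStationary κ σ ν) (hl : S.IsLight (S.markLaw κ)) (hσ : σ ≠ 0) {q : ℝ}
    (hq : q ∈ Ico 0 S.L) :
    S.cycleSecondMoment κ σ ν q = S.limitMoment σ (S.markLaw κ) (S.delta σ q) := by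
  have := hν.isProb
  have : IsProbabilityMeasure (S.arrivalLaw κ) := by unfold arrivalLaw; infer_instance
  set c := S.limitMoment σ (S.markLaw κ) (S.delta σ q)
  -- Joint measurability in the initial configuration is part of the stationarity hypothesis.
  have hae : ∀ n, AEMeasurable (fun ω => S.cycleTime σ ω n q) (ν.prod (S.arrivalLaw κ)) := fun n =>
    (hν.identDistrib_cycleTime n hq).aemeasurable_snd
  have hid : ∀ n, IdentDistrib (fun ω => S.cycleTime σ ω n q) (fun ω => S.cycleTime σ ω 0 q)
      (ν.prod (S.arrivalLaw κ)) (ν.prod (S.arrivalLaw κ)) := by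
    intro n
    induction n with
    | zero => exact IdentDistrib.refl (hae 0)
    | succ n ih => exact (hν.identDistrib_cycleTime n hq).trans ih
  have hlim : ∀ᵐ x ∂ν, Tendsto (fun n => ∫⁻ ω, S.cycleTime σ (x, ω) n q ^ 2 ∂S.arrivalLaw κ) atTop
      (𝓝 c) := by
    filter_upwards [hν.finite] with x hx
    obtain ⟨s, -, rfl⟩ := hx
    simp only [lintegral_cycleTime_sq hl hσ s _ hq]
    exact tendsto_moment_baseSched (onCircle_markLaw κ) hl hσ (S.delta_mem σ hσ hq) s
  have hsq : ∀ n, ∫⁻ x, ∫⁻ ω, S.cycleTime σ (x, ω) n q ^ 2 ∂S.arrivalLaw κ ∂ν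
      = S.cycleSecondMoment κ σ ν q := by
    intro n
    rw [← lintegral_prod (fun ω : Path N => S.cycleTime σ ω n q ^ 2) ((hae n).pow_const 2)]
    exact ((hid n).comp (measurable_id.pow_const 2)).lintegral_eq
  have haen : ∀ n, AEMeasurable
      (fun x => ∫⁻ ω, S.cycleTime σ (x, ω) n q ^ 2 ∂S.arrivalLaw κ) ν := fun n =>
    AEMeasurable.lintegral_prod_right' (f := fun ω : Path N => S.cycleTime σ ω n q ^ 2)
      ((hae n).pow_const 2)
  apply le_antisymm
  -- The conditional moments need not be uniformly integrable over the initial configurations.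
  -- Truncation at `B` permits dominated convergence: the truncated moment does not change with `n`,
  -- and by concavity of truncation it is at most the mean of the truncated conditional moment.
  · have htrunc : ∀ B : ℕ, ∫⁻ ω, min (S.cycleTime σ ω 0 q ^ 2) B ∂ν.prod (S.arrivalLaw κ) ≤ c := by
      intro B
      have h1 : ∀ n, ∫⁻ ω, min (S.cycleTime σ ω 0 q ^ 2) B ∂ν.prod (S.arrivalLaw κ)
          ≤ ∫⁻ x, min (∫⁻ ω, S.cycleTime σ (x, ω) n q ^ 2 ∂S.arrivalLaw κ) B ∂ν := by
        intro n
        have hg : Measurable fun t : ℝ≥0∞ => min (t ^ 2) (B : ℝ≥0∞) :=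
          (measurable_id.pow_const 2).min measurable_const
        have h2 := ((hid n).comp hg).lintegral_eq
        refine h2.symm.le.trans ?_
        have h3 : AEMeasurable (fun ω : Path N => min (S.cycleTime σ ω n q ^ 2) (B : ℝ≥0∞))
            (ν.prod (S.arrivalLaw κ)) := hg.comp_aemeasurable (hae n)
        refine (lintegral_prod _ h3).le.trans (lintegral_mono fun x => le_min ?_ ?_)
        · exact lintegral_mono fun ω => min_le_left _ _
        · refine (lintegral_mono fun ω => min_le_right _ _).trans ?_
          simp
      have h4 : Tendsto (fun n => ∫⁻ x, min (∫⁻ ω, S.cycleTime σ (x, ω) n q ^ 2 ∂S.arrivalLaw κ) B ∂ν)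
          atTop (𝓝 (∫⁻ _, min c B ∂ν)) := by
        refine tendsto_lintegral_of_dominated_convergence' (fun _ => (B : ℝ≥0∞))
          (fun n => (haen n).min aemeasurable_const) (fun n => ae_of_all _ fun x => min_le_right _ _)
          (by simp) ?_
        filter_upwards [hlim] with x hx
        exact hx.min tendsto_const_nhds
      refine (ge_of_tendsto' h4 h1).trans ?_
      simp
    have hmono : Tendsto (fun B : ℕ => ∫⁻ ω, min (S.cycleTime σ ω 0 q ^ 2) B ∂ν.prod (S.arrivalLaw κ))
        atTop (𝓝 (S.cycleSecondMoment κ σ ν q)) := by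
      refine lintegral_tendsto_of_tendsto_of_monotone (fun B =>
        ((hae 0).pow_const 2).min aemeasurable_const) (ae_of_all _ fun ω i j hij => ?_)
        (ae_of_all _ fun ω => ?_)
      · exact min_le_min le_rfl (by exact_mod_cast hij)
      · have h5 : Tendsto (fun B : ℕ => min (S.cycleTime σ ω 0 q ^ 2) (B : ℝ≥0∞)) atTop
            (𝓝 (min (S.cycleTime σ ω 0 q ^ 2) ⊤)) :=
          tendsto_const_nhds.min ENNReal.tendsto_nat_nhds_top
        simpa using h5
    exact le_of_tendsto' hmono htrunc
  -- Fatou's lemma over the initial configuration gives the other inequality.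
  · calc c = ∫⁻ _, c ∂ν := by simp
      _ = ∫⁻ x, liminf (fun n => ∫⁻ ω, S.cycleTime σ (x, ω) n q ^ 2 ∂S.arrivalLaw κ) atTop ∂ν := by
          refine lintegral_congr_ae ?_
          filter_upwards [hlim] with x hx
          exact hx.liminf_eq.symm
      _ ≤ liminf (fun n => ∫⁻ x, ∫⁻ ω, S.cycleTime σ (x, ω) n q ^ 2 ∂S.arrivalLaw κ ∂ν) atTop :=
          lintegral_liminf_le' haen
      _ = S.cycleSecondMoment κ σ ν q := by
          simp only [hsq]
          exact liminf_const _

end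

end Network

end

/-! ### Convergence as the discretization is refined -/

section

/-- Dominated convergence for the counting measure. -/
theorem tendsto_tsum_of_dominated {F : ℕ → ℕ → ℝ≥0∞} {g b : ℕ → ℝ≥0∞} (hb : ∑' i, b i ≠ ⊤)
    (hF : ∀ k i, F k i ≤ b i) (h : ∀ i, Tendsto (fun k => F k i) atTop (𝓝 (g i))) :
    Tendsto (fun k => ∑' i, F k i) atTop (𝓝 (∑' i, g i)) := by
  simp only [← lintegral_count]
  refine tendsto_lintegral_of_dominated_convergence b (fun k => measurable_from_top)
    (fun k => ae_of_all _ (hF k)) ?_ (ae_of_all _ h)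
  rwa [lintegral_count]

namespace Network

variable {N : ℕ} {S : Network N} {μ : Measure (Mark N)}

variable (S) in
theorem delta_top (q : ℝ) : S.delta ⊤ q = q := if_pos rfl

variable (S) in
theorem tendsto_delta (q : ℝ) : Tendsto (fun k : ℕ => S.delta k q) atTop (𝓝 q) := by
  have hL := S.L_pos
  have h1 : Tendsto (fun k : ℕ => q - S.L / k) atTop (𝓝 (q - 0)) :=
    tendsto_const_nhds.sub (tendsto_const_div_atTop_nhds_zero_nat S.L)
  rw [sub_zero] at h1
  have hd : ∀ k : ℕ, S.delta k q = ⌊q * k / S.L⌋ * (S.L / k) := fun k => by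
    rw [delta, if_neg (by simp), ENat.toNat_natCast]
  refine tendsto_of_tendsto_of_tendsto_of_le_of_le' h1 tendsto_const_nhds ?_ ?_
  · filter_upwards [eventually_gt_atTop 0] with k hk
    have hk' : (0 : ℝ) < k := by exact_mod_cast hk
    rw [hd]
    have h2 : q * k / S.L - 1 ≤ ⌊q * k / S.L⌋ := (Int.sub_one_lt_floor _).le
    calc q - S.L / k = (q * k / S.L - 1) * (S.L / k) := by field_simp
      _ ≤ _ := by gcongr
  · filter_upwards [eventually_gt_atTop 0] with k hk
    have hk' : (0 : ℝ) < k := by exact_mod_cast hk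
    rw [hd]
    calc (⌊q * k / S.L⌋ : ℝ) * (S.L / k) ≤ q * k / S.L * (S.L / k) := by
          gcongr; exact Int.floor_le _
      _ = q := by field_simp

variable (S) in
/-- A fine discretization does not change the order of two points. -/
theorem eventually_delta_cmp (r p : ℝ) : ∀ᶠ k : ℕ in atTop,
    (S.delta k r < S.delta k p ↔ r < p) ∧ (S.delta k r = S.delta k p ↔ r = p) := by
  rcases lt_trichotomy r p with h | h | h
  · filter_upwards [(S.tendsto_delta r).eventually_lt (S.tendsto_delta p) h] with k hk
    exact ⟨iff_of_true hk h, iff_of_false hk.ne h.ne⟩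
  · subst h
    simp
  · filter_upwards [(S.tendsto_delta p).eventually_lt (S.tendsto_delta r) h] with k hk
    exact ⟨iff_of_false hk.not_gt h.not_gt, iff_of_false hk.ne' h.ne'⟩

variable (S) in
theorem eventually_nextCycle (m : ℕ) (r : ℝ) (j : Fin N) (y : ℝ) : ∀ᶠ k : ℕ in atTop,
    nextCycle (m, S.delta k r, j) (S.delta k y) = nextCycle (m, r, j) y := by
  filter_upwards [S.eventually_delta_cmp r y] with k hk
  simp only [nextCycle, hk.1, hk.2]

variable (S) in
theorem eventually_lag (u : User N) (j : Fin N) :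
    ∀ᶠ k : ℕ in atTop, S.lag k u j = S.lag ⊤ u j := by
  have h := eventually_all.2 fun i : Fin N =>
    S.eventually_delta_cmp (pos u.2 i) (pos u.2 (prev i))
  filter_upwards [h] with k hk
  unfold lag
  congr 1
  ext i
  simp only [mem_ofPred_eq, delta_top, le_iff_lt_or_eq, (hk i).1, (hk i).2]

variable [NeZero N]

/-- Pointwise convergence, along ever finer discretizations, of functions of the visits. -/
def VisitTendsto (S : Network N) (f : ℕ∞ → ℕ × ℝ × Fin N → ℝ≥0∞) : Prop :=
  ∀ m r j, Tendsto (fun k : ℕ => f k (m, S.delta k r, j)) atTop (𝓝 (f ⊤ (m, r, j)))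

theorem VisitTendsto.total {f : ℕ∞ → ℕ × ℝ × Fin N → ℝ≥0∞} (hf : S.VisitTendsto f) (m : Mark N)
    (i : ℕ) : Tendsto (fun k : ℕ => S.total k (f k) m i) atTop (𝓝 (S.total ⊤ (f ⊤) m i)) := by
  unfold Network.total
  refine tendsto_finsetSum _ fun j _ => ENNReal.Tendsto.const_mul ?_ (Or.inr ENNReal.coe_ne_top)
  unfold visit
  rw [delta_top]
  refine (hf _ _ _).congr' ?_
  filter_upwards [S.eventually_lag (0, m) j] with k hk
  rw [hk]

/-- For each mark, the cycle of first service is eventually that of the mixed system, since it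
depends only on the order of two points. The weight is at most `2`, which gives an integrable
majorant. -/
theorem visitTendsto_meanValue {n : ℕ} {W : ℕ∞ → Mark N → ℕ → ℝ≥0∞} {w : Mark N → ℝ≥0∞}
    (hWm : ∀ σ i, Measurable fun m => W σ m i) (hw : ∫⁻ m, w m ∂μ ≠ ⊤)
    (hW : ∀ σ m i, W σ m i ≤ w m * wt n i) (hwm : Measurable w)
    (h : ∀ m i, Tendsto (fun k : ℕ => W k m i) atTop (𝓝 (W ⊤ m i))) :
    S.VisitTendsto fun σ => S.meanValue σ μ (W σ) := by
  intro c r j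
  unfold meanValue
  refine tendsto_lintegral_of_dominated_convergence (fun m => w m * 2)
    (fun k => measurable_meanValue_arg (hWm k) _) (fun k => ae_of_all _ fun m => ?_) ?_
    (ae_of_all _ fun m => ?_)
  · exact (hW _ _ _).trans (mul_le_mul_right (wt_le_two _ _) _)
  · rw [lintegral_mul_const _ hwm]
    finiteness
  · rw [delta_top]
    refine (h m _).congr' ?_
    filter_upwards [S.eventually_nextCycle c r j (pos m 0)] with k hk
    rw [hk]

section Resolvent

variable [SFinite μ] {n : ℕ} {c : ℝ≥0∞} {f : ℕ∞ → ℕ × ℝ × Fin N → ℝ≥0∞}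

theorem VisitTendsto.offspring (hl : S.IsLight μ) (hc : c ≠ ⊤) (hf : S.VisitTendsto f)
    (hm : ∀ σ, Measurable (f σ)) (hle : ∀ σ e, f σ e ≤ c * wt n e.1) :
    S.VisitTendsto fun σ => S.offspring σ μ (f σ) := by
  have hw : ∫⁻ m, totalSvc m * (2 ^ N * c) ∂μ ≠ ⊤ := by
    rw [lintegral_mul_const _ measurable_totalSvc.coe_nnreal_ennreal]
    have := hl.lintegral_totalSvc_ne_top
    finiteness
  have h := visitTendsto_meanValue (S := S) (μ := μ) (n := n) (W := fun σ => S.total σ (f σ))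
    (fun σ => S.measurable_total σ (hm σ)) hw
    (fun σ m i => (total_le (hle σ) m i).trans_eq (by ring))
    (measurable_totalSvc.coe_nnreal_ennreal.mul_const _) hf.total
  exact fun m r j => ENNReal.Tendsto.const_mul (h m r j) (Or.inr ENNReal.ofReal_ne_top)

theorem VisitTendsto.iterate_offspring (hl : S.IsLight μ) (hc : c ≠ ⊤) (hf : S.VisitTendsto f)
    (hm : ∀ σ, Measurable (f σ)) (hle : ∀ σ e, f σ e ≤ c * wt n e.1) (i : ℕ) :
    S.VisitTendsto fun σ => (S.offspring σ μ)^[i] (f σ) := by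
  induction i with
  | zero => exact hf
  | succ i ih =>
    simp only [Function.iterate_succ_apply']
    exact ih.offspring hl (c := 2⁻¹ ^ i * c) (by finiteness)
      (fun σ => measurable_iterate_offspring (hm σ) i) fun σ => iterate_offspring_le hl (hle σ) i

/-- Each generation converges, and the contraction bounds the generations by a geometric series that
is the same for all discretizations. -/
theorem VisitTendsto.resolvent (hl : S.IsLight μ) (hc : c ≠ ⊤) (hf : S.VisitTendsto f)
    (hm : ∀ σ, Measurable (f σ)) (hle : ∀ σ e, f σ e ≤ c * wt n e.1) :
    S.VisitTendsto fun σ => S.resolvent σ μ (f σ) := by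
  intro m r j
  unfold Network.resolvent
  refine tendsto_tsum_of_dominated (b := fun i => 2⁻¹ ^ i * (c * wt n m)) ?_ (fun k i => ?_)
    fun i => hf.iterate_offspring hl hc hm hle i m r j
  · rw [ENNReal.tsum_mul_right, ENNReal.tsum_geometric, ENNReal.one_sub_inv_two, inv_inv]
    have := (wt_le_two n m).trans_lt ENNReal.ofNat_lt_top
    finiteness
  · exact (iterate_offspring_le hl (hle k) i _).trans_eq (by ring)

variable (S) in
theorem visitTendsto_passes (n : ℕ) (q : ℝ) :
    S.VisitTendsto fun σ => passes n (S.delta σ q) := by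
  intro m r j
  refine tendsto_const_nhds.congr' ?_
  filter_upwards [S.eventually_nextCycle m r j q] with k hk
  simp only [passes, hk, delta_top]

theorem visitTendsto_influence (hl : S.IsLight μ) (n : ℕ) (q : ℝ) :
    S.VisitTendsto fun σ => S.influence σ μ n (S.delta σ q) :=
  (S.visitTendsto_passes n q).resolvent hl ENNReal.one_ne_top
    (fun _ => measurable_passes n _) fun _ => passes_le n _

theorem visitTendsto_meanSq (hl : S.IsLight μ) (n : ℕ) (q : ℝ) :
    S.VisitTendsto fun σ => S.meanSq σ μ n (S.delta σ q) := by
  have hm : Measurable fun m : Mark N => (totalSvc m : ℝ≥0∞) ^ 2 :=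
    measurable_totalSvc.coe_nnreal_ennreal.pow_const 2
  have hw : ∫⁻ m, (totalSvc m : ℝ≥0∞) ^ 2 * (2 * (2 ^ (N + 1)) ^ 2) ∂μ ≠ ⊤ := by
    rw [lintegral_mul_const _ hm]
    have := hl.sq
    finiteness
  have h := visitTendsto_meanValue (S := S) (μ := μ) (n := n)
    (W := fun σ m i => S.total σ (S.influence σ μ n (S.delta σ q)) m i ^ 2)
    (fun σ => measurable_sq_total n _) hw
    (fun σ m i => sq_total_influence_le hl n _ m i) (hm.mul_const _)
    fun m i => (ENNReal.continuous_pow 2).continuousAt.tendsto.comp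
      ((visitTendsto_influence hl n q).total m i)
  exact fun m r j => ENNReal.Tendsto.const_mul (h m r j) (Or.inr ENNReal.ofReal_ne_top)

theorem visitTendsto_varInfluence (hl : S.IsLight μ) (n : ℕ) (q : ℝ) :
    S.VisitTendsto fun σ => S.varInfluence σ μ n (S.delta σ q) :=
  (visitTendsto_meanSq hl n q).resolvent hl hl.sqBound_ne_top
    (fun _ => measurable_meanSq n _) fun _ => meanSq_le hl n _

/-- The limits of the second moments of the cycle times depend continuously on the discretization. -/
theorem tendsto_limitMoment (hl : S.IsLight μ) (q : ℝ) :
    Tendsto (fun k : ℕ => S.limitMoment k μ (S.delta k q)) atTop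
      (𝓝 (S.limitMoment ⊤ μ (S.delta ⊤ q))) := by
  have hU : ∀ d, Tendsto (fun k : ℕ => ∫⁻ m, S.total k (S.influence k μ d (S.delta k q)) m 1 ∂μ)
      atTop (𝓝 (∫⁻ m, S.total ⊤ (S.influence ⊤ μ d (S.delta ⊤ q)) m 1 ∂μ)) := by
    intro d
    refine tendsto_lintegral_of_dominated_convergence (fun m => totalSvc m * 2 ^ (N + 1) * wt d 1)
      (fun k => S.measurable_total k (measurable_influence d _) 1)
      (fun k => ae_of_all _ fun m => total_influence_le hl d _ m 1) ?_
      (ae_of_all _ fun m => (visitTendsto_influence hl d q).total m 1)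
    rw [lintegral_mul_const _ (measurable_totalSvc.coe_nnreal_ennreal.mul_const _)]
    have := hl.lintegral_mul_ne_top
    have := (wt_le_two d 1).trans_lt ENNReal.ofNat_lt_top
    finiteness
  have hV : ∀ d, Tendsto (fun k : ℕ => ∫⁻ m, S.varValue k μ d (S.delta k q) m 1 ∂μ)
      atTop (𝓝 (∫⁻ m, S.varValue ⊤ μ d (S.delta ⊤ q) m 1 ∂μ)) := by
    intro d
    refine tendsto_lintegral_of_dominated_convergence (fun m => S.varBound μ m * wt d 1)
      (fun k => measurable_varValue d _ 1)
      (fun k => ae_of_all _ fun m => varValue_le hl d _ m 1) ?_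
      (ae_of_all _ fun m => ?_)
    · rw [lintegral_mul_const _ measurable_varBound]
      have := hl.lintegral_varBound_ne_top
      have := (wt_le_two d 1).trans_lt ENNReal.ofNat_lt_top
      finiteness
    · exact ((ENNReal.continuous_pow 2).continuousAt.tendsto.comp
        ((visitTendsto_influence hl d q).total m 1)).add
        ((visitTendsto_varInfluence hl d q).total m 1)
  have h1 := tendsto_tsum_of_dominated (tsum_wt_one_lt_top _ hl.lintegral_mul_ne_top)
    (fun k d => lintegral_total_le (σ := k) hl d (S.delta k q)) hU
  have h2 := tendsto_tsum_of_dominated (tsum_wt_one_lt_top _ hl.lintegral_varBound_ne_top)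
    (fun k d => lintegral_varValue_le (σ := k) hl d (S.delta k q)) hV
  unfold limitMoment limitMean limitVar
  refine ((ENNReal.continuous_pow 2).continuousAt.tendsto.comp (tendsto_const_nhds.add ?_)).add ?_
  · exact ENNReal.Tendsto.const_mul (ENNReal.Tendsto.const_mul h1 (Or.inr ENNReal.coe_ne_top))
      (Or.inr ENNReal.ofReal_ne_top)
  · exact ENNReal.Tendsto.const_mul (ENNReal.Tendsto.const_mul h2 (Or.inr ENNReal.coe_ne_top))
      (Or.inr ENNReal.ofReal_ne_top)

end Resolvent

end Network

end

/-! ### The threshold for the service times -/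

section

namespace Network

variable {N : ℕ} [NeZero N]

/-- The bound of the second moments of the service times under which the system is light is the square
of this number. -/
def lightThreshold (S : Network N) : ℝ≥0 := (S.lam.toNNReal * (2 ^ (N + 3) * N))⁻¹

theorem lightThreshold_pos (S : Network N) : 0 < S.lightThreshold := by
  have h1 : 0 < S.lam.toNNReal := Real.toNNReal_pos.2 S.lam_pos
  have h2 : 0 < (N : ℝ≥0) := by exact_mod_cast Nat.pos_of_ne_zero (NeZero.ne N)
  unfold lightThreshold
  positivity

theorem isLight_markLaw {S : Network N} {κ : Fin N → Kernel ℝ ℝ≥0} [∀ j, IsMarkovKernel (κ j)]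
    (h : ∀ j, S.secondMoment κ j < (S.lightThreshold ^ 2 : ℝ≥0)) : S.IsLight (S.markLaw κ) := by
  set ε := S.lightThreshold with hε
  have hε0 : 0 < ε := S.lightThreshold_pos
  have hsq : ∀ j, ∫⁻ m, (svc m j : ℝ≥0∞) ^ 2 ∂S.markLaw κ = S.secondMoment κ j := fun j =>
    lintegral_markLaw κ j (f := fun _ b => (b : ℝ≥0∞) ^ 2)
      (measurable_snd.coe_nnreal_ennreal.pow_const 2)
  have hsm : ∀ j, Measurable fun m : Mark N => (svc m j : ℝ≥0∞) := fun j =>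
    (measurable_svc j).coe_nnreal_ennreal
  constructor
  · have hj : ∀ j, ∫⁻ m, (svc m j : ℝ≥0∞) ∂S.markLaw κ ≤ (2 * ε : ℝ≥0) := by
      intro j
      -- Either `b ≤ ε` or `b ≤ b² / ε`; a second moment below `ε²` thus gives a mean of at most `2
      -- ε`.
      have h1 : ∀ b : ℝ≥0, b ≤ ε + ε⁻¹ * b ^ 2 := by
        intro b
        rcases le_total b ε with hb | hb
        · exact hb.trans le_self_add
        · refine le_trans ?_ le_add_self
          calc b = ε⁻¹ * (ε * b) := by rw [inv_mul_cancel_left₀ hε0.ne']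
            _ ≤ ε⁻¹ * (b * b) := by gcongr
            _ = ε⁻¹ * b ^ 2 := by ring
      calc ∫⁻ m, (svc m j : ℝ≥0∞) ∂S.markLaw κ
          ≤ ∫⁻ m, ((ε : ℝ≥0∞) + (ε⁻¹ : ℝ≥0) * (svc m j : ℝ≥0∞) ^ 2) ∂S.markLaw κ :=
            by
            refine lintegral_mono fun m => ?_
            have h6 := ENNReal.coe_le_coe.2 (h1 (svc m j))
            rw [ENNReal.coe_add, ENNReal.coe_mul, ENNReal.coe_pow] at h6
            exact h6
        _ = ε + (ε⁻¹ : ℝ≥0) * S.secondMoment κ j := by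
            rw [lintegral_add_left measurable_const, lintegral_const_mul _ ((hsm j).pow_const 2),
              hsq, lintegral_const, measure_univ, mul_one]
        _ ≤ ε + (ε⁻¹ : ℝ≥0) * (ε ^ 2 : ℝ≥0) := by gcongr; exact (h j).le
        _ = (2 * ε : ℝ≥0) := by
            norm_cast
            rw [sq, inv_mul_cancel_left₀ hε0.ne', two_mul]
    have hsum : ∫⁻ m, totalSvc m ∂S.markLaw κ ≤ (N * (2 * ε) : ℝ≥0) := by
      unfold totalSvc
      push_cast
      rw [lintegral_finsetSum _ fun j _ => hsm j]
      refine (Finset.sum_le_sum fun j _ => hj j).trans ?_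
      simp
    -- The exponent `N + 3` of the threshold absorbs `2 ^ (N + 1)`, the factor in `2 ε`, and the
    -- required `1/2`.
    have h2 : S.lam.toNNReal * (2 ^ (N + 1) * (N * (2 * ε))) = 2⁻¹ := by
      have h3 : S.lam.toNNReal ≠ 0 := (Real.toNNReal_pos.2 S.lam_pos).ne'
      have h4 : (N : ℝ≥0) ≠ 0 := by exact_mod_cast NeZero.ne N
      rw [hε, lightThreshold]
      field_simp
      ring
    calc ENNReal.ofReal S.lam * (2 ^ (N + 1) * ∫⁻ m, totalSvc m ∂S.markLaw κ)
        ≤ (S.lam.toNNReal : ℝ≥0∞) * (2 ^ (N + 1) * (N * (2 * ε) : ℝ≥0)) := by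
          rw [ENNReal.ofReal]
          gcongr
      _ = ((S.lam.toNNReal * (2 ^ (N + 1) * (N * (2 * ε))) : ℝ≥0) : ℝ≥0∞) := by push_cast; rfl
      _ ≤ 2⁻¹ := by
          rw [h2, ENNReal.coe_inv two_ne_zero]
          simp
  · refine ne_top_of_le_ne_top (b := N * ∑ j, S.secondMoment κ j) ?_ ?_
    · exact ENNReal.mul_ne_top (by simp) (ENNReal.sum_ne_top.2 fun j _ => (h j).ne_top)
    · calc ∫⁻ m, (totalSvc m : ℝ≥0∞) ^ 2 ∂S.markLaw κ
          ≤ ∫⁻ m, N * ∑ j, (svc m j : ℝ≥0∞) ^ 2 ∂S.markLaw κ := by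
            refine lintegral_mono fun m => ?_
            have h5 := sq_sum_le_card_mul_sum_sq (s := Finset.univ) (f := fun j => svc m j)
            rw [Finset.card_univ, Fintype.card_fin] at h5
            have h6 := ENNReal.coe_le_coe.2 h5
            unfold totalSvc
            push_cast at h6 ⊢
            exact h6
        _ = N * ∑ j, S.secondMoment κ j := by
            rw [lintegral_const_mul _ (Finset.measurable_sum _ fun j _ => (hsm j).pow_const 2),
              lintegral_finsetSum _ fun j _ => (hsm j).pow_const 2]
            simp only [hsq]

end Network

end

end Polling

end

theorem theorem3 {N : ℕ} [NeZero N] (S : Polling.Network N) :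
    ∃ πbar : ℝ≥0, 0 < πbar ∧
      ∀ (κ : Fin N → Kernel ℝ ℝ≥0) [∀ j, IsMarkovKernel (κ j)],
        (∀ j, S.secondMoment κ j < πbar) →
        ∀ ν : ℕ∞ → Measure (Polling.Config N),
          (∀ σ : ℕ∞, σ ≠ 0 → S.IsPalmStationary κ σ (ν σ)) →
          ∃ s : ℕ → ℕ, StrictMono s ∧ (∀ k, 0 < s k) ∧
            (∀ᵐ q ∂S.P 0,
              S.cycleSecondMoment κ ⊤ (ν ⊤) q ≠ ⊤ ∧
              Tendsto (fun k => S.cycleSecondMoment κ (s k) (ν (s k)) q) atTop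
                (𝓝 (S.cycleSecondMoment κ ⊤ (ν ⊤) q))) ∧
            ∃ (σbar : ℕ) (ωbar : ℝ≥0), ∀ k, σbar < s k → ∀ q ∈ Ico 0 S.L,
              S.cycleSecondMoment κ (s k) (ν (s k)) q ≤ ωbar := by
  refine ⟨S.lightThreshold ^ 2, pow_pos S.lightThreshold_pos 2, ?_⟩
  intro κ _ hκ ν hν
  have hl : S.IsLight (S.markLaw κ) := Polling.Network.isLight_markLaw hκ
  have heq : ∀ σ : ℕ∞, σ ≠ 0 → ∀ q ∈ Ico 0 S.L, S.cycleSecondMoment κ σ (ν σ) q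
      = S.limitMoment σ (S.markLaw κ) (S.delta σ q) := fun σ hσ q hq =>
    (hν σ hσ).cycleSecondMoment_eq hl hσ hq
  have hne : ∀ k : ℕ, ((k + 1 : ℕ) : ℕ∞) ≠ 0 := fun k => by simp
  have hb : S.limitBound (S.markLaw κ) ≠ ⊤ := hl.limitBound_ne_top
  -- The whole sequence converges; the shift by one only skips the level `0`. The uniform bound
  -- holds from the first level on.
  refine ⟨fun k => k + 1, fun _ _ h => Nat.succ_lt_succ h, fun k => k.succ_pos, ?_, 0,
    (S.limitBound (S.markLaw κ)).toNNReal, fun k _ q hq => ?_⟩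
  · filter_upwards [S.ae_mem_Ico 0] with q hq
    simp only [heq _ (hne _) q hq, heq ⊤ (by simp) q hq]
    exact ⟨ne_top_of_le_ne_top hb (Polling.Network.limitMoment_le hl _),
      (Polling.Network.tendsto_limitMoment hl q).comp (tendsto_add_atTop_nat 1)⟩
  · rw [heq _ (hne k) q hq, ENNReal.coe_toNNReal hb]
    exact Polling.Network.limitMoment_le hl _
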